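/- **Singular knots.** A *singular knot* $K$ is the image of a piecewise linear immersion of finitely many circles in $\mathbb R^3$ (so $K$ may be disconnected and is not oriented) without triple points and with finitely many double points, called *singular points*, such that near each singular point $B$ the set $K$ lies in a plane $T_B\ni B$ (which may be folded along a line through $B$, i.e. be the union of two half-planes with this line as common boundary), in which the two branches of $K$ through $B$ cross each other: the four arcs of $K$ issuing from $B$ alternate between the two branches in the cyclic order. The plane $T_B$ (the *template* of $B$) is part of the structure. An *ambient PL isotopy* is a continuous family of PL homeomorphisms $\phi_t:\mathbb R^3\to\mathbb R^3$, $t\in[0,1]$, with $\phi_0=\mathrm{id}$. **Three-page embeddings.** Let $P_0,P_1,P_2$ be the half-planes $\{z=0,\,y\ge0\}$, $\{y=0,\,z\ge0\}$, $\{z=0,\,y\le0\}$ with common boundary the $x$-axis $\alpha$, oriented by $x$; let $\mathbb Y=P_0\cup P_1\cup P_2$, and take indices in $\mathbb Z_3$. A homeomorphism $h$ of $\mathbb R^3$ is a *three-page embedding* of $K$ if $h(K)\subset\mathbb Y$ and 1. all the images of singular points lie on $\alpha$; 2. $h(K)\cap\alpha$ is finite; 3. at every point of $h(K)\cap\alpha$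 that is not the image of a singular point, the two arcs of $h(K)$ are straight near this point and lie in different half-planes; 4. for every singular point $B$ there is $i\in\mathbb Z_3$ such that a neighbourhood of $h(B)$ in $h(K)$ lies in $P_{i-1}\cup P_{i+1}$, and $h$ takes the germ of $T_B$ at $B$ onto the germ of $P_{i-1}\cup P_{i+1}$ at $h(B)$; 5. for each $i$, on each connected component of $h(K)\cap P_i$ the orthogonal projection to $\alpha$ is strictly monotone. **Words.** Let $\mathbb A=\{a_i,b_i,c_i,d_i,x_i\mid i\in\mathbb Z_3\}$. A letter describes how a set looks near a point of $\alpha$, namely as a union of straight arcs issuing from it, one for each entry of the following list, where $j^-$ and $j^+$ mean an arc in $P_j$ going to the left, resp. to the right (along $\alpha$): $a_i:\ (i-1)^+,(i+1)^+$; $\ b_i:\ (i-1)^-,(i+1)^+$; $\ c_i:\ (i-1)^-,(i+1)^-$; $\ d_i:\ (i-1)^+,(i+1)^-$; $\ x_i:\ (i-1)^\pm,(i+1)^\pm$. A three-page embedding is *encoded* by the word formed by the letters of its points on $\alpha$, from left to right. A word is *balanced* if for each $i\in\mathbb Z_3$ the substitution $a_i,b_i,c_i,d_i,x_i\to\varnothing$;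 $a_{i\pm1},b_{i-1},d_{i+1}\to($; $b_{i+1},c_{i\pm1},d_{i-1}\to)$; $x_{i\pm1}\to)($ gives a correctly balanced bracket expression. **The semigroup $SK$** is the semigroup with unit generated by $\mathbb A$ with the relations, for $i\in\mathbb Z_3$: $a_i=a_{i+1}d_{i-1}$, $b_i=a_{i-1}c_{i+1}$, $c_i=b_{i-1}c_{i+1}$, $d_i=a_{i+1}c_{i-1}$; $x_i=d_{i+1}x_{i-1}b_{i+1}$; $d_0d_1d_2=1$; $b_id_i=d_ib_i=1$; $d_ix_id_i=a_i(d_ix_id_i)c_i$, $b_ix_ib_i=a_i(b_ix_ib_i)c_i$; $x_i$ commutes with $d_{i+1}d_id_{i-1}$; $d_ic_i$ commutes with $c_{i+1},x_{i+1},b_id_{i+1}d_i$; $a_ib_i$ and $d_ix_ib_i$ commute with $a_{i+1},b_{i+1},c_{i+1},x_{i+1},b_id_{i+1}d_i$; $b_{i+1}d_{i-1}d_{i+1}b_{i-1}$ commutes with $a_i,b_i,c_i,x_i,b_{i-1}d_id_{i-1}$. **Theorem 1.** For every singular knot $K$ there are an ambient PL isotopy $(\phi_t)$ and a word $w$ in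 the alphabet $\mathbb A$ such that $\phi_1$ is a three-page embedding of $K$, the word $w$ encodes $\phi_1(K)$, and $w$ is balanced. Hence $K$ is represented by an element of $SK$, the class of $w$. -/

import Mathlib

open Set Topology

noncomputable section

namespace ThreePage

/-- Euclidean space `ℝ³`; only its topology and its affine structure are used. -/
abbrev Space : Type := Fin 3 → ℝ

/-! ### Singular knots -/

/-- Finitely many closed polygonal lines, given by cyclically ordered vertices:
each cycle of the permutation `next` is one polygon, and the vertex `s` is joined to the
vertex `next s` by a straight edge. The orientation is only a device of the description. -/
structure ClosedPolygons where
  size : ℕ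
  next : Equiv.Perm (Fin size)
  vertex : Fin size → Space

namespace ClosedPolygons

variable (L : ClosedPolygons)

/-- The edge that starts at the vertex `s`. -/
def edge (s : Fin L.size) : Set Space := segment ℝ (L.vertex s) (L.vertex (L.next s))

/-- The disjoint union of the circles that are mapped to space: `(s, t)` is the point of
the edge `s` at the parameter `t ∈ [0, 1)`. -/
abbrev Param : Type := Fin L.size × Set.Ico (0 : ℝ) 1

/-- The map from the circles to space. -/
def point (x : L.Param) : Space :=
  AffineMap.lineMap (L.vertex x.1) (L.vertex (L.next x.1)) (x.2 : ℝ)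

/-- The image of the circles. -/
def carrier : Set Space := Set.range L.point

/-- The map is an immersion (it is locally injective): edges are not degenerate, and
consecutive edges meet only in their common vertex. -/
def IsImmersion : Prop :=
  (∀ s, L.vertex s ≠ L.vertex (L.next s)) ∧
    ∀ s, L.edge s ∩ L.edge (L.next s) ⊆ {L.vertex (L.next s)}

/-- The points of space through which the circles pass more than once. -/
def singularPoints : Set Space :=
  {B | ∃ x y : L.Param, x ≠ y ∧ L.point x = B ∧ L.point y = B}

/-- The direction of the arc that leaves the point `x` along the orientation. -/
def forward (x : L.Param) : Space := L.vertex (L.next x.1) - L.vertex x.1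

/-- The direction of the arc that leaves the point `x` against the orientation. -/
def backward (x : L.Param) : Space :=
  open Classical in
  if (x.2 : ℝ) = 0 then L.vertex (L.next.symm x.1) - L.vertex x.1
  else L.vertex x.1 - L.vertex (L.next x.1)

end ClosedPolygons

/-- The map of the coordinate plane to space that is linear on the upper half-plane, linear on
the lower one, and sends `(1, 0)`, `(0, 1)`, `(0, -1)` to `e`, `f`, `g`. If it is injective, its
image is the union of two half-planes bounded by the line through `e`: a plane folded along
this line, and a flat plane in the special case `g = -f`. -/
def fold (e f g : Space) (q : ℝ × ℝ) : Space :=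
  q.1 • e + max q.2 0 • f + max (-q.2) 0 • g

/-- The two branches through `B = L.point x = L.point y` lie near `B` in the (possibly
folded) plane `T`, and cross each other there: the four arcs that issue from `B` have four
different directions in `T`, and the arcs of the two branches alternate in the cyclic order. -/
def ClosedPolygons.CrossIn (L : ClosedPolygons) (T : Set Space) (B : Space)
    (x y : L.Param) : Prop :=
  ∃ e f g : Space, Function.Injective (fold e f g) ∧
    T = Set.range (fun q => B + fold e f g q) ∧
    ∃ θ r : Fin 4 → ℝ, (∀ k, 0 < r k) ∧
      θ 0 < θ 1 ∧ θ 1 < θ 2 ∧ θ 2 < θ 3 ∧ θ 3 < θ 0 + 2 * Real.pi ∧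
      L.forward x = r 0 • fold e f g (Real.cos (θ 0), Real.sin (θ 0)) ∧
      L.forward y = r 1 • fold e f g (Real.cos (θ 1), Real.sin (θ 1)) ∧
      L.backward x = r 2 • fold e f g (Real.cos (θ 2), Real.sin (θ 2)) ∧
      L.backward y = r 3 • fold e f g (Real.cos (θ 3), Real.sin (θ 3))

/-- A singular knot (possibly with several components): a piecewise linear immersion of
finitely many circles in `ℝ³` without triple points, with finitely many double points (the
singular points), at each of which the two branches cross in a plane, which may be folded
along a line. This plane is the template that a rigid isotopy has to respect; the values of
`template` away from the singular points play no role. -/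
structure SingularKnot extends ClosedPolygons where
  immersion : toClosedPolygons.IsImmersion
  double : ∀ B : Space, {x | toClosedPolygons.point x = B}.encard ≤ 2
  finite : toClosedPolygons.singularPoints.Finite
  template : Space → Set Space
  cross : ∀ B ∈ toClosedPolygons.singularPoints, ∃ x y : toClosedPolygons.Param, x ≠ y ∧
    toClosedPolygons.point x = B ∧ toClosedPolygons.point y = B ∧
    toClosedPolygons.CrossIn (template B) B x y

/-! ### Ambient piecewise linear isotopies -/

/-- A closed convex polyhedron: a finite intersection of closed half-spaces. -/
def IsPolyhedron (C : Set Space) : Prop :=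
  ∃ F : Finset (Space →ᵃ[ℝ] ℝ), C = {y | ∀ l ∈ F, 0 ≤ l y}

/-- A piecewise linear map: every point has a neighbourhood covered by finitely many closed
convex polyhedra on each of which the map is affine. -/
def IsPL (h : Space → Space) : Prop :=
  ∀ p : Space, ∃ 𝒞 : Set (Set Space), 𝒞.Finite ∧ ⋃₀ 𝒞 ∈ 𝓝 p ∧
    ∀ C ∈ 𝒞, IsPolyhedron C ∧ ∃ A : Space →ᵃ[ℝ] Space, Set.EqOn h A C

/-- An ambient PL isotopy: a continuous family of PL homeomorphisms of `ℝ³`, parametrized by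
`[0, 1]`, that starts at the identity. -/
structure AmbientPLIsotopy where
  map : unitInterval → Space ≃ₜ Space
  continuous_map : Continuous fun q : unitInterval × Space => map q.1 q.2
  isPL : ∀ t, IsPL (map t)
  map_zero : map 0 = Homeomorph.refl Space

/-! ### The book with three pages -/

/-- The axis of the book, oriented by the first coordinate. -/
def axis : Set Space := {p | p 1 = 0 ∧ p 2 = 0}

/-- The point of the axis with the given coordinate. -/
def axisPoint (u : ℝ) : Space := ![u, 0, 0]

/-- The three pages: three half-planes with the axis as their common boundary. The page `0` is
the upper half and the page `2` is the lower half of a plane, the page `1` is at the reader's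
side. -/
def page (i : ZMod 3) : Set Space :=
  if i = 0 then {p | p 2 = 0 ∧ 0 ≤ p 1}
  else if i = 1 then {p | p 1 = 0 ∧ 0 ≤ p 2}
  else {p | p 2 = 0 ∧ p 1 ≤ 0}

/-- The book with three pages. -/
def book : Set Space := ⋃ i, page i

/-- Near the point `A` the set `X` is the union of the rays that issue from `A` in the
directions of `V`. -/
def LooksLike (X : Set Space) (A : Space) (V : Set Space) : Prop :=
  ∀ᶠ p in 𝓝 A, p ∈ X ↔ ∃ v ∈ V, ∃ r : ℝ, 0 ≤ r ∧ p = A + r • v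

/-- The homeomorphism `h` of `ℝ³` places the singular knot `K` in the book as a three-page
embedding. -/
structure IsThreePageEmbedding (K : SingularKnot) (h : Space ≃ₜ Space) : Prop where
  /-- The image lies in the book. -/
  subset_book : h '' K.carrier ⊆ book
  /-- All singular points lie on the axis. -/
  singular_mem_axis : h '' K.singularPoints ⊆ axis
  /-- Finiteness. -/
  finite_inter_axis : (h '' K.carrier ∩ axis).Finite
  /-- At a non-singular point on the axis the two arcs lie in different half-planes. -/
  regular : ∀ A ∈ h '' K.carrier ∩ axis, A ∉ h '' K.singularPoints →
    ∃ i j : ZMod 3, i ≠ j ∧ ∃ u ∈ page i \ axis, ∃ v ∈ page j \ axis,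
      LooksLike (h '' K.carrier) A {u, v}
  /-- A neighbourhood of a singular point lies in the plane formed by two pages, and `h` takes
  the template of this singular point to that plane. -/
  singular : ∀ B ∈ K.singularPoints, ∃ i : ZMod 3,
    (∀ᶠ p in 𝓝 (h B), p ∈ h '' K.carrier → p ∈ page (i - 1) ∪ page (i + 1)) ∧
    ∀ᶠ q in 𝓝 B, q ∈ K.template B ↔ h q ∈ page (i - 1) ∪ page (i + 1)
  /-- Monotonicity: on every connected component of the part in one page the orthogonal
  projection to the axis is injective (hence, on an arc, strictly monotone). -/
  monotone : ∀ i : ZMod 3, ∀ p ∈ h '' K.carrier ∩ page i,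
    Set.InjOn (fun q : Space => q 0) (connectedComponentIn (h '' K.carrier ∩ page i) p)

/-! ### Words -/

/-- The alphabet with 15 letters. -/
inductive Letter : Type
  | a (i : ZMod 3)
  | b (i : ZMod 3)
  | c (i : ZMod 3)
  | d (i : ZMod 3)
  | x (i : ZMod 3)

/-- The two directions of the axis; `right` is the positive one. -/
inductive Side : Type
  | left
  | right

/-- The arcs in the local picture of a letter: the pages in which they lie and the sides to
which they go. -/
def Letter.arcs : Letter → Set (ZMod 3 × Side)
  | .a i => {(i - 1, .right), (i + 1, .right)}
  | .b i => {(i - 1, .left), (i + 1, .right)}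
  | .c i => {(i - 1, .left), (i + 1, .left)}
  | .d i => {(i - 1, .right), (i + 1, .left)}
  | .x i => {(i - 1, .left), (i - 1, .right), (i + 1, .left), (i + 1, .right)}

/-- The directions of arcs in a given page that go to a given side. -/
def arcDirections : ZMod 3 × Side → Set Space
  | (j, .left) => {v | v ∈ page j ∧ v ∉ axis ∧ v 0 < 0}
  | (j, .right) => {v | v ∈ page j ∧ v ∉ axis ∧ 0 < v 0}

/-- Near the point `A` of the axis the set `X` is the picture of the given letter. -/
def HasLetter (X : Set Space) (A : Space) (l : Letter) : Prop :=
  ∃ v : ZMod 3 × Side → Space, (∀ k ∈ l.arcs, v k ∈ arcDirections k) ∧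
    LooksLike X A (v '' l.arcs)

/-- The word `w` encodes `X`: its letters are, one by one, those of the intersection points
of `X` with the axis, in the order along the axis. -/
def Encodes (w : List Letter) (X : Set Space) : Prop :=
  ∃ u : Fin w.length → ℝ, StrictMono u ∧
    X ∩ axis = Set.range (fun k => axisPoint (u k)) ∧
    ∀ k, HasLetter X (axisPoint (u k)) (w.get k)

/-- The brackets substituted for a letter; `U` is a left bracket, `D` is a right one. -/
def Letter.brackets (i : ZMod 3) : Letter → List DyckStep
  | .a j => if j = i then [] else [.U]
  | .b j => if j = i then [] else if j = i - 1 then [.U] else [.D]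
  | .c j => if j = i then [] else [.D]
  | .d j => if j = i then [] else if j = i + 1 then [.U] else [.D]
  | .x j => if j = i then [] else [.D, .U]

/-- The word is `i`-balanced: the substitution gives correctly placed brackets. -/
def IsBalancedAt (i : ZMod 3) (w : List Letter) : Prop :=
  ∃ p : DyckWord, p.toList = w.flatMap (Letter.brackets i)

/-- The word is balanced. -/
def IsBalanced (w : List Letter) : Prop := ∀ i, IsBalancedAt i w

/-! ### The semigroup with unit `SK` -/

/-- The generator `a i` as a word. -/
def a (i : ZMod 3) : FreeMonoid Letter := FreeMonoid.of (.a i)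

/-- The generator `b i` as a word. -/
def b (i : ZMod 3) : FreeMonoid Letter := FreeMonoid.of (.b i)

/-- The generator `c i` as a word. -/
def c (i : ZMod 3) : FreeMonoid Letter := FreeMonoid.of (.c i)

/-- The generator `d i` as a word. -/
def d (i : ZMod 3) : FreeMonoid Letter := FreeMonoid.of (.d i)

/-- The generator `x i` as a word. -/
def x (i : ZMod 3) : FreeMonoid Letter := FreeMonoid.of (.x i)

/-- The word `b (i+1) d (i-1) d (i+1) b (i-1)`. -/
def t (i : ZMod 3) : FreeMonoid Letter := b (i + 1) * d (i - 1) * d (i + 1) * b (i - 1)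

/-- The defining relations of `SK`. -/
inductive SKRel : FreeMonoid Letter → FreeMonoid Letter → Prop
  | a_eq (i : ZMod 3) : SKRel (a i) (a (i + 1) * d (i - 1))
  | b_eq (i : ZMod 3) : SKRel (b i) (a (i - 1) * c (i + 1))
  | c_eq (i : ZMod 3) : SKRel (c i) (b (i - 1) * c (i + 1))
  | d_eq (i : ZMod 3) : SKRel (d i) (a (i + 1) * c (i - 1))
  | x_eq (i : ZMod 3) : SKRel (x i) (d (i + 1) * x (i - 1) * b (i + 1))
  | d_d_d : SKRel (d 0 * d 1 * d 2) 1
  | b_d (i : ZMod 3) : SKRel (b i * d i) 1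
  | d_b (i : ZMod 3) : SKRel (d i * b i) 1
  | d_x_d (i : ZMod 3) : SKRel (d i * x i * d i) (a i * (d i * x i * d i) * c i)
  | b_x_b (i : ZMod 3) : SKRel (b i * x i * b i) (a i * (b i * x i * b i) * c i)
  | x_comm (i : ZMod 3) :
      SKRel (x i * (d (i + 1) * d i * d (i - 1))) ((d (i + 1) * d i * d (i - 1)) * x i)
  | d_c_comm (i : ZMod 3) (w : FreeMonoid Letter)
      (hw : w ∈ ({c (i + 1), x (i + 1), b i * d (i + 1) * d i} : Set (FreeMonoid Letter))) :
      SKRel (d i * c i * w) (w * (d i * c i))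
  | a_b_comm (i : ZMod 3) (w : FreeMonoid Letter)
      (hw : w ∈ ({a (i + 1), b (i + 1), c (i + 1), x (i + 1), b i * d (i + 1) * d i} :
        Set (FreeMonoid Letter))) :
      SKRel (a i * b i * w) (w * (a i * b i))
  | t_comm (i : ZMod 3) (w : FreeMonoid Letter)
      (hw : w ∈ ({a i, b i, c i, x i, b (i - 1) * d i * d (i - 1)} :
        Set (FreeMonoid Letter))) :
      SKRel (t i * w) (w * t i)
  | d_x_b_comm (i : ZMod 3) (w : FreeMonoid Letter)
      (hw : w ∈ ({a (i + 1), b (i + 1), c (i + 1), x (i + 1), b i * d (i + 1) * d i} :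
        Set (FreeMonoid Letter))) :
      SKRel (d i * x i * b i * w) (w * (d i * x i * b i))

/-- The semigroup (with unit) `SK` on the 15 letters with the defining relations `SKRel`. -/
abbrev SK : Type := PresentedMonoid SKRel

/-- The element of `SK` given by a word. -/
def SK.ofWord (w : List Letter) : SK := PresentedMonoid.mk SKRel (FreeMonoid.ofList w)

/-- The element `s` of `SK` represents the singular knot `K`: some ambient PL isotopy makes
`K` a three-page embedding, and a balanced word that encodes this embedding is equal to `s`
in `SK`. -/
def SK.Represents (s : SK) (K : SingularKnot) : Prop :=
  ∃ (Φ : AmbientPLIsotopy) (w : List Letter), IsThreePageEmbedding K (Φ.map 1) ∧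
    Encodes w (Φ.map 1 '' K.carrier) ∧ IsBalanced w ∧ SK.ofWord w = s

end ThreePage

end

/-!
The knot is moved by shears `p ↦ p + φ p • w` and by contractive displacements `p ↦ p + ψ p`, with
piecewise linear `φ` and `ψ`. Such maps come with straight-line isotopies (`shear`, `displace`), so
that no extension theorem for PL isotopies is needed. All local pictures are recorded as finite
unions of rays (`LooksLike`).

*Normalization.* Near a singular point, conical shears turn the folded template into a horizontal
plane and then bend the four arcs in this plane until two of them go to the right and two to the
left. Germs of this kind can be cut off by a piecewise linear bump, hence there is an isotopy
that does this at all singular points simultaneously (`exists_straightening`). A linear projection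
in a generic direction followed by a slight shear brings the set into general position with respect
to the projections to the plane and to the line, without destroying the local form at the singular
points (`exists_generic_position`).

*The spine.* In the plane of the projection one draws the graph of a piecewise linear function `g`
of one variable (`Spine.exists_function`). It passes through the singular points and the vertices,
where it separates the arcs, it follows the upper strand for a short while at each crossing, and
everywhere else it is so steep that it crosses the projection of the knot transversely in finitely
many points. It is the minimum of wedges, one for each special point, which are so narrow that any
two of them meet only above the knot. On the other hand, there is a piecewise linear function `F`
on the plane whose graph contains the whole set except for short bridges at the crossings; over the
projection of a bridge the graph of `F` dips to the lower strand (`exists_ground_height`).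

*The book.* Two shears, `z ↦ z - F (x, y)` and `y ↦ y - g x`, carry the graph of `F` to the
horizontal plane, that is, to the union of the pages `0` and `2`, and the part of this graph over
the spine to the axis. A bridge lies over the spine, hence it becomes a tent in the page `1`. Since
`F` is constant near singular points, templates remain horizontal. Thus every point of the image
is straight inside a page or has a letter on the axis, and singular points have the letter `x 1`
(`BookPicture`, `IsGeneric.exists_bookPicture`).

The remaining properties follow from these local pictures. The part of the image in one page is a
compact union of strands transverse to the fibres of the projection to the axis; local labellings of
the strands are glued over an interval, so the projection is injective on the components
(`injOn_connectedComponentIn`). The brackets of the letters record how the number of points in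
the fibres changes at the points of the axis. This number is never negative and vanishes far to the
left and far to the right, so the expression is balanced (`BookPicture.exists_word`).
-/

namespace ThreePage

open Filter
open scoped NNReal

/-! ### Piecewise linear maps -/

section PiecewiseLinear

variable {E F G : Type*} [NormedAddCommGroup E] [NormedSpace ℝ E] [NormedAddCommGroup F]
  [NormedSpace ℝ F] [NormedAddCommGroup G] [NormedSpace ℝ G]

/-- A closed convex polyhedron in a real vector space: a finite intersection of closed
half-spaces. -/
def IsConvexPolyhedron (C : Set E) : Prop :=
  ∃ F : Finset (E →ᵃ[ℝ] ℝ), C = {y | ∀ l ∈ F, 0 ≤ l y}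

/-- A continuous piecewise linear map between normed spaces: locally, the source is covered by
finitely many convex polyhedra on each of which the map is affine. For self-maps of `Space` the
second part is `IsPL`. -/
def PL (f : E → F) : Prop :=
  Continuous f ∧ ∀ p : E, ∃ 𝒞 : Set (Set E), 𝒞.Finite ∧ ⋃₀ 𝒞 ∈ 𝓝 p ∧
    ∀ C ∈ 𝒞, IsConvexPolyhedron C ∧ ∃ A : E →ᵃ[ℝ] F, Set.EqOn f A C

theorem IsConvexPolyhedron.inter {C D : Set E} (hC : IsConvexPolyhedron C)
    (hD : IsConvexPolyhedron D) : IsConvexPolyhedron (C ∩ D) := by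
  classical
  obtain ⟨F, rfl⟩ := hC
  obtain ⟨F', rfl⟩ := hD
  refine ⟨F ∪ F', ?_⟩
  ext y
  simp only [mem_inter_iff, mem_ofPred_eq, Finset.mem_union]
  exact ⟨fun h l hl => hl.elim (h.1 l) (h.2 l),
    fun h => ⟨fun l hl => h l (Or.inl hl), fun l hl => h l (Or.inr hl)⟩⟩

theorem IsConvexPolyhedron.preimage {C : Set F} (hC : IsConvexPolyhedron C) (A : E →ᵃ[ℝ] F) :
    IsConvexPolyhedron (A ⁻¹' C) := by
  classical
  obtain ⟨S, rfl⟩ := hC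
  refine ⟨S.image fun l => l.comp A, ?_⟩
  ext y
  simp

theorem IsConvexPolyhedron.convex {C : Set E} (hC : IsConvexPolyhedron C) : Convex ℝ C := by
  obtain ⟨S, rfl⟩ := hC
  have : {y : E | ∀ l ∈ S, 0 ≤ l y} = ⋂ l ∈ S, (l : E →ᵃ[ℝ] ℝ) ⁻¹' Ici 0 := by
    ext y; simp
  rw [this]
  exact convex_iInter₂ fun l _ => (convex_Ici 0).affine_preimage l

theorem IsConvexPolyhedron.isClosed [FiniteDimensional ℝ E] {C : Set E}
    (hC : IsConvexPolyhedron C) : IsClosed C := by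
  obtain ⟨S, rfl⟩ := hC
  have : {y : E | ∀ l ∈ S, 0 ≤ l y} = ⋂ l ∈ S, (l : E →ᵃ[ℝ] ℝ) ⁻¹' Ici 0 := by
    ext y; simp
  rw [this]
  exact isClosed_biInter fun l _ => isClosed_Ici.preimage l.continuous_of_finiteDimensional

theorem PL.continuous {f : E → F} (hf : PL f) : Continuous f := hf.1

theorem PL.of_affine [FiniteDimensional ℝ E] (A : E →ᵃ[ℝ] F) : PL A := by
  refine ⟨A.continuous_of_finiteDimensional, fun p => ⟨{univ}, finite_singleton _, by simp, ?_⟩⟩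
  rintro C rfl
  exact ⟨⟨∅, by simp⟩, A, fun _ _ => rfl⟩

theorem PL.of_linear [FiniteDimensional ℝ E] (A : E →ₗ[ℝ] F) : PL A :=
  PL.of_affine A.toAffineMap

theorem PL.id [FiniteDimensional ℝ E] : PL (fun p : E => p) := PL.of_linear LinearMap.id

theorem PL.const [FiniteDimensional ℝ E] (v : F) : PL (fun _ : E => v) :=
  PL.of_affine (AffineMap.const ℝ E v)

theorem PL.comp {g : F → G} {f : E → F} (hg : PL g) (hf : PL f) : PL (fun p => g (f p)) := by
  refine ⟨hg.1.comp hf.1, fun p => ?_⟩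
  obtain ⟨𝒞, h𝒞, hp, hC⟩ := hf.2 p
  obtain ⟨𝒟, h𝒟, hq, hD⟩ := hg.2 (f p)
  choose! hpoly A hA using hC
  refine ⟨(fun q : Set E × Set F => q.1 ∩ A q.1 ⁻¹' q.2) '' (𝒞 ×ˢ 𝒟),
    (h𝒞.prod h𝒟).image _, ?_, ?_⟩
  · filter_upwards [hp, hf.1.continuousAt hq] with q ⟨C, hC, hqC⟩ ⟨D, hD, hqD⟩
    exact ⟨_, ⟨(C, D), ⟨hC, hD⟩, rfl⟩, hqC, by simpa [← hA C hC hqC] using hqD⟩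
  · rintro _ ⟨⟨C, D⟩, ⟨hC, hD'⟩, rfl⟩
    obtain ⟨hDp, B, hB⟩ := hD D hD'
    refine ⟨(hpoly C hC).inter (hDp.preimage _), B.comp (A C), fun q hq => ?_⟩
    have h1 := hA C hC hq.1
    have h2 := hB (show A C q ∈ D from hq.2)
    simp [h1, h2]

theorem PL.prodMk {f : E → F} {g : E → G} (hf : PL f) (hg : PL g) :
    PL (fun p => (f p, g p)) := by
  refine ⟨hf.1.prodMk hg.1, fun p => ?_⟩
  obtain ⟨𝒞, h𝒞, hp, hC⟩ := hf.2 p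
  obtain ⟨𝒟, h𝒟, hq, hD⟩ := hg.2 p
  refine ⟨(fun q : Set E × Set E => q.1 ∩ q.2) '' (𝒞 ×ˢ 𝒟), (h𝒞.prod h𝒟).image _, ?_, ?_⟩
  · filter_upwards [hp, hq] with q ⟨C, hC, hqC⟩ ⟨D, hD, hqD⟩
    exact ⟨_, ⟨(C, D), ⟨hC, hD⟩, rfl⟩, hqC, hqD⟩
  · rintro _ ⟨⟨C, D⟩, ⟨hC', hD'⟩, rfl⟩
    obtain ⟨hCp, A, hA⟩ := hC C hC'
    obtain ⟨hDp, B, hB⟩ := hD D hD'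
    exact ⟨hCp.inter hDp, A.prod B, fun q hq => by simp [hA hq.1, hB hq.2]⟩

theorem PL.linear_comp [FiniteDimensional ℝ F] {f : E → F} (L : F →ₗ[ℝ] G) (hf : PL f) :
    PL (fun p => L (f p)) := (PL.of_linear L).comp hf

theorem PL.add [FiniteDimensional ℝ F] {f g : E → F} (hf : PL f) (hg : PL g) :
    PL (fun p => f p + g p) :=
  (hf.prodMk hg).linear_comp (LinearMap.fst ℝ F F + LinearMap.snd ℝ F F)

theorem PL.sub [FiniteDimensional ℝ F] {f g : E → F} (hf : PL f) (hg : PL g) :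
    PL (fun p => f p - g p) :=
  (hf.prodMk hg).linear_comp (LinearMap.fst ℝ F F - LinearMap.snd ℝ F F)

theorem PL.neg [FiniteDimensional ℝ F] {f : E → F} (hf : PL f) : PL (fun p => -f p) :=
  hf.linear_comp (-LinearMap.id)

theorem PL.const_mul {f : E → ℝ} (hf : PL f) (k : ℝ) : PL (fun p => k * f p) :=
  hf.linear_comp (k • LinearMap.id)

theorem PL.const_smul [FiniteDimensional ℝ F] {f : E → F} (hf : PL f) (k : ℝ) :
    PL (fun p => k • f p) := hf.linear_comp (k • LinearMap.id)

theorem PL.smul_const {f : E → ℝ} (hf : PL f) (v : F) : PL (fun p => f p • v) :=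
  hf.linear_comp (LinearMap.toSpanSingleton ℝ F v)

theorem PL.sup {f g : E → ℝ} (hf : PL f) (hg : PL g) : PL (fun p => max (f p) (g p)) := by
  have key : PL (fun q : ℝ × ℝ => max q.1 q.2) := by
    let A : ℝ × ℝ →ᵃ[ℝ] ℝ := (LinearMap.fst ℝ ℝ ℝ - LinearMap.snd ℝ ℝ ℝ).toAffineMap
    refine ⟨by fun_prop, fun p => ⟨{{y | ∀ l ∈ ({A} : Finset _), 0 ≤ l y},
      {y | ∀ l ∈ ({-A} : Finset _), 0 ≤ l y}}, by simp, ?_, ?_⟩⟩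
    · refine univ_mem' fun q => ?_
      rcases le_total q.2 q.1 with h | h
      · exact ⟨_, Or.inl rfl, by simpa [A] using h⟩
      · exact ⟨_, Or.inr rfl, by simpa [A] using h⟩
    · rintro C (rfl | rfl)
      · refine ⟨⟨_, rfl⟩, (LinearMap.fst ℝ ℝ ℝ).toAffineMap, fun q hq => ?_⟩
        have : q.2 ≤ q.1 := by simpa [A] using hq
        simp [this]
      · refine ⟨⟨_, rfl⟩, (LinearMap.snd ℝ ℝ ℝ).toAffineMap, fun q hq => ?_⟩
        have : q.1 ≤ q.2 := by simpa [A] using hq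
        simp [this]
  exact key.comp (hf.prodMk hg)

theorem PL.inf {f g : E → ℝ} (hf : PL f) (hg : PL g) : PL (fun p => min (f p) (g p)) := by
  have : (fun p => min (f p) (g p)) = fun p => -max (-f p) (-g p) := by
    ext p; rw [max_neg_neg, neg_neg]
  rw [this]
  exact (hf.neg.sup hg.neg).neg

theorem PL.abs {f : E → ℝ} (hf : PL f) : PL (fun p => |f p|) := hf.sup hf.neg

theorem PL.vec3 {f g h : E → ℝ} (hf : PL f) (hg : PL g) (hh : PL h) :
    PL (fun p => (![f p, g p, h p] : Space)) := by
  have : (fun p => (![f p, g p, h p] : Space)) = fun p =>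
      f p • (![1, 0, 0] : Space) + g p • ![0, 1, 0] + h p • ![0, 0, 1] := by
    ext p i; fin_cases i <;> simp
  rw [this]
  exact ((hf.smul_const _).add (hg.smul_const _)).add (hh.smul_const _)

theorem PL.apply {f : E → Space} (hf : PL f) (i : Fin 3) : PL (fun p => f p i) :=
  hf.linear_comp (LinearMap.proj i)

/-- Near a point a piecewise linear map is affine on each segment that issues from the point: such a
segment lies in one of the polyhedra that contain the point. -/
theorem PL.radial [FiniteDimensional ℝ E] {f : E → F} (hf : PL f) (p : E) :
    ∀ᶠ q in 𝓝 p, ∀ t ∈ Icc (0 : ℝ) 1, f (p + t • (q - p)) = f p + t • (f q - f p) := by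
  obtain ⟨𝒞, h𝒞, hp, hC⟩ := hf.2 p
  have hcl : IsClosed (⋃₀ {C ∈ 𝒞 | p ∉ C}) :=
    sUnion_eq_biUnion ▸
      (h𝒞.subset (sep_subset _ _)).isClosed_biUnion fun C hC' => (hC C hC'.1).1.isClosed
  have hnot : p ∉ ⋃₀ {C ∈ 𝒞 | p ∉ C} := fun ⟨C, hC', hpC⟩ => hC'.2 hpC
  filter_upwards [hp, hcl.isOpen_compl.mem_nhds hnot] with q ⟨C, hC', hqC⟩ hq t ht
  have hpC : p ∈ C := by
    by_contra h
    exact hq ⟨C, ⟨hC', h⟩, hqC⟩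
  obtain ⟨hconv, A, hA⟩ := hC C hC'
  have hmem : p + t • (q - p) ∈ C := by
    have := hconv.convex.lineMap_mem hpC hqC ht
    rwa [AffineMap.lineMap_apply, vsub_eq_sub, vadd_eq_add, add_comm] at this
  have h1 : A (p + t • (q - p)) = A p + t • (A q - A p) := by
    have := A.apply_lineMap p q t
    rw [AffineMap.lineMap_apply, AffineMap.lineMap_apply] at this
    simpa [add_comm] using this
  rw [hA hmem, hA hpC, hA hqC, h1]

/-- A piecewise linear map has one-sided directional derivatives, with an exact expansion. -/
theorem PL.exists_direction [FiniteDimensional ℝ E] {f : E → F} (hf : PL f) (p v : E) :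
    ∃ w : F, ∃ r₀ > 0, ∀ r ∈ Icc (0 : ℝ) r₀, f (p + r • v) = f p + r • w := by
  have hc : Tendsto (fun r : ℝ => p + r • v) (𝓝 0) (𝓝 p) := by
    have : Continuous (fun r : ℝ => p + r • v) := by fun_prop
    simpa using this.tendsto 0
  obtain ⟨ε, hε, h⟩ := Metric.eventually_nhds_iff.1 (hc.eventually (hf.radial p))
  have h' := h (y := ε / 2) (by
    rw [dist_zero_right, Real.norm_of_nonneg (half_pos hε).le]; exact half_lt_self hε)
  refine ⟨(ε / 2)⁻¹ • (f (p + (ε / 2) • v) - f p), ε / 2, half_pos hε, fun r hr => ?_⟩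
  have := h' (r / (ε / 2)) ⟨div_nonneg hr.1 (half_pos hε).le, (div_le_one (half_pos hε)).2 hr.2⟩
  rw [add_sub_cancel_left, smul_smul, div_mul_cancel₀ _ (half_pos hε).ne'] at this
  rw [this, smul_smul, div_eq_mul_inv]

end PiecewiseLinear

/-! ### Elementary ambient isotopies -/

theorem IsPL.of_PL {f : Space → Space} (hf : PL f) : IsPL f := hf.2

theorem AmbientPLIsotopy.pl (Φ : AmbientPLIsotopy) (t : unitInterval) : PL (Φ.map t) :=
  ⟨(Φ.map t).continuous, Φ.isPL t⟩

/-- The isotopy that performs two isotopies simultaneously, so that its end is the composition of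
their ends. -/
def AmbientPLIsotopy.trans (Φ Ψ : AmbientPLIsotopy) : AmbientPLIsotopy where
  map t := (Φ.map t).trans (Ψ.map t)
  continuous_map := by
    have := Ψ.continuous_map.comp (continuous_fst.prodMk Φ.continuous_map)
    exact this
  isPL t := IsPL.of_PL ((Ψ.pl t).comp (Φ.pl t))
  map_zero := by rw [Φ.map_zero, Ψ.map_zero]; rfl

theorem AmbientPLIsotopy.trans_apply (Φ Ψ : AmbientPLIsotopy) (t : unitInterval) (p : Space) :
    (Φ.trans Ψ).map t p = Ψ.map t (Φ.map t p) := rfl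

/-- The constant isotopy. -/
def AmbientPLIsotopy.refl : AmbientPLIsotopy where
  map _ := Homeomorph.refl Space
  continuous_map := continuous_snd
  isPL _ := IsPL.of_PL PL.id
  map_zero := rfl

/-- The shear in the direction `w` by a piecewise linear function that is constant along `w`. -/
noncomputable def shear (φ : Space → ℝ) (w : Space) (hφ : PL φ)
    (hw : ∀ (p : Space) (s : ℝ), φ (p + s • w) = φ p) :
    AmbientPLIsotopy where
  map t :=
    { toFun := fun p => p + ((t : ℝ) * φ p) • w
      invFun := fun p => p + (-((t : ℝ) * φ p)) • w
      left_inv := fun p => by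
        dsimp only
        rw [hw, add_assoc, ← add_smul]; simp
      right_inv := fun p => by
        dsimp only
        rw [hw, add_assoc, ← add_smul]; simp
      continuous_toFun := by have := hφ.1; fun_prop
      continuous_invFun := by have := hφ.1; fun_prop }
  continuous_map := by
    have := hφ.1
    change Continuous fun q : unitInterval × Space => q.2 + ((q.1 : ℝ) * φ q.2) • w
    fun_prop
  isPL t := IsPL.of_PL (PL.id.add ((hφ.const_mul _).smul_const w))
  map_zero := by ext p; simp

theorem shear_apply (φ : Space → ℝ) (w : Space) (hφ : PL φ)
    (hw : ∀ (p : Space) (s : ℝ), φ (p + s • w) = φ p)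
    (p : Space) : (shear φ w hφ hw).map 1 p = p + φ p • w := by
  simp [shear]

/-- The maps `id + t • ψ` are homeomorphisms since they are close to the identity in the sense of
the inverse function theorem. -/
theorem approximatesLinearOn_add_smul {ψ : Space → Space} (hψ : LipschitzWith 2⁻¹ ψ)
    (t : unitInterval) : ApproximatesLinearOn (fun p => p + (t : ℝ) • ψ p)
      ((ContinuousLinearEquiv.refl ℝ Space : Space ≃L[ℝ] Space) : Space →L[ℝ] Space) univ
      (2⁻¹ : ℝ≥0) := by
  intro p _ q _
  have h1 := hψ.dist_le_mul p q
  rw [dist_eq_norm, dist_eq_norm] at h1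
  have h2 : p + (t : ℝ) • ψ p - (q + (t : ℝ) • ψ q) -
      ((ContinuousLinearEquiv.refl ℝ Space : Space ≃L[ℝ] Space) : Space →L[ℝ] Space) (p - q) =
      (t : ℝ) • (ψ p - ψ q) := by
    simp only [ContinuousLinearEquiv.coe_refl, ContinuousLinearMap.coe_id', id_eq, smul_sub]
    abel
  rw [h2, norm_smul, Real.norm_of_nonneg t.2.1]
  calc (t : ℝ) * ‖ψ p - ψ q‖ ≤ 1 * ‖ψ p - ψ q‖ := by
        gcongr; exact t.2.2
    _ ≤ _ := by rw [one_mul]; exact h1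

/-- The isotopy along straight lines from the identity to a map that differs from the identity
by a contraction. -/
noncomputable def displace (ψ : Space → Space) (hψ : PL ψ) (hL : LipschitzWith 2⁻¹ ψ) :
    AmbientPLIsotopy where
  map t := (approximatesLinearOn_add_smul hL t).toHomeomorph _ (by
    right
    have h1 : ‖((ContinuousLinearEquiv.refl ℝ Space).symm : Space →L[ℝ] Space)‖₊ = 1 := by
      have : ((ContinuousLinearEquiv.refl ℝ Space).symm : Space →L[ℝ] Space) =
        ContinuousLinearMap.id ℝ Space := rfl
      rw [this]; exact nnnorm_one (G := Space →L[ℝ] Space)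
    rw [h1, inv_one]
    exact inv_lt_one_of_one_lt₀ (by norm_num))
  continuous_map := by
    have := hψ.1
    change Continuous fun q : unitInterval × Space => q.2 + (q.1 : ℝ) • ψ q.2
    fun_prop
  isPL t := IsPL.of_PL (PL.id.add (hψ.const_smul _))
  map_zero := by
    ext p i
    change (p + ((0 : unitInterval) : ℝ) • ψ p) i = p i
    simp

theorem displace_apply (ψ : Space → Space) (hψ : PL ψ) (hL : LipschitzWith 2⁻¹ ψ) (p : Space) :
    (displace ψ hψ hL).map 1 p = p + ψ p := by
  change p + ((1 : unitInterval) : ℝ) • ψ p = _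
  simp

/-! ### Sets that are locally unions of rays -/

/-- A short straight arc of `X` issues from the point `A` in the direction `w`. -/
def HasRay (X : Set Space) (A w : Space) : Prop :=
  ∃ r₀ > 0, ∀ r ∈ Icc (0 : ℝ) r₀, A + r • w ∈ X

theorem HasRay.smul {X : Set Space} {A w : Space} (h : HasRay X A w) {k : ℝ} (hk : 0 < k) :
    HasRay X A (k • w) := by
  obtain ⟨r₀, h₀, h⟩ := h
  refine ⟨r₀ / k, div_pos h₀ hk, fun r hr => ?_⟩
  rw [smul_smul]
  exact h _ ⟨mul_nonneg hr.1 hk.le, (le_div_iff₀ hk).1 hr.2⟩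

theorem HasRay.mem {X : Set Space} {A w : Space} (h : HasRay X A w) : A ∈ X := by
  obtain ⟨r₀, h₀, h⟩ := h
  simpa using h 0 ⟨le_rfl, h₀.le⟩

theorem tendsto_add_smul (A w : Space) : Tendsto (fun r : ℝ => A + r • w) (𝓝 0) (𝓝 A) := by
  have : Continuous (fun r : ℝ => A + r • w) := by fun_prop
  simpa using this.tendsto 0

theorem exists_radius_of_eventually {A w : Space} {P : Space → Prop} (h : ∀ᶠ q in 𝓝 A, P q) :
    ∃ r₀ > 0, ∀ r ∈ Icc (0 : ℝ) r₀, P (A + r • w) := by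
  obtain ⟨ε, hε, h'⟩ := Metric.eventually_nhds_iff.1 ((tendsto_add_smul A w).eventually h)
  refine ⟨ε / 2, half_pos hε, fun r hr => h' ?_⟩
  rw [dist_zero_right, Real.norm_of_nonneg hr.1]
  linarith [hr.2]

theorem LooksLike.hasRay {X : Set Space} {A : Space} {V : Set Space} (h : LooksLike X A V)
    {v : Space} (hv : v ∈ V) : HasRay X A v := by
  obtain ⟨r₀, h₀, h'⟩ := exists_radius_of_eventually (w := v) h
  exact ⟨r₀, h₀, fun r hr => (h' r hr).2 ⟨v, hv, r, hr.1, rfl⟩⟩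

theorem LooksLike.exists_of_hasRay {X : Set Space} {A : Space} {V : Set Space}
    (h : LooksLike X A V) {w : Space} (hw : HasRay X A w) :
    ∃ v ∈ V, ∃ k : ℝ, 0 ≤ k ∧ w = k • v := by
  obtain ⟨r₀, h₀, h'⟩ := exists_radius_of_eventually (w := w) h
  obtain ⟨r₁, h₁, h''⟩ := hw
  have hm : 0 < min r₀ r₁ := lt_min h₀ h₁
  obtain ⟨v, hv, r, hr, he⟩ := (h' (min r₀ r₁) ⟨hm.le, min_le_left _ _⟩).1
    (h'' _ ⟨hm.le, min_le_right _ _⟩)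
  refine ⟨v, hv, (min r₀ r₁)⁻¹ * r, by positivity, ?_⟩
  rw [mul_smul, ← add_left_cancel he, smul_smul, inv_mul_cancel₀ hm.ne', one_smul]

theorem LooksLike.congr_rays {X : Set Space} {A : Space} {V W : Set Space} (h : LooksLike X A V)
    (h1 : ∀ v ∈ V, ∃ w ∈ W, ∃ k : ℝ, 0 ≤ k ∧ v = k • w)
    (h2 : ∀ w ∈ W, ∃ v ∈ V, ∃ k : ℝ, 0 ≤ k ∧ w = k • v) : LooksLike X A W := by
  filter_upwards [h] with p hp
  rw [hp]
  constructor
  · rintro ⟨v, hv, r, hr, rfl⟩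
    obtain ⟨w, hw, k, hk, rfl⟩ := h1 v hv
    exact ⟨w, hw, r * k, by positivity, by rw [smul_smul]⟩
  · rintro ⟨v, hv, r, hr, rfl⟩
    obtain ⟨w, hw, k, hk, rfl⟩ := h2 v hv
    exact ⟨w, hw, r * k, by positivity, by rw [smul_smul]⟩

/-- Near `A` the set is covered by the rays, and it contains a short arc of each of them; by
finiteness of `V` the lengths of these arcs are bounded below. -/
theorem LooksLike.of_hasRay {X : Set Space} {A : Space} {V : Set Space} (hV : V.Finite)
    (h0 : ∀ v ∈ V, v ≠ 0)
    (hsub : ∀ᶠ q in 𝓝 A, q ∈ X → ∃ v ∈ V, ∃ r : ℝ, 0 ≤ r ∧ q = A + r • v)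
    (hray : ∀ v ∈ V, HasRay X A v) : LooksLike X A V := by
  have key : ∀ v ∈ V, ∀ᶠ q in 𝓝 A, ∀ r : ℝ, 0 ≤ r → q = A + r • v → q ∈ X := by
    intro v hv
    obtain ⟨r₀, h₀, h⟩ := hray v hv
    have hpos : 0 < r₀ * ‖v‖ := mul_pos h₀ (norm_pos_iff.2 (h0 v hv))
    filter_upwards [Metric.ball_mem_nhds A hpos] with q hq r hr hqr
    rw [Metric.mem_ball, hqr, dist_eq_norm, add_sub_cancel_left, norm_smul,
      Real.norm_of_nonneg hr] at hq
    rw [hqr]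
    exact h r ⟨hr, (lt_of_mul_lt_mul_right hq (norm_nonneg v)).le⟩
  filter_upwards [hsub, (eventually_all_finite hV).2 key] with q h1 h2
  exact ⟨h1, fun ⟨v, hv, r, hr, he⟩ => h2 v hv r hr he⟩

/-- The local picture is transported by a homeomorphism that is straight along the rays. -/
theorem LooksLike.image {X : Set Space} {A : Space} {V : Set Space} (hX : LooksLike X A V)
    (hV : V.Finite) (h0 : ∀ v ∈ V, v ≠ 0) (h : Space ≃ₜ Space) (c : Space → Space)
    (hc : ∀ v ∈ V, ∃ r₀ > 0, ∀ r ∈ Icc (0 : ℝ) r₀, h (A + r • v) = h A + r • c v) :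
    LooksLike (h '' X) (h A) (c '' V) := by
  apply LooksLike.of_hasRay (hV.image c)
  · rintro _ ⟨v, hv, rfl⟩ hcv
    obtain ⟨r₀, h₀, hr⟩ := hc v hv
    have h1 := hr r₀ ⟨h₀.le, le_rfl⟩
    rw [hcv, smul_zero, add_zero] at h1
    have h2 := h.injective h1
    rw [add_eq_left, smul_eq_zero] at h2
    exact h2.elim h₀.ne' (h0 v hv)
  · have key : ∀ v ∈ V, ∀ᶠ q in 𝓝 A, ∀ r : ℝ, 0 ≤ r → q = A + r • v →
        h q = h A + r • c v := by
      intro v hv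
      obtain ⟨r₀, h₀, hr₀⟩ := hc v hv
      have hpos : 0 < r₀ * ‖v‖ := mul_pos h₀ (norm_pos_iff.2 (h0 v hv))
      filter_upwards [Metric.ball_mem_nhds A hpos] with q hq r hr hqr
      rw [Metric.mem_ball, hqr, dist_eq_norm, add_sub_cancel_left, norm_smul,
        Real.norm_of_nonneg hr] at hq
      rw [hqr]
      exact hr₀ r ⟨hr, (lt_of_mul_lt_mul_right hq (norm_nonneg v)).le⟩
    have hsymm : Tendsto h.symm (𝓝 (h A)) (𝓝 A) := by
      simpa using h.symm.continuous.tendsto (h A)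
    filter_upwards [hsymm.eventually hX, hsymm.eventually ((eventually_all_finite hV).2 key)]
      with p h1 h2 hp
    obtain ⟨q, hq, rfl⟩ := hp
    rw [h.symm_apply_apply] at h1 h2
    obtain ⟨v, hv, r, hr, he⟩ := h1.1 hq
    exact ⟨c v, mem_image_of_mem _ hv, r, hr, h2 v hv r hr he⟩
  · rintro _ ⟨v, hv, rfl⟩
    obtain ⟨r₀, h₀, hr⟩ := hc v hv
    obtain ⟨r₁, h₁, hr'⟩ := hX.hasRay hv
    refine ⟨min r₀ r₁, lt_min h₀ h₁, fun r hr'' => ⟨A + r • v,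
      hr' r ⟨hr''.1, hr''.2.trans (min_le_right _ _)⟩,
      hr r ⟨hr''.1, hr''.2.trans (min_le_left _ _)⟩⟩⟩

theorem LooksLike.mem {X : Set Space} {A : Space} {V : Set Space} (h : LooksLike X A V)
    (hV : V.Nonempty) : A ∈ X :=
  (h.hasRay hV.some_mem).mem

/-- A compact set that is locally a finite union of rays is a finite union of segments. -/
theorem exists_finite_segments {X : Set Space} (hX : IsCompact X) (Q : Space → Prop)
    (hloc : ∀ p ∈ X, ∃ V : Set Space, V.Finite ∧ (∀ v ∈ V, v ≠ 0 ∧ Q v) ∧ LooksLike X p V) :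
    ∃ T : Set (Space × Space), T.Finite ∧ X = ⋃ e ∈ T, segment ℝ e.1 e.2 ∧
      ∀ e ∈ T, ∃ v, v ≠ 0 ∧ Q v ∧ ∃ r > (0 : ℝ), e.2 = e.1 + r • v := by
  have hcov : ∀ p ∈ X, ∃ T : Set (Space × Space), T.Finite ∧ (∀ e ∈ T, segment ℝ e.1 e.2 ⊆ X) ∧
      (∀ e ∈ T, ∃ v, v ≠ 0 ∧ Q v ∧ ∃ r > (0 : ℝ), e.2 = e.1 + r • v) ∧
      ∀ᶠ q in 𝓝 p, q ∈ X → q ∈ ⋃ e ∈ T, segment ℝ e.1 e.2 := by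
    intro p hp
    obtain ⟨V, hV, hV0, hL⟩ := hloc p hp
    have hray : ∀ v ∈ V, ∃ r₀ > 0, ∀ r ∈ Icc (0 : ℝ) r₀, p + r • v ∈ X := fun v hv => hL.hasRay hv
    choose! ρ hρ hρX using hray
    have hseg : ∀ v ∈ V, segment ℝ p (p + ρ v • v) = (fun r : ℝ => p + r • v) '' Icc 0 (ρ v) := by
      intro v hv
      rw [segment_eq_image']
      ext q
      constructor
      · rintro ⟨t, ht, rfl⟩
        refine ⟨t * ρ v, ⟨mul_nonneg ht.1 (hρ v hv).le, mul_le_of_le_one_left (hρ v hv).le ht.2⟩,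
          ?_⟩
        simp [mul_smul]
      · rintro ⟨t, ht, rfl⟩
        refine ⟨t / ρ v, ⟨div_nonneg ht.1 (hρ v hv).le, (div_le_one (hρ v hv)).2 ht.2⟩, ?_⟩
        simp [smul_smul, div_mul_cancel₀ _ (hρ v hv).ne']
    refine ⟨(fun v => (p, p + ρ v • v)) '' V, hV.image _, ?_, ?_, ?_⟩
    · rintro _ ⟨v, hv, rfl⟩
      rw [hseg v hv]
      rintro _ ⟨r, hr, rfl⟩
      exact hρX v hv r hr
    · rintro _ ⟨v, hv, rfl⟩
      exact ⟨v, (hV0 v hv).1, (hV0 v hv).2, ρ v, hρ v hv, rfl⟩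
    · have key : ∀ v ∈ V, ∀ᶠ q in 𝓝 p, ∀ r : ℝ, 0 ≤ r → q = p + r • v → r ≤ ρ v := by
        intro v hv
        have hpos : 0 < ρ v * ‖v‖ := mul_pos (hρ v hv) (norm_pos_iff.2 (hV0 v hv).1)
        filter_upwards [Metric.ball_mem_nhds p hpos] with q hq r hr hqr
        rw [Metric.mem_ball, hqr, dist_eq_norm, add_sub_cancel_left, norm_smul,
          Real.norm_of_nonneg hr] at hq
        exact (lt_of_mul_lt_mul_right hq (norm_nonneg v)).le
      filter_upwards [hL, (eventually_all_finite hV).2 key] with q h1 h2 hq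
      obtain ⟨v, hv, r, hr, he⟩ := h1.1 hq
      refine mem_biUnion (mem_image_of_mem _ hv) ?_
      change q ∈ segment ℝ p (p + ρ v • v)
      rw [hseg v hv]
      exact ⟨r, ⟨hr, h2 v hv r hr he⟩, he.symm⟩
  choose! T hTf hTX hTQ hTn using hcov
  obtain ⟨s, hsX, hs⟩ :=
    hX.elim_nhds_subcover (fun p => {q | q ∈ X → q ∈ ⋃ e ∈ T p, segment ℝ e.1 e.2})
    hTn
  refine ⟨⋃ p ∈ s, T p, s.finite_toSet.biUnion fun p hp => hTf p (hsX p hp), ?_, ?_⟩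
  · apply Subset.antisymm
    · intro q hq
      obtain ⟨p, hp, hpq⟩ := mem_iUnion₂.1 (hs hq)
      obtain ⟨e, he, hqe⟩ := mem_iUnion₂.1 (hpq hq)
      exact mem_iUnion₂.2 ⟨e, mem_iUnion₂.2 ⟨p, hp, he⟩, hqe⟩
    · intro q hq
      obtain ⟨e, he, hqe⟩ := mem_iUnion₂.1 hq
      obtain ⟨p, hp, hpe⟩ := mem_iUnion₂.1 he
      exact hTX p (hsX p hp) e hpe hqe
  · intro e he
    obtain ⟨p, hp, hpe⟩ := mem_iUnion₂.1 he
    exact hTQ p (hsX p hp) e hpe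

/-- Near a fibre of a continuous map, a compact set stays in given neighbourhoods of the points of
this fibre. -/
theorem exists_tube {Y : Type*} [MetricSpace Y] {X : Set Space} (hX : IsCompact X)
    {f : Space → Y} (hf : Continuous f) (c : Y) (N : Space → Set Space)
    (hN : ∀ p ∈ X, f p = c → N p ∈ 𝓝 p) :
    ∃ δ > 0, ∀ q ∈ X, dist (f q) c < δ → ∃ p ∈ X, f p = c ∧ q ∈ N p := by
  -- The part of `X` outside these neighbourhoods is compact, and its image misses `c`.
  set O : Set Space := ⋃ p ∈ {p | p ∈ X ∧ f p = c}, interior (N p)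
  have hO : IsOpen O := isOpen_biUnion fun _ _ => isOpen_interior
  have hcl : IsClosed (f '' (X \ O)) := ((hX.diff hO).image hf).isClosed
  have hc : c ∈ (f '' (X \ O))ᶜ := by
    rintro ⟨p, ⟨hp, hpO⟩, hpc⟩
    exact hpO (mem_biUnion (show p ∈ {p | p ∈ X ∧ f p = c} from ⟨hp, hpc⟩)
      (mem_interior_iff_mem_nhds.2 (hN p hp hpc)))
  obtain ⟨δ, hδ, h⟩ := Metric.isOpen_iff.1 hcl.isOpen_compl c hc
  refine ⟨δ, hδ, fun q hq hqc => ?_⟩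
  have : q ∈ O := by
    by_contra hqO
    exact h (Metric.mem_ball.2 hqc) ⟨q, ⟨hq, hqO⟩, rfl⟩
  obtain ⟨p, hp, hpq⟩ := mem_iUnion₂.1 this
  exact ⟨p, hp.1, hp.2, interior_subset hpq⟩

/-! ### The local picture of a singular knot -/

namespace ClosedPolygons

variable {L : ClosedPolygons}

theorem point_mem_edge (z : L.Param) : L.point z ∈ L.edge z.1 := by
  rw [edge, segment_eq_image_lineMap]
  exact ⟨z.2, ⟨z.2.2.1, z.2.2.2.le⟩, rfl⟩

theorem edge_subset_carrier (s : Fin L.size) : L.edge s ⊆ L.carrier := by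
  rw [edge, segment_eq_image_lineMap]
  rintro _ ⟨t, ht, rfl⟩
  rcases ht.2.lt_or_eq with h | rfl
  · exact ⟨(s, ⟨t, ht.1, h⟩), rfl⟩
  · exact ⟨(L.next s, ⟨0, le_rfl, one_pos⟩), by simp [point]⟩

theorem carrier_eq : L.carrier = ⋃ s, L.edge s :=
  Subset.antisymm (by rintro _ ⟨z, rfl⟩; exact mem_iUnion.2 ⟨z.1, point_mem_edge z⟩)
    (iUnion_subset edge_subset_carrier)

theorem isCompact_edge (s : Fin L.size) : IsCompact (L.edge s) := by
  rw [edge, segment_eq_image_lineMap]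
  exact isCompact_Icc.image (AffineMap.lineMap_continuous)

theorem isCompact_carrier : IsCompact L.carrier := by
  rw [carrier_eq]
  exact isCompact_iUnion isCompact_edge

/-- The directions of the arcs that issue from a point. -/
def directions (L : ClosedPolygons) (p : Space) : Set Space :=
  {u | ∃ z, L.point z = p ∧ (u = L.forward z ∨ u = L.backward z)}

theorem point_eq (z : L.Param) :
    L.point z = L.vertex z.1 + (z.2 : ℝ) • (L.vertex (L.next z.1) - L.vertex z.1) := by
  rw [point, AffineMap.lineMap_apply]
  simp [add_comm]

theorem mem_edge_iff {s : Fin L.size} {q : Space} : q ∈ L.edge s ↔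
    ∃ t ∈ Icc (0 : ℝ) 1, q = L.vertex s + t • (L.vertex (L.next s) - L.vertex s) := by
  rw [edge, segment_eq_image']
  constructor
  · rintro ⟨t, ht, rfl⟩; exact ⟨t, ht, rfl⟩
  · rintro ⟨t, ht, rfl⟩; exact ⟨t, ht, rfl⟩

theorem exists_direction_of_mem_edge {s : Fin L.size} {p q : Space} (hp : p ∈ L.edge s)
    (hq : q ∈ L.edge s) : ∃ u ∈ L.directions p, ∃ r : ℝ, 0 ≤ r ∧ q = p + r • u := by
  obtain ⟨t, ht, hpt⟩ := mem_edge_iff.1 hp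
  obtain ⟨t', ht', hqt⟩ := mem_edge_iff.1 hq
  rcases ht.2.lt_or_eq with h1 | h1
  · have hpz : L.point (s, ⟨t, ht.1, h1⟩) = p := by rw [point_eq, hpt]
    rcases le_total t t' with h | h
    · refine ⟨_, ⟨_, hpz, Or.inl rfl⟩, t' - t, sub_nonneg.2 h, ?_⟩
      rw [hpt, hqt, forward, add_assoc, ← add_smul]; simp
    · rcases ht.1.eq_or_lt with h0 | h0
      · refine ⟨_, ⟨_, hpz, Or.inl rfl⟩, 0, le_rfl, ?_⟩
        have : t' = t := by linarith [ht'.1]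
        rw [hpt, hqt, this]; simp
      · refine ⟨_, ⟨_, hpz, Or.inr rfl⟩, t - t', sub_nonneg.2 h, ?_⟩
        rw [backward, if_neg (by simpa using h0.ne')]
        rw [hpt, hqt, ← neg_sub (L.vertex (L.next s)) (L.vertex s), smul_neg, ← sub_eq_add_neg,
          add_sub_assoc, ← sub_smul]; simp
  · have hpz : L.point (L.next s, ⟨0, le_rfl, one_pos⟩) = p := by
      rw [point_eq, hpt, h1]; simp
    refine ⟨_, ⟨_, hpz, Or.inr rfl⟩, 1 - t', sub_nonneg.2 ht'.2, ?_⟩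
    rw [backward, if_pos rfl, hpt, hqt, h1, Equiv.symm_apply_apply]
    simp only [sub_smul, one_smul, smul_sub]
    abel

theorem hasRay_forward (z : L.Param) : HasRay L.carrier (L.point z) (L.forward z) := by
  refine ⟨1 - z.2, sub_pos.2 z.2.2.2, fun r hr => edge_subset_carrier z.1 (mem_edge_iff.2
    ⟨z.2 + r, ⟨add_nonneg z.2.2.1 hr.1, by linarith [hr.2]⟩, ?_⟩)⟩
  rw [point_eq, forward, add_assoc, ← add_smul]

theorem hasRay_backward (z : L.Param) : HasRay L.carrier (L.point z) (L.backward z) := by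
  by_cases h0 : (z.2 : ℝ) = 0
  · refine ⟨1, one_pos, fun r hr => edge_subset_carrier (L.next.symm z.1) (mem_edge_iff.2
      ⟨1 - r, ⟨sub_nonneg.2 hr.2, by linarith [hr.1]⟩, ?_⟩)⟩
    rw [point_eq, backward, if_pos h0, h0, Equiv.apply_symm_apply]
    simp only [sub_smul, one_smul, smul_sub, zero_smul]
    abel
  · refine ⟨z.2, lt_of_le_of_ne z.2.2.1 (Ne.symm h0), fun r hr => edge_subset_carrier z.1
      (mem_edge_iff.2 ⟨z.2 - r, ⟨sub_nonneg.2 hr.2, by linarith [hr.1, z.2.2.2]⟩, ?_⟩)⟩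
    rw [point_eq, backward, if_neg h0]
    simp only [sub_smul, smul_sub]
    abel

theorem forward_ne_zero (hL : L.IsImmersion) (z : L.Param) : L.forward z ≠ 0 :=
  sub_ne_zero.2 (hL.1 z.1).symm

theorem backward_ne_zero (hL : L.IsImmersion) (z : L.Param) : L.backward z ≠ 0 := by
  rw [backward]
  split_ifs
  · have := hL.1 (L.next.symm z.1)
    rw [Equiv.apply_symm_apply] at this
    exact sub_ne_zero.2 this
  · exact sub_ne_zero.2 (hL.1 z.1)

/-- Near a point through which the circles pass finitely often, the polygons are the union of the
forward and backward rays of all passages. -/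
theorem looksLike_directions (hL : L.IsImmersion) {p : Space}
    (hp : {z | L.point z = p}.Finite) : LooksLike L.carrier p (L.directions p) := by
  have hdir : L.directions p = L.forward '' {z | L.point z = p} ∪
      L.backward '' {z | L.point z = p} := by
    ext u
    constructor
    · rintro ⟨z, hz, rfl | rfl⟩
      · exact Or.inl ⟨z, hz, rfl⟩
      · exact Or.inr ⟨z, hz, rfl⟩
    · rintro (⟨z, hz, rfl⟩ | ⟨z, hz, rfl⟩)
      · exact ⟨z, hz, Or.inl rfl⟩
      · exact ⟨z, hz, Or.inr rfl⟩
  apply LooksLike.of_hasRay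
  · rw [hdir]; exact (hp.image _).union (hp.image _)
  · rintro _ ⟨z, -, rfl | rfl⟩
    · exact forward_ne_zero hL z
    · exact backward_ne_zero hL z
  · have : ∀ s : Fin L.size, ∀ᶠ q in 𝓝 p, q ∈ L.edge s →
        ∃ v ∈ L.directions p, ∃ r : ℝ, 0 ≤ r ∧ q = p + r • v := by
      intro s
      by_cases hs : p ∈ L.edge s
      · exact Eventually.of_forall fun q hq => exists_direction_of_mem_edge hs hq
      · filter_upwards [(isCompact_edge s).isClosed.isOpen_compl.mem_nhds hs] with q hq hq'
        exact absurd hq' hq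
    filter_upwards [eventually_all.2 this] with q hq hqX
    rw [carrier_eq] at hqX
    obtain ⟨s, hs⟩ := mem_iUnion.1 hqX
    exact hq s hs
  · rintro _ ⟨z, rfl, rfl | rfl⟩
    · exact hasRay_forward z
    · exact hasRay_backward z

/-- The two arcs of one branch do not overlap. -/
theorem forward_ne_smul_backward (hL : L.IsImmersion) (z : L.Param) {k : ℝ} (hk : 0 < k) :
    L.forward z ≠ k • L.backward z := by
  intro h
  by_cases h0 : (z.2 : ℝ) = 0
  · rw [backward, if_pos h0, forward] at h
    set s := L.next.symm z.1 with hs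
    have hz : z.1 = L.next s := by simp [hs]
    have himm := hL.2 s
    rw [hz] at h
    set m := min 1 k with hm
    have hmpos : 0 < m := lt_min one_pos hk
    have hmk : 0 < m / k := div_pos hmpos hk
    have hmem : L.vertex (L.next s) + (m / k) • (L.vertex (L.next (L.next s)) -
        L.vertex (L.next s)) ∈ L.edge s ∩ L.edge (L.next s) := by
      constructor
      · refine mem_edge_iff.2 ⟨1 - m, ⟨sub_nonneg.2 (min_le_left _ _), by linarith⟩, ?_⟩
        rw [h, smul_smul, div_mul_cancel₀ _ hk.ne']
        simp only [sub_smul, one_smul, smul_sub]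
        abel
      · exact mem_edge_iff.2 ⟨m / k, ⟨hmk.le, (div_le_one hk).2 (min_le_right _ _)⟩, rfl⟩
    have h2 := himm hmem
    rw [mem_singleton_iff, add_eq_left, smul_eq_zero] at h2
    exact h2.elim hmk.ne' (sub_ne_zero.2 (hL.1 (L.next s)).symm)
  · rw [backward, if_neg h0, forward, ← neg_sub, eq_comm, ← sub_eq_zero, sub_neg_eq_add] at h
    nth_rewrite 2 [← one_smul ℝ (L.vertex z.1 - _)] at h
    rw [← add_smul, smul_eq_zero] at h
    exact h.elim (by positivity) (sub_ne_zero.2 (hL.1 z.1))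

end ClosedPolygons

/-- The vectors are nonzero and do not span the same ray; opposite vectors are allowed. -/
def RayIndep {E : Type*} [AddCommGroup E] [Module ℝ E] (u v : E) : Prop :=
  u ≠ 0 ∧ v ≠ 0 ∧ ∀ k : ℝ, 0 < k → u ≠ k • v

/-- Directions whose angles differ by less than a full turn are independent. -/
theorem rayIndep_polar {θ θ' r r' : ℝ} (hr : 0 < r) (hr' : 0 < r') (h1 : θ < θ')
    (h2 : θ' < θ + 2 * Real.pi) :
    RayIndep (r • (Real.cos θ, Real.sin θ)) (r' • (Real.cos θ', Real.sin θ')) := by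
  have hne : ∀ (r θ : ℝ), 0 < r → r • (Real.cos θ, Real.sin θ) ≠ 0 := by
    intro r θ hr h
    simp only [Prod.smul_mk, smul_eq_mul, Prod.mk_eq_zero] at h
    have := Real.sin_sq_add_cos_sq θ
    rw [(mul_eq_zero.1 h.1).resolve_left hr.ne', (mul_eq_zero.1 h.2).resolve_left hr.ne'] at this
    norm_num at this
  refine ⟨hne r θ hr, hne r' θ' hr', fun k hk h => ?_⟩
  simp only [Prod.smul_mk, smul_eq_mul, Prod.mk.injEq] at h
  obtain ⟨hc, hs⟩ := h
  have e1 := Real.sin_sq_add_cos_sq θ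
  have e2 := Real.sin_sq_add_cos_sq θ'
  have hm : 0 < k * r' := mul_pos hk hr'
  have hrr : r = k * r' := by
    have : r ^ 2 = (k * r') ^ 2 := by
      calc r ^ 2 = (r * Real.cos θ) ^ 2 + (r * Real.sin θ) ^ 2 := by
            linear_combination (-(r ^ 2)) * e1
        _ = (k * r') ^ 2 := by rw [hc, hs]; linear_combination (k * r') ^ 2 * e2
    exact (pow_left_inj₀ hr.le hm.le two_ne_zero).1 this
  have hc' : Real.cos θ = Real.cos θ' := by
    apply mul_left_cancel₀ hr.ne'; rw [hc, hrr]; ring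
  have hs' : Real.sin θ = Real.sin θ' := by
    apply mul_left_cancel₀ hr.ne'; rw [hs, hrr]; ring
  have : Real.cos (θ' - θ) = 1 := by
    rw [Real.cos_sub, hc', hs']; linear_combination e2
  rw [Real.cos_eq_one_iff_of_lt_of_lt (by linarith [Real.pi_pos]) (by linarith)] at this
  linarith

theorem fold_smul (e f g : Space) {r : ℝ} (hr : 0 ≤ r) (q : ℝ × ℝ) :
    fold e f g (r • q) = r • fold e f g q := by
  simp only [fold, Prod.smul_fst, Prod.smul_snd, smul_eq_mul, smul_add, smul_smul]
  rw [mul_max_of_nonneg _ _ hr, mul_max_of_nonneg _ _ hr, mul_zero, mul_neg]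

namespace SingularKnot

variable (K : SingularKnot)

theorem finite_fibre (p : Space) : {z | K.toClosedPolygons.point z = p}.Finite :=
  Set.finite_of_encard_le_coe (k := 2) (K.double p)

theorem singularPoints_subset : K.singularPoints ⊆ K.carrier := by
  rintro B ⟨z, _, _, rfl, _⟩
  exact ⟨z, rfl⟩

/-- A regular point has exactly two rays, those of the only branch through it. -/
theorem exists_rays_of_regular {p : Space} (hp : p ∈ K.carrier) (hs : p ∉ K.singularPoints) :
    ∃ u v, RayIndep u v ∧ LooksLike K.carrier p {u, v} := by
  obtain ⟨z, rfl⟩ := hp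
  refine ⟨K.forward z, K.backward z, ⟨ClosedPolygons.forward_ne_zero K.immersion z,
    ClosedPolygons.backward_ne_zero K.immersion z,
    fun k hk => ClosedPolygons.forward_ne_smul_backward K.immersion z hk⟩, ?_⟩
  have : K.directions (K.point z) = {K.forward z, K.backward z} := by
    ext u
    constructor
    · rintro ⟨z', hz', hu⟩
      have : z' = z := by
        by_contra hne
        exact hs ⟨z', z, hne, hz', rfl⟩
      subst this
      exact hu
    · exact fun hu => ⟨z, rfl, hu⟩
  rw [← this]
  exact ClosedPolygons.looksLike_directions K.immersion (K.finite_fibre _)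

/-- At a singular point the four rays of the knot lie in the template and are pairwise different.
Their cyclic order plays no role: conical germs can bend the rays in the template as needed. -/
theorem exists_rays_of_singular {B : Space} (hB : B ∈ K.singularPoints) :
    ∃ e f g, Function.Injective (fold e f g) ∧
      K.template B = Set.range (fun q => B + fold e f g q) ∧
      ∃ q : Fin 4 → ℝ × ℝ, (∀ i j, i ≠ j → RayIndep (q i) (q j)) ∧
        LooksLike K.carrier B (Set.range fun i => fold e f g (q i)) := by
  obtain ⟨z, w, hzw, hz, hw, e, f, g, hinj, hT, θ, r, hr, h01, h12, h23, h30, hfz, hfw, hbz, hbw⟩ :=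
    K.cross B hB
  refine ⟨e, f, g, hinj, hT, fun i => r i • (Real.cos (θ i), Real.sin (θ i)), ?_, ?_⟩
  · have hlt : ∀ i j : Fin 4, i < j → θ i < θ j ∧ θ j < θ i + 2 * Real.pi := by
      intro i j hij
      fin_cases i <;> fin_cases j <;> first | (exact absurd hij (by decide)) | skip
      all_goals
        simp only [Fin.zero_eta, Fin.mk_one, Fin.reduceFinMk]
        constructor <;> linarith
    have hsymm : ∀ u v : ℝ × ℝ, RayIndep u v → RayIndep v u := by
      rintro u v ⟨h1, h2, h3⟩
      refine ⟨h2, h1, fun k hk he => h3 k⁻¹ (inv_pos.2 hk) ?_⟩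
      rw [he, smul_smul, inv_mul_cancel₀ hk.ne', one_smul]
    intro i j hij
    rcases lt_or_gt_of_ne hij with h | h
    · exact rayIndep_polar (hr i) (hr j) (hlt i j h).1 (hlt i j h).2
    · exact hsymm _ _ (rayIndep_polar (hr j) (hr i) (hlt j i h).1 (hlt j i h).2)
  · have hfib : ∀ z', K.point z' = B → z' = z ∨ z' = w := by
      intro z' hz'
      by_contra! hne
      have h3 : ({z, w, z'} : Set K.Param).encard = 3 := by
        rw [encard_eq_three]; exact ⟨z, w, z', hzw, hne.1.symm, hne.2.symm, rfl⟩
      have : ({z, w, z'} : Set K.Param) ⊆ {y | K.point y = B} := by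
        rintro y (rfl | rfl | rfl)
        exacts [hz, hw, hz']
      have := (encard_le_encard this).trans (K.double B)
      rw [h3] at this
      exact absurd this (by decide)
    have hdir : K.directions B =
        Set.range fun i => fold e f g (r i • (Real.cos (θ i), Real.sin (θ i))) := by
      ext u
      constructor
      · rintro ⟨z', hz', hu⟩
        rcases hfib z' hz' with rfl | rfl <;> rcases hu with rfl | rfl
        · exact ⟨0, by dsimp only; rw [fold_smul _ _ _ (hr 0).le, hfz]⟩
        · exact ⟨2, by dsimp only; rw [fold_smul _ _ _ (hr 2).le, hbz]⟩
        · exact ⟨1, by dsimp only; rw [fold_smul _ _ _ (hr 1).le, hfw]⟩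
        · exact ⟨3, by dsimp only; rw [fold_smul _ _ _ (hr 3).le, hbw]⟩
      · rintro ⟨i, rfl⟩
        dsimp only
        rw [fold_smul _ _ _ (hr i).le]
        fin_cases i
        · exact ⟨z, hz, Or.inl hfz.symm⟩
        · exact ⟨w, hw, Or.inl hfw.symm⟩
        · exact ⟨z, hz, Or.inr hbz.symm⟩
        · exact ⟨w, hw, Or.inr hbw.symm⟩
    rw [← hdir]
    exact ClosedPolygons.looksLike_directions K.immersion (K.finite_fibre _)

end SingularKnot

/-! ### Local modifications by ambient isotopies -/

/-- The germ at the origin of the map `c` can be realized at every point, by an ambient isotopy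
that is supported in an arbitrarily small neighbourhood of this point. -/
def GermRealizable (c : Space → Space) : Prop :=
  ∀ B : Space, ∀ U ∈ 𝓝 B, ∃ Φ : AmbientPLIsotopy, (∀ p ∉ U, Φ.map 1 p = p) ∧
    ∀ᶠ p in 𝓝 (0 : Space), Φ.map 1 (B + p) = B + c p

theorem GermRealizable.comp {c c' : Space → Space} (h' : GermRealizable c')
    (h : GermRealizable c) (hc : Continuous c) (h0 : c 0 = 0) :
    GermRealizable (fun p => c' (c p)) := by
  intro B U hU
  obtain ⟨Φ, hΦU, hΦ⟩ := h B U hU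
  obtain ⟨Ψ, hΨU, hΨ⟩ := h' B U hU
  refine ⟨Φ.trans Ψ, fun p hp => ?_, ?_⟩
  · rw [AmbientPLIsotopy.trans_apply, hΦU p hp, hΨU p hp]
  · have ht : Tendsto c (𝓝 0) (𝓝 0) := by simpa [h0] using hc.tendsto 0
    filter_upwards [hΦ, ht.eventually hΨ] with p h1 h2
    rw [AmbientPLIsotopy.trans_apply, h1, h2]

theorem pl_norm : PL (fun p : Space => ‖p‖) := by
  have : (fun p : Space => ‖p‖) = fun p => max |p 0| (max |p 1| |p 2|) := by
    ext p
    apply le_antisymm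
    · rw [pi_norm_le_iff_of_nonneg (by positivity)]
      intro i
      fin_cases i <;> simp
    · exact max_le (norm_le_pi_norm p 0) (max_le (norm_le_pi_norm p 1) (norm_le_pi_norm p 2))
  rw [this]
  exact ((PL.id.apply 0).abs).sup (((PL.id.apply 1).abs).sup ((PL.id.apply 2).abs))

/-- The germ of a contractive perturbation of the identity is realized by cutting off the
displacement with a piecewise linear bump, which keeps it a contraction. -/
theorem germRealizable_add {ψ : Space → Space} (hψ : PL ψ) (hL : LipschitzWith 2⁻¹ ψ)
    (h0 : ψ 0 = 0) : GermRealizable (fun p => p + ψ p) := by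
  intro B U hU
  obtain ⟨ε, hε, hεU⟩ := Metric.mem_nhds_iff.1 hU
  have hn : PL (fun p : Space => ‖p - B‖) := pl_norm.comp (PL.id.sub (PL.const B))
  -- A bump with the Lipschitz constant `1/2`.
  set H : Space → ℝ := fun p => max (2⁻¹ * (ε - ‖p - B‖)) 0 with hH
  have hHpl : PL H := (((PL.const ε).sub hn).const_mul 2⁻¹).sup (PL.const 0)
  have hHL : LipschitzWith 2⁻¹ H := by
    apply LipschitzWith.of_dist_le_mul
    intro p q
    rw [Real.dist_eq]
    refine (abs_max_sub_max_le_abs _ _ _).trans ?_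
    rw [← mul_sub, abs_mul, dist_eq_norm]
    have h1 : |ε - ‖p - B‖ - (ε - ‖q - B‖)| ≤ ‖p - q‖ := by
      have := abs_norm_sub_norm_le (q - B) (p - B)
      rw [sub_sub_sub_cancel_right, norm_sub_rev q p] at this
      convert this using 2
      ring
    have h2 : |(2⁻¹ : ℝ)| = 2⁻¹ := abs_of_pos (by norm_num)
    rw [h2]
    simp only [NNReal.coe_inv, NNReal.coe_ofNat]
    gcongr
  set φ : Space → Space := fun p => ψ (p - B) with hφ
  have hφpl : PL φ := hψ.comp (PL.id.sub (PL.const B))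
  -- The displacement is clamped between `-H` and `H`. It vanishes outside `U`, and it is not
  -- changed near `B`, since there it is at most half the distance from `B`.
  set χ : Space → Fin 3 → ℝ := fun p i => max (-H p) (min (φ p i) (H p)) with hχ
  have hχi : ∀ i, PL (fun p => χ p i) := fun i => hHpl.neg.sup ((hφpl.apply i).inf hHpl)
  have hχpl : PL χ := by
    have : χ = fun p => ![χ p 0, χ p 1, χ p 2] := by
      ext p i; fin_cases i <;> rfl
    rw [this]
    exact (hχi 0).vec3 (hχi 1) (hχi 2)
  have hχL : LipschitzWith 2⁻¹ χ := by
    apply LipschitzWith.of_dist_le_mul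
    intro p q
    rw [dist_pi_le_iff (by positivity)]
    intro i
    have hφL : LipschitzWith 2⁻¹ (fun p => φ p i) := by
      apply LipschitzWith.of_dist_le_mul
      intro p q
      have := hL.dist_le_mul (p - B) (q - B)
      rw [dist_sub_right] at this
      exact (dist_le_pi_dist (φ p) (φ q) i).trans this
    have hneg : LipschitzWith 2⁻¹ (fun p => -H p) := by
      apply LipschitzWith.of_dist_le_mul
      intro p q
      rw [dist_neg_neg]
      exact hHL.dist_le_mul p q
    have := (hneg.max (hφL.min hHL)).dist_le_mul p q
    simpa using this
  refine ⟨displace χ hχpl hχL, fun p hp => ?_, ?_⟩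
  · have hHp : H p = 0 := by
      have : p ∉ Metric.ball B ε := fun h => hp (hεU h)
      rw [Metric.mem_ball, dist_eq_norm, not_lt] at this
      rw [hH]
      exact max_eq_right (by linarith)
    rw [displace_apply]
    have : χ p = 0 := by
      ext i
      simp only [hχ, hHp, neg_zero, Pi.zero_apply]
      exact max_eq_left (min_le_right _ _)
    rw [this, add_zero]
  · filter_upwards [Metric.ball_mem_nhds (0 : Space) (half_pos hε)] with p hp
    rw [Metric.mem_ball, dist_zero_right] at hp
    rw [displace_apply, add_assoc]
    congr 2
    ext i
    have h1 : |ψ p i| ≤ 2⁻¹ * ‖p‖ := by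
      have h2 := hL.dist_le_mul p 0
      rw [h0, dist_zero_right, dist_zero_right] at h2
      exact (norm_le_pi_norm (ψ p) i).trans (by simpa using h2)
    have h2 : 2⁻¹ * ‖p‖ ≤ H (B + p) := by
      simp only [hH, add_sub_cancel_left]
      exact le_max_of_le_left (by linarith)
    obtain ⟨h3, h4⟩ := abs_le.1 (h1.trans h2)
    simp only [hχ, hφ, add_sub_cancel_left]
    rw [min_eq_left h4, max_eq_right h3]

/-- A realizable germ given by an injective continuous map that commutes with nonnegative scaling.
Such maps send rays to rays. -/
structure ConicalGerm (c : Space → Space) : Prop where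
  realizable : GermRealizable c
  continuous : Continuous c
  injective : Function.Injective c
  smul : ∀ r : ℝ, 0 ≤ r → ∀ p, c (r • p) = r • c p

namespace ConicalGerm

variable {c c' : Space → Space}

theorem zero (h : ConicalGerm c) : c 0 = 0 := by
  simpa using h.smul 0 le_rfl 0

theorem comp (h' : ConicalGerm c') (h : ConicalGerm c) : ConicalGerm (fun p => c' (c p)) where
  realizable := h'.realizable.comp h.realizable h.continuous h.zero
  continuous := h'.continuous.comp h.continuous
  injective := h'.injective.comp h.injective
  smul r hr p := by rw [h.smul r hr, h'.smul r hr]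

end ConicalGerm

theorem RayIndep.map {E F : Type*} [AddCommGroup E] [Module ℝ E] [AddCommGroup F] [Module ℝ F]
    {c : E → F} (hc : Function.Injective c)
    (hs : ∀ r : ℝ, 0 ≤ r → ∀ p, c (r • p) = r • c p) {u v : E} (h : RayIndep u v) :
    RayIndep (c u) (c v) := by
  have h0 : c 0 = 0 := by simpa using hs 0 le_rfl 0
  refine ⟨fun h1 => h.1 (hc (h1.trans h0.symm)), fun h1 => h.2.1 (hc (h1.trans h0.symm)),
    fun k hk h1 => h.2.2 k hk (hc ?_)⟩
  rw [h1, hs k hk.le]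

/-- A conical shear: in the direction `w`, by a function that is linear on each side of a plane. -/
def conicalShear (l m : Space →ₗ[ℝ] ℝ) (k k' : ℝ) (w : Space) (p : Space) : Space :=
  p + (l p + k * max (m p) 0 + k' * max (-m p) 0) • w

theorem conicalShear_apply (l m : Space →ₗ[ℝ] ℝ) (k k' : ℝ) (w p : Space) (i : Fin 3) :
    conicalShear l m k k' w p i = p i + (l p + k * max (m p) 0 + k' * max (-m p) 0) * w i := rfl

/-- Conical shears are conical germs, although their displacement need not be a contraction. -/
theorem conicalShear_conical (l m : Space →ₗ[ℝ] ℝ) (k k' : ℝ) {w : Space} (hl : l w = 0)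
    (hm : m w = 0) : ConicalGerm (conicalShear l m k k' w) := by
  set φ : Space → ℝ := fun p => l p + k * max (m p) 0 + k' * max (-m p) 0 with hφ
  have hpl : PL φ := ((PL.of_linear l).add (((PL.of_linear m).sup (PL.const 0)).const_mul k)).add
    (((PL.of_linear m).neg.sup (PL.const 0)).const_mul k')
  have hw : ∀ (p : Space) (s : ℝ), φ (p + s • w) = φ p := by
    intro p s
    simp [hφ, hl, hm]
  have hφ0 : φ 0 = 0 := by simp [hφ]
  have hLip : ∃ C : ℝ, 0 ≤ C ∧ ∀ p q, |φ p - φ q| ≤ C * ‖p - q‖ := by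
    set L := LinearMap.toContinuousLinearMap l
    set M := LinearMap.toContinuousLinearMap m
    refine ⟨‖L‖ + |k| * ‖M‖ + |k'| * ‖M‖, by positivity, fun p q => ?_⟩
    have e1 : |l p - l q| ≤ ‖L‖ * ‖p - q‖ := by
      rw [← map_sub]; exact L.le_opNorm (p - q)
    have e2 : |m p - m q| ≤ ‖M‖ * ‖p - q‖ := by
      rw [← map_sub]; exact M.le_opNorm (p - q)
    have e3 : |max (m p) 0 - max (m q) 0| ≤ ‖M‖ * ‖p - q‖ :=
      (abs_max_sub_max_le_abs _ _ _).trans e2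
    have e4 : |max (-m p) 0 - max (-m q) 0| ≤ ‖M‖ * ‖p - q‖ := by
      refine (abs_max_sub_max_le_abs _ _ _).trans ?_
      rwa [neg_sub_neg, abs_sub_comm]
    calc |φ p - φ q| = |(l p - l q) + k * (max (m p) 0 - max (m q) 0) +
          k' * (max (-m p) 0 - max (-m q) 0)| := by simp only [hφ]; congr 1; ring
      _ ≤ |l p - l q| + |k| * |max (m p) 0 - max (m q) 0| +
          |k'| * |max (-m p) 0 - max (-m q) 0| := by
          refine (abs_add_le _ _).trans ?_
          rw [abs_mul k']
          gcongr
          refine (abs_add_le _ _).trans ?_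
          rw [abs_mul k]
      _ ≤ ‖L‖ * ‖p - q‖ + |k| * (‖M‖ * ‖p - q‖) + |k'| * (‖M‖ * ‖p - q‖) := by gcongr
      _ = _ := by ring
  have hcont : ∀ s : ℝ, Continuous fun p : Space => p + (s * φ p) • w := fun s => by
    have := hpl.1; fun_prop
  -- The shear is an iterate of a shear so small that its displacement is a contraction.
  have hreal : GermRealizable (fun p => p + φ p • w) := by
    obtain ⟨C, hC, hCφ⟩ := hLip
    obtain ⟨n, hn⟩ := exists_nat_gt (2 * (C * ‖w‖))
    have hn0 : (0 : ℝ) < n := lt_of_le_of_lt (by positivity) hn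
    have hψL : LipschitzWith 2⁻¹ (fun p => ((n : ℝ)⁻¹ * φ p) • w) := by
      apply LipschitzWith.of_dist_le_mul
      intro p q
      rw [dist_eq_norm, dist_eq_norm, ← sub_smul, ← mul_sub, norm_smul, Real.norm_eq_abs, abs_mul,
        abs_of_pos (inv_pos.2 hn0)]
      calc (n : ℝ)⁻¹ * |φ p - φ q| * ‖w‖ ≤ (n : ℝ)⁻¹ * (C * ‖p - q‖) * ‖w‖ := by
            gcongr; exact hCφ p q
        _ = (n : ℝ)⁻¹ * (C * ‖w‖) * ‖p - q‖ := by ring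
        _ ≤ 2⁻¹ * ‖p - q‖ := by
            gcongr
            rw [inv_mul_le_iff₀ hn0]; linarith
        _ = _ := by simp
    have hstep : GermRealizable (fun p => p + ((n : ℝ)⁻¹ * φ p) • w) :=
      germRealizable_add ((hpl.const_mul _).smul_const w) hψL (by simp [hφ0])
    have hiter : ∀ j : ℕ, GermRealizable (fun p => p + ((j + 1 : ℕ) * (n : ℝ)⁻¹ * φ p) • w) := by
      intro j
      induction j with
      | zero => simpa using hstep
      | succ j ih =>
        have := hstep.comp ih (hcont _) (by simp [hφ0])
        have he : (fun p => p + (((j + 1 + 1 : ℕ) : ℝ) * (n : ℝ)⁻¹ * φ p) • w) =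
            fun p => p + (((j + 1 : ℕ) : ℝ) * (n : ℝ)⁻¹ * φ p) • w + ((n : ℝ)⁻¹ *
              φ (p + (((j + 1 : ℕ) : ℝ) * (n : ℝ)⁻¹ * φ p) • w)) • w := by
          funext p
          rw [hw, add_assoc p, ← add_smul]
          congr 2
          push_cast
          ring
        rw [he]
        exact this
    obtain ⟨j, rfl⟩ : ∃ j, n = j + 1 := Nat.exists_eq_succ_of_ne_zero (by
      rintro rfl; simp at hn0)
    convert hiter j using 4 with p
    rw [mul_inv_cancel₀ hn0.ne', one_mul]
  refine ⟨hreal, (by simpa using hcont 1 : Continuous fun p => p + φ p • w),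
    fun p q h => ?_, fun r hr p => ?_⟩
  · have h' : p + φ p • w = q + φ q • w := h
    have h1 : φ p = φ q := by
      have := congrArg φ h'
      rwa [hw, hw] at this
    rw [h1] at h'
    exact add_right_cancel h'
  · simp only [conicalShear, map_smul, smul_eq_mul, smul_add, smul_smul]
    congr 2
    have e1 : max (r * m p) 0 = r * max (m p) 0 := by rw [mul_max_of_nonneg _ _ hr, mul_zero]
    have e2 : max (-(r * m p)) 0 = r * max (-m p) 0 := by
      rw [mul_max_of_nonneg _ _ hr, mul_zero, mul_neg]
    rw [e1, e2]
    ring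

/-- Finitely many conical germs are realized simultaneously, by isotopies with disjoint supports. -/
theorem exists_isotopy_of_germs {S : Set Space} (hS : S.Finite) (c : Space → Space → Space)
    (hc : ∀ B ∈ S, ConicalGerm (c B)) :
    ∃ Φ : AmbientPLIsotopy, ∀ B ∈ S, ∀ᶠ p in 𝓝 (0 : Space), Φ.map 1 (B + p) = B + c B p := by
  have key : ∀ S' : Set Space, S'.Finite → S' ⊆ S → ∃ Φ : AmbientPLIsotopy,
      (∀ B ∈ S', ∀ᶠ p in 𝓝 (0 : Space), Φ.map 1 (B + p) = B + c B p) ∧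
      ∀ B ∈ S \ S', ∀ᶠ p in 𝓝 (0 : Space), Φ.map 1 (B + p) = B + p := by
    intro S' hS'
    induction S', hS' using Set.Finite.induction_on with
    | empty => exact fun _ => ⟨AmbientPLIsotopy.refl, by simp, fun B _ => Eventually.of_forall
        fun p => rfl⟩
    | @insert B T hBT hT ih =>
      intro hsub
      obtain ⟨Φ, hΦ, hΦ'⟩ := ih ((subset_insert _ _).trans hsub)
      have hBS : B ∈ S := hsub (mem_insert _ _)
      have hcl : IsClosed (S \ {B}) := (hS.subset sdiff_subset).isClosed
      obtain ⟨ε, hε, hεU⟩ := Metric.isOpen_iff.1 hcl.isOpen_compl B (by simp)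
      obtain ⟨Ψ, hΨU, hΨ⟩ := (hc B hBS).realizable B _ (Metric.ball_mem_nhds B (half_pos hε))
      have hfar : ∀ B' ∈ S, B' ≠ B → ∀ᶠ p in 𝓝 (0 : Space), Ψ.map 1 (B' + p) = B' + p := by
        intro B' hB' hne
        filter_upwards [Metric.ball_mem_nhds (0 : Space) (half_pos hε)] with p hp
        apply hΨU
        intro hmem
        have h1 : ε ≤ dist B' B := by
          by_contra! hlt
          exact hεU (Metric.mem_ball.2 hlt) ⟨hB', hne⟩
        have h2 : dist B' (B' + p) < ε / 2 := by
          rw [dist_comm, dist_eq_norm, add_sub_cancel_left]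
          simpa using hp
        have := dist_triangle B' (B' + p) B
        have h3 := Metric.mem_ball.1 hmem
        linarith
      refine ⟨Φ.trans Ψ, ?_, ?_⟩
      · intro B' hB'
        rcases eq_or_ne B' B with rfl | hne
        · filter_upwards [hΦ' B' ⟨hBS, hBT⟩, hΨ] with p h1 h2
          rw [AmbientPLIsotopy.trans_apply, h1, h2]
        · have hB'T : B' ∈ T := hB'.resolve_left hne
          have hB'S := hsub hB'
          have ht : Tendsto (c B') (𝓝 0) (𝓝 0) := by
            simpa [(hc B' hB'S).zero] using (hc B' hB'S).continuous.tendsto 0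
          filter_upwards [hΦ B' hB'T, ht.eventually (hfar B' hB'S hne)] with p h1 h2
          rw [AmbientPLIsotopy.trans_apply, h1, h2]
      · intro B' hB'
        have hne : B' ≠ B := fun h => hB'.2 (h ▸ mem_insert _ _)
        filter_upwards [hΦ' B' ⟨hB'.1, fun h => hB'.2 (mem_insert_of_mem _ h)⟩,
          hfar B' hB'.1 hne] with p h1 h2
        rw [AmbientPLIsotopy.trans_apply, h1, h2]
  obtain ⟨Φ, hΦ, -⟩ := key S hS Subset.rfl
  exact ⟨Φ, hΦ⟩

/-! ### Straightening near the singular points -/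

/-- Four horizontal rays, two of which go to the right (`u` and `u'`) and two to the left (`v` and
`v'`), with different slopes on each side. -/
def FlatCross (V : Set Space) : Prop :=
  ∃ u u' v v' : Space, V = {u, u', v, v'} ∧ (u 2 = 0 ∧ u' 2 = 0 ∧ v 2 = 0 ∧ v' 2 = 0) ∧
    (0 < u 0 ∧ 0 < u' 0 ∧ v 0 < 0 ∧ v' 0 < 0) ∧
    u 1 / u 0 < u' 1 / u' 0 ∧ v 1 / v 0 < v' 1 / v' 0

/-- The determinant of three vectors. -/
def det3 (u v w : Space) : ℝ :=
  u 0 * (v 1 * w 2 - v 2 * w 1) - u 1 * (v 0 * w 2 - v 2 * w 0) + u 2 * (v 0 * w 1 - v 1 * w 0)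

/-- The two half-planes of a folded plane lie on different sides of some plane that contains the
fold line and the vector `v`, so that the folded plane is a graph in the direction `v`. The
condition `v 2 ≠ 0` allows to shear this direction to the vertical. -/
theorem exists_transverse_direction {e f g : Space} (h : Function.Injective (fold e f g)) :
    ∃ v : Space, v 2 ≠ 0 ∧ det3 e f v * det3 e g v < 0 := by
  have hfold : ∀ x y : ℝ, 0 ≤ y → fold e f g (x, y) = x • e + y • f := by
    intro x y hy; simp [fold, hy]
  have hfold' : fold e f g (0, -1) = g := by simp [fold]
  -- A vector with a vanishing last coordinate is perturbed.
  suffices h1 : ∃ v : Space, det3 e f v * det3 e g v < 0 by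
    obtain ⟨v, hv⟩ := h1
    by_cases h2 : v 2 = 0
    · have hcont : Continuous fun ε : ℝ => det3 e f (v + ε • ![0, 0, 1]) *
          det3 e g (v + ε • ![0, 0, 1]) := by
        unfold det3
        fun_prop
      have hev : ∀ᶠ ε in 𝓝 (0 : ℝ), det3 e f (v + ε • ![0, 0, 1]) *
          det3 e g (v + ε • ![0, 0, 1]) < 0 :=
        (hcont.tendsto' 0 _ (by simp)).eventually (gt_mem_nhds hv)
      obtain ⟨ε, hε, hε0⟩ := ((hev.filter_mono nhdsWithin_le_nhds).and
        (self_mem_nhdsWithin (a := (0 : ℝ)) (s := {0}ᶜ))).exists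
      exact ⟨_, by simpa [h2] using hε0, hε⟩
    · exact ⟨v, h2, hv⟩
  -- If the plane is flat, take its normal vector `n = e × f`; then `g = s • e + t • f`
  -- with `t < 0`. Otherwise take `f + g`.
  by_cases hd : det3 e f g = 0
  · obtain ⟨n, n0, n1, n2⟩ : ∃ n : Space, n 0 = e 1 * f 2 - e 2 * f 1 ∧
        n 1 = e 2 * f 0 - e 0 * f 2 ∧ n 2 = e 0 * f 1 - e 1 * f 0 :=
      ⟨![e 1 * f 2 - e 2 * f 1, e 2 * f 0 - e 0 * f 2, e 0 * f 1 - e 1 * f 0], rfl, rfl, rfl⟩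
    obtain ⟨N, hN⟩ : ∃ N, N = n 0 * n 0 + n 1 * n 1 + n 2 * n 2 := ⟨_, rfl⟩
    have hNnn : 0 ≤ N := by
      nlinarith [mul_self_nonneg (n 0), mul_self_nonneg (n 1), mul_self_nonneg (n 2)]
    have hn0 : N ≠ 0 := by
      intro h0
      have z0 : n 0 = 0 := by
        nlinarith [mul_self_nonneg (n 0), mul_self_nonneg (n 1), mul_self_nonneg (n 2)]
      have z1 : n 1 = 0 := by
        nlinarith [mul_self_nonneg (n 0), mul_self_nonneg (n 1), mul_self_nonneg (n 2)]
      have z2 : n 2 = 0 := by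
        nlinarith [mul_self_nonneg (n 0), mul_self_nonneg (n 1), mul_self_nonneg (n 2)]
      rw [n0] at z0
      rw [n1] at z1
      rw [n2] at z2
      set E := e 0 * e 0 + e 1 * e 1 + e 2 * e 2 with hE
      have hE0 : E ≠ 0 := by
        intro hE0
        have y0 : e 0 = 0 := by
          nlinarith [mul_self_nonneg (e 0), mul_self_nonneg (e 1), mul_self_nonneg (e 2)]
        have y1 : e 1 = 0 := by
          nlinarith [mul_self_nonneg (e 0), mul_self_nonneg (e 1), mul_self_nonneg (e 2)]
        have y2 : e 2 = 0 := by
          nlinarith [mul_self_nonneg (e 0), mul_self_nonneg (e 1), mul_self_nonneg (e 2)]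
        have he : e = 0 := by ext i; fin_cases i <;> simp [y0, y1, y2]
        have := @h (1, 0) (0, 0) (by rw [hfold _ _ le_rfl, hfold _ _ le_rfl, he]; simp)
        simp at this
      have hf : f = ((e 0 * f 0 + e 1 * f 1 + e 2 * f 2) / E) • e := by
        ext i
        rw [Pi.smul_apply, smul_eq_mul, div_mul_eq_mul_div, eq_div_iff hE0, hE]
        fin_cases i
        · simp; linear_combination -e 1 * z2 + e 2 * z1
        · simp; linear_combination e 0 * z2 - e 2 * z0
        · simp; linear_combination e 1 * z0 - e 0 * z1
      have := @h (0, 1) ((e 0 * f 0 + e 1 * f 1 + e 2 * f 2) / E, 0) (by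
        rw [hfold _ _ zero_le_one, hfold _ _ le_rfl, ← hf]; simp)
      simp at this
    have hNpos : 0 < N := lt_of_le_of_ne hNnn (Ne.symm hn0)
    obtain ⟨t, ht⟩ : ∃ t, t = det3 e g n / N := ⟨_, rfl⟩
    obtain ⟨s, hs⟩ : ∃ s, s = det3 g f n / N := ⟨_, rfl⟩
    have hg : g = s • e + t • f := by
      rw [det3] at hd
      ext i
      rw [Pi.add_apply, Pi.smul_apply, Pi.smul_apply, smul_eq_mul, smul_eq_mul, hs, ht,
        div_mul_eq_mul_div, div_mul_eq_mul_div, ← add_div, eq_div_iff hn0, hN]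
      fin_cases i
      · simp only [Fin.zero_eta, det3, n0, n1, n2]
        linear_combination (e 1 * f 2 - e 2 * f 1) * hd
      · simp only [Fin.mk_one, det3, n0, n1, n2]
        linear_combination (e 2 * f 0 - e 0 * f 2) * hd
      · simp only [Fin.reduceFinMk, det3, n0, n1, n2]
        linear_combination (e 0 * f 1 - e 1 * f 0) * hd
    refine ⟨n, ?_⟩
    have h1 : det3 e f n = N := by rw [det3, hN, n0, n1, n2]; ring
    have h2 : det3 e g n = t * N := by rw [ht, div_mul_cancel₀ _ hn0]
    have ht0 : t < 0 := by
      by_contra! htn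
      have := @h (s, t) (0, -1) (by rw [hfold _ _ htn, hfold', ← hg])
      simp at this
      linarith [this.2]
    rw [h1, h2]
    have := mul_pos hNpos hNpos
    nlinarith
  · refine ⟨f + g, ?_⟩
    have h1 : det3 e f (f + g) = det3 e f g := by simp [det3]; ring
    have h2 : det3 e g (f + g) = -det3 e f g := by simp [det3]; ring
    rw [h1, h2]
    have := mul_self_pos.2 hd
    linarith

/-- A folded plane is made horizontal by two conical shears: the first one makes it a graph over the
horizontal plane, the second one subtracts the height of this graph. -/
theorem exists_flattening {e f g : Space} (h : Function.Injective (fold e f g)) :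
    ∃ c, ConicalGerm c ∧ ∀ p, p ∈ Set.range (fold e f g) ↔ c p 2 = 0 := by
  obtain ⟨v, hv2, hv⟩ := exists_transverse_direction h
  obtain ⟨a, ha⟩ : ∃ a, a = v 0 / v 2 := ⟨_, rfl⟩
  obtain ⟨b, hb⟩ : ∃ b, b = v 1 / v 2 := ⟨_, rfl⟩
  have hav : v 0 = a * v 2 := by rw [ha, div_mul_cancel₀ _ hv2]
  have hbv : v 1 = b * v 2 := by rw [hb, div_mul_cancel₀ _ hv2]
  let X : Space →ₗ[ℝ] ℝ := LinearMap.proj 0 - a • LinearMap.proj 2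
  let Y : Space →ₗ[ℝ] ℝ := LinearMap.proj 1 - b • LinearMap.proj 2
  have hX : ∀ p : Space, X p = p 0 - a * p 2 := fun p => rfl
  have hY : ∀ p : Space, Y p = p 1 - b * p 2 := fun p => rfl
  obtain ⟨α, hα⟩ : ∃ α, α = X e * Y f - Y e * X f := ⟨_, rfl⟩
  obtain ⟨β, hβ⟩ : ∃ β, β = X e * Y g - Y e * X g := ⟨_, rfl⟩
  have hαβ : α * β < 0 := by
    have h1 : det3 e f v = v 2 * α := by rw [det3, hα, hX, hX, hY, hY, hav, hbv]; ring
    have h2 : det3 e g v = v 2 * β := by rw [det3, hβ, hX, hX, hY, hY, hav, hbv]; ring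
    rw [h1, h2] at hv
    have : v 2 * α * (v 2 * β) = v 2 ^ 2 * (α * β) := by ring
    rw [this] at hv
    exact (mul_neg_iff.1 hv).elim (fun h => h.2)
      (fun h => absurd h.1 (by nlinarith [sq_nonneg (v 2)]))
  have hα0 : α ≠ 0 := by rintro rfl; simp at hαβ
  have hβ0 : β ≠ 0 := by rintro rfl; simp at hαβ
  have hα2 : 0 < α * α := mul_self_pos.2 hα0
  -- In the coordinates `X`, `Y` along `v` the folded plane is the graph of the function `T`,
  -- which is linear on each side of the projected fold line.
  let m : Space →ₗ[ℝ] ℝ := α • (X e • LinearMap.proj 1 - Y e • LinearMap.proj 0)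
  let l : Space →ₗ[ℝ] ℝ := (e 2 / α) • (Y f • LinearMap.proj 0 - X f • LinearMap.proj 1)
  have hm : ∀ p : Space, m p = α * (X e * p 1 - Y e * p 0) := fun p => rfl
  have hl : ∀ p : Space, l p = e 2 / α * (Y f * p 0 - X f * p 1) := fun p => rfl
  obtain ⟨k, hk⟩ : ∃ k, k = f 2 / (α * α) := ⟨_, rfl⟩
  obtain ⟨k', hk'⟩ : ∃ k', k' = (g 2 - e 2 / α * (Y f * X g - X f * Y g)) / (-(α * β)) := ⟨_, rfl⟩
  have hk1 : k * (α * α) = f 2 := by rw [hk, div_mul_cancel₀ _ hα2.ne']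
  have hk1' : k' * (-(α * β)) = g 2 - e 2 / α * (Y f * X g - X f * Y g) := by
    rw [hk', div_mul_cancel₀ _ (by linarith)]
  obtain ⟨κ, hκ⟩ : ∃ κ, κ = e 2 / α := ⟨_, rfl⟩
  have hκ1 : κ * α = e 2 := by rw [hκ, div_mul_cancel₀ _ hα0]
  rw [← hκ] at hk1'
  have h1 := conicalShear_conical (LinearMap.proj 2) 0 0 0 (w := ![-a, -b, 0]) (by simp) (by simp)
  have h2 := conicalShear_conical (-l) m (-k) (-k') (w := ![0, 0, 1]) (by simp [hl])
    (by simp [hm])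
  refine ⟨_, h2.comp h1, fun p => ?_⟩
  have hc1 : conicalShear (LinearMap.proj 2) 0 0 0 ![-a, -b, 0] p = ![X p, Y p, p 2] := by
    ext i; fin_cases i <;> simp [conicalShear, hX, hY] <;> ring
  have hc2 : conicalShear (-l) m (-k) (-k') ![0, 0, 1] (![X p, Y p, p 2]) 2 = p 2 -
      (κ * (Y f * X p - X f * Y p) + k * max (α * (X e * Y p - Y e * X p)) 0 +
        k' * max (-(α * (X e * Y p - Y e * X p))) 0) := by
    simp [conicalShear, hl, hm, hκ]; ring
  rw [hc1, hc2]
  constructor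
  · rintro ⟨⟨x, y⟩, rfl⟩
    rcases le_total 0 y with hy | hy
    · have hp : fold e f g (x, y) = x • e + y • f := by simp [fold, hy]
      rw [hp]
      have eX : X (x • e + y • f) = x * X e + y * X f := by simp
      have eY : Y (x • e + y • f) = x * Y e + y * Y f := by simp
      have hpos : α * (X e * Y (x • e + y • f) - Y e * X (x • e + y • f)) = y * (α * α) := by
        rw [eX, eY]; linear_combination -α * y * hα
      rw [hpos, max_eq_left (by positivity), max_eq_right (by nlinarith), eX, eY]
      simp only [Pi.add_apply, Pi.smul_apply, smul_eq_mul]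
      linear_combination -y * hk1 - x * hκ1 + κ * x * hα
    · have hp : fold e f g (x, y) = x • e + (-y) • g := by simp [fold, hy]
      rw [hp]
      have eX : X (x • e + (-y) • g) = x * X e - y * X g := by simp [sub_eq_add_neg]
      have eY : Y (x • e + (-y) • g) = x * Y e - y * Y g := by simp [sub_eq_add_neg]
      have hpos : α * (X e * Y (x • e + (-y) • g) - Y e * X (x • e + (-y) • g)) =
          -y * (α * β) := by
        rw [eX, eY]; linear_combination α * y * hβ
      rw [hpos, max_eq_right (by nlinarith), max_eq_left (by nlinarith), eX, eY]
      simp only [Pi.add_apply, Pi.smul_apply, smul_eq_mul]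
      linear_combination y * hk1' - x * hκ1 + κ * x * hα
  · intro hp
    have hX' : ∀ q : Space, q 0 = X q + a * q 2 := fun q => by rw [hX]; ring
    have hY' : ∀ q : Space, q 1 = Y q + b * q 2 := fun q => by rw [hY]; ring
    have hext : ∀ q : Space, X q = X p → Y q = Y p → q 2 = p 2 → q = p := by
      intro q q0 q1 q2
      ext i
      fin_cases i
      · simp only [Fin.zero_eta]; rw [hX' q, hX' p, q0, q2]
      · simp only [Fin.mk_one]; rw [hY' q, hY' p, q1, q2]
      · exact q2
    rcases le_total 0 (α * (X e * Y p - Y e * X p)) with hs | hs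
    · rw [max_eq_left hs, max_eq_right (by linarith)] at hp
      obtain ⟨y, hy⟩ : ∃ y, y = α * (X e * Y p - Y e * X p) / (α * α) := ⟨_, rfl⟩
      have hy0 : 0 ≤ y := hy ▸ div_nonneg hs hα2.le
      have hy1 : y * α = X e * Y p - Y e * X p := by rw [hy]; field_simp
      obtain ⟨x, hx⟩ : ∃ x, x = (Y f * X p - X f * Y p) / α := ⟨_, rfl⟩
      have hx1 : x * α = Y f * X p - X f * Y p := by rw [hx, div_mul_cancel₀ _ hα0]
      refine ⟨(x, y), ?_⟩
      have hfe : fold e f g (x, y) = x • e + y • f := by simp [fold, hy0]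
      rw [hfe]
      apply hext
      · simp only [map_add, map_smul, smul_eq_mul]
        apply mul_right_cancel₀ hα0
        linear_combination X e * hx1 + X f * hy1 - X p * hα
      · simp only [map_add, map_smul, smul_eq_mul]
        apply mul_right_cancel₀ hα0
        linear_combination Y e * hx1 + Y f * hy1 - Y p * hα
      · simp only [Pi.add_apply, Pi.smul_apply, smul_eq_mul]
        linear_combination -hp - x * hκ1 - y * hk1 + κ * hx1 + k * α * hy1
    · rw [max_eq_right hs, max_eq_left (by linarith)] at hp
      obtain ⟨y, hy⟩ : ∃ y, y = -(α * (X e * Y p - Y e * X p)) / -(α * β) := ⟨_, rfl⟩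
      have hy0 : 0 ≤ y := hy ▸ div_nonneg (by linarith) (by linarith)
      have hy1 : y * β = X e * Y p - Y e * X p := by rw [hy]; field_simp
      obtain ⟨x, hx⟩ : ∃ x, x = (Y g * X p - X g * Y p) / β := ⟨_, rfl⟩
      have hx1 : x * β = Y g * X p - X g * Y p := by rw [hx, div_mul_cancel₀ _ hβ0]
      have q0 : x * X e + y * X g = X p := by
        apply mul_right_cancel₀ hβ0
        linear_combination X e * hx1 + X g * hy1 - X p * hβ
      have q1 : x * Y e + y * Y g = Y p := by
        apply mul_right_cancel₀ hβ0
        linear_combination Y e * hx1 + Y g * hy1 - Y p * hβ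
      refine ⟨(x, -y), ?_⟩
      have hfe : fold e f g (x, -y) = x • e + y • g := by simp [fold, hy0]
      rw [hfe]
      apply hext
      · simpa only [map_add, map_smul, smul_eq_mul] using q0
      · simpa only [map_add, map_smul, smul_eq_mul] using q1
      · simp only [Pi.add_apply, Pi.smul_apply, smul_eq_mul]
        linear_combination -hp - x * hκ1 - y * hk1' - k' * α * hy1 + κ * x * hα +
          κ * Y f * q0 - κ * X f * q1

/-- If a function is injective on `A`, some threshold is exceeded by exactly two of its values. -/
theorem exists_threshold {A : Finset (Fin 4)} (hA : 2 ≤ A.card) {r : Fin 4 → ℝ}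
    (hr : ∀ i ∈ A, ∀ j ∈ A, i ≠ j → r i ≠ r j) :
    ∃ κ : ℝ, ∃ i ∈ A, ∃ j ∈ A, i ≠ j ∧ κ < r i ∧ κ < r j ∧
      ∀ k ∈ A, k ≠ i → k ≠ j → r k < κ := by
  obtain ⟨i, hi, hmax⟩ := A.exists_max_image r (Finset.card_pos.1 (by omega))
  obtain ⟨j, hj, hmax'⟩ := (A.erase i).exists_max_image r
    (Finset.card_pos.1 (by rw [Finset.card_erase_of_mem hi]; omega))
  have hjA := Finset.mem_of_mem_erase hj
  have hji := Finset.ne_of_mem_erase hj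
  obtain ⟨κ, h1, h2⟩ := Order.exists_between_finsets (((A.erase i).erase j).image r) {r j} (by
    simp only [Finset.mem_image, Finset.mem_singleton]
    rintro _ ⟨k, hk, rfl⟩ _ rfl
    have hk' := Finset.mem_of_mem_erase hk
    exact lt_of_le_of_ne (hmax' k hk') (hr k (Finset.mem_of_mem_erase hk') j hjA
      (Finset.ne_of_mem_erase hk)))
  have hκ := h2 (r j) (Finset.mem_singleton_self _)
  refine ⟨κ, i, hi, j, hjA, hji.symm, hκ.trans_le (hmax j hjA), hκ, fun k hk hki hkj => ?_⟩
  exact h1 _ (Finset.mem_image_of_mem _ (Finset.mem_erase.2 ⟨hkj, Finset.mem_erase.2 ⟨hki, hk⟩⟩))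

/-- Four rays of a plane, none of which is on the first axis, are bent by a shear along this
axis so that two of them go to the right, and two to the left. -/
theorem exists_balancing_of_card {a b : Fin 4 → ℝ} (hb : ∀ i, b i ≠ 0)
    (hab : ∀ i j, i ≠ j → ∀ k : ℝ, 0 < k → a i = k * a j → b i ≠ k * b j)
    (hA : 2 ≤ (Finset.univ.filter fun i => 0 < b i).card) :
    ∃ k k' : ℝ, ∃ i j, i ≠ j ∧ (0 < a i + k * max (b i) 0 + k' * max (-b i) 0) ∧
      (0 < a j + k * max (b j) 0 + k' * max (-b j) 0) ∧
      ∀ n, n ≠ i → n ≠ j → a n + k * max (b n) 0 + k' * max (-b n) 0 < 0 := by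
  have hpos : ∀ i, i ∈ (Finset.univ.filter fun i => 0 < b i) ↔ 0 < b i := fun i => by simp
  obtain ⟨κ, i, hi, j, hj, hij, h1, h2, h3⟩ := exists_threshold hA (r := fun i => a i / b i) (by
    intro i hi j hj hij he
    rw [hpos] at hi hj
    rw [div_eq_div_iff hi.ne' hj.ne'] at he
    refine hab i j hij (b i / b j) (div_pos hi hj) ?_ ?_
    · field_simp; linarith
    · field_simp)
  obtain ⟨M, hM⟩ : ∃ M, ∀ n, |a n / b n| < M := by
    obtain ⟨M, hM⟩ := (Set.finite_range fun n => |a n / b n|).bddAbove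
    exact ⟨M + 1, fun n => (hM ⟨n, rfl⟩).trans_lt (lt_add_one M)⟩
  rw [hpos] at hi hj
  -- In the upper half-plane the shear by `-κ` leaves exactly two rays on the right; in the lower
  -- half-plane the shear by `-M` moves all rays to the left.
  refine ⟨-κ, -M, i, j, hij, ?_, ?_, fun n hni hnj => ?_⟩
  · rw [max_eq_left hi.le, max_eq_right (by linarith)]
    rw [lt_div_iff₀ hi] at h1
    linarith
  · rw [max_eq_left hj.le, max_eq_right (by linarith)]
    rw [lt_div_iff₀ hj] at h2
    linarith
  · rcases lt_or_gt_of_ne (hb n) with hn | hn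
    · rw [max_eq_right hn.le, max_eq_left (by linarith)]
      have := (abs_lt.1 (hM n)).1
      rw [lt_div_iff_of_neg hn] at this
      linarith
    · rw [max_eq_left hn.le, max_eq_right (by linarith)]
      have := h3 n ((hpos n).2 hn) hni hnj
      rw [div_lt_iff₀ hn] at this
      linarith

/-- The assumption on the number of rays in the upper half-plane is removed by a reflection. -/
theorem exists_balancing {a b : Fin 4 → ℝ} (hb : ∀ i, b i ≠ 0)
    (hab : ∀ i j, i ≠ j → ∀ k : ℝ, 0 < k → a i = k * a j → b i ≠ k * b j) :
    ∃ k k' : ℝ, ∃ i j, i ≠ j ∧ (0 < a i + k * max (b i) 0 + k' * max (-b i) 0) ∧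
      (0 < a j + k * max (b j) 0 + k' * max (-b j) 0) ∧
      ∀ n, n ≠ i → n ≠ j → a n + k * max (b n) 0 + k' * max (-b n) 0 < 0 := by
  by_cases hA : 2 ≤ (Finset.univ.filter fun i => 0 < b i).card
  · exact exists_balancing_of_card hb hab hA
  · have hA' : 2 ≤ (Finset.univ.filter fun i => 0 < -b i).card := by
      have h1 := Finset.card_filter_add_card_filter_not (s := (Finset.univ : Finset (Fin 4)))
        (fun i => 0 < b i)
      have h2 : (Finset.univ.filter fun i => ¬ 0 < b i) = Finset.univ.filter fun i => 0 < -b i := by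
        ext i
        simp only [Finset.mem_filter, Finset.mem_univ, true_and, not_lt, Left.neg_pos_iff]
        exact ⟨fun h => lt_of_le_of_ne h (hb i), le_of_lt⟩
      rw [h2, Finset.card_univ, Fintype.card_fin] at h1
      omega
    obtain ⟨k, k', i, j, hij, h1, h2, h3⟩ := exists_balancing_of_card (a := a) (b := fun i => -b i)
      (fun i => neg_ne_zero.2 (hb i)) (fun i j hij k hk ha hb' => hab i j hij k hk ha (by
        linarith)) hA'
    simp only [neg_neg] at h1 h2 h3
    exact ⟨k', k, i, j, hij, by linarith, by linarith, fun n hni hnj => by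
      linarith [h3 n hni hnj]⟩

/-- Independent horizontal vectors on the same side have different slopes. -/
theorem slope_ne_of_rayIndep {u v : Space} (h : RayIndep u v) (hu : u 2 = 0) (hv : v 2 = 0)
    (h0 : 0 < u 0 * v 0) : u 1 / u 0 ≠ v 1 / v 0 := by
  intro he
  have hu0 : u 0 ≠ 0 := by rintro h; simp [h] at h0
  have hv0 : v 0 ≠ 0 := by rintro h; simp [h] at h0
  rw [div_eq_div_iff hu0 hv0] at he
  refine h.2.2 (u 0 / v 0) ?_ ?_
  · rw [← mul_div_mul_right _ _ hv0]
    exact div_pos h0 (mul_self_pos.2 hv0)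
  · ext i
    fin_cases i
    · simp; field_simp
    · simp; field_simp; linarith
    · simp [hu, hv]

/-- Four different horizontal rays are made a flat cross by a conical germ that preserves the
heights. -/
theorem exists_conicalGerm_flatCross {w : Fin 4 → Space} (hw : ∀ i, w i 2 = 0)
    (hind : ∀ i j, i ≠ j → RayIndep (w i) (w j)) :
    ∃ c, ConicalGerm c ∧ (∀ p, c p 2 = p 2) ∧ FlatCross (Set.range fun i => c (w i)) := by
  -- A shear moves all rays off the first axis.
  obtain ⟨s, hs⟩ : ∃ s : ℝ, ∀ i, w i 1 + s * w i 0 ≠ 0 := by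
    obtain ⟨s, hs⟩ := Infinite.exists_notMem_finset
      (Finset.univ.image fun i : Fin 4 => -(w i 1) / w i 0)
    refine ⟨s, fun i h => hs (Finset.mem_image.2 ⟨i, Finset.mem_univ _, ?_⟩)⟩
    have h0 : w i 0 ≠ 0 := by
      intro h0
      rw [h0, mul_zero, add_zero] at h
      obtain ⟨j, hj⟩ : ∃ j, i ≠ j := ⟨_, (exists_ne i).choose_spec.symm⟩
      exact (hind i j hj).1 (by ext n; fin_cases n <;> simp [h0, h, hw])
    rw [div_eq_iff h0]
    linarith
  have h1 := conicalShear_conical (s • LinearMap.proj 0) 0 0 0 (w := ![0, 1, 0]) (by simp) (by simp)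
  set w' : Fin 4 → Space := fun i => conicalShear (s • LinearMap.proj 0) 0 0 0 ![0, 1, 0] (w i)
    with hw'
  have hw'0 : ∀ i, w' i 0 = w i 0 := fun i => by simp [hw', conicalShear_apply]
  have hw'1 : ∀ i, w' i 1 = w i 1 + s * w i 0 := fun i => by simp [hw', conicalShear_apply]
  have hw'2 : ∀ i, w' i 2 = 0 := fun i => by simp [hw', conicalShear_apply, hw]
  have hind' : ∀ i j, i ≠ j → RayIndep (w' i) (w' j) := fun i j hij =>
    (hind i j hij).map h1.injective h1.smul
  obtain ⟨k, k', i, j, hij, hi, hj, hrest⟩ := exists_balancing (a := fun i => w' i 0)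
    (b := fun i => w' i 1) (fun i => by rw [hw'1]; exact hs i) (by
      intro i j hij k hk ha hb
      refine (hind' i j hij).2.2 k hk ?_
      ext n; fin_cases n
      · simpa using ha
      · simpa using hb
      · simp [hw'2])
  have h2 := conicalShear_conical 0 (LinearMap.proj 1) k k' (w := ![1, 0, 0]) (by simp) (by simp)
  refine ⟨_, h2.comp h1, fun p => by simp [conicalShear_apply], ?_⟩
  set w'' : Fin 4 → Space := fun i => conicalShear 0 (LinearMap.proj 1) k k' ![1, 0, 0] (w' i)
    with hw''
  have hw''0 : ∀ i, w'' i 0 = w' i 0 + k * max (w' i 1) 0 + k' * max (-w' i 1) 0 := fun i => by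
    simp [hw'', conicalShear_apply, add_assoc]
  have hw''2 : ∀ i, w'' i 2 = 0 := fun i => by simp [hw'', conicalShear_apply, hw'2]
  have hind'' : ∀ i j, i ≠ j → RayIndep (w'' i) (w'' j) := fun i j hij =>
    (hind' i j hij).map h2.injective h2.smul
  change FlatCross (Set.range w'')
  obtain ⟨m, n, hmn, hcompl⟩ := Finset.card_eq_two.1 (show (({i, j} : Finset (Fin 4))ᶜ).card = 2 by
    rw [Finset.card_compl, Fintype.card_fin, Finset.card_pair hij])
  have hm : m ∈ ({i, j} : Finset (Fin 4))ᶜ := by rw [hcompl]; simp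
  have hn : n ∈ ({i, j} : Finset (Fin 4))ᶜ := by rw [hcompl]; simp
  simp only [Finset.mem_compl, Finset.mem_insert, Finset.mem_singleton, not_or] at hm hn
  have hall : ∀ l, l = i ∨ l = j ∨ l = m ∨ l = n := by
    intro l
    by_cases hl : l ∈ ({i, j} : Finset (Fin 4))
    · simp only [Finset.mem_insert, Finset.mem_singleton] at hl; tauto
    · rw [← Finset.mem_compl, hcompl] at hl
      simp only [Finset.mem_insert, Finset.mem_singleton] at hl; tauto
  have key : ∀ i j m n, (∀ l : Fin 4, l = i ∨ l = j ∨ l = m ∨ l = n) → 0 < w'' i 0 → 0 < w'' j 0 →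
      w'' m 0 < 0 → w'' n 0 < 0 → w'' i 1 / w'' i 0 < w'' j 1 / w'' j 0 →
      w'' m 1 / w'' m 0 < w'' n 1 / w'' n 0 → FlatCross (Set.range w'') := by
    intro i j m n hl h1 h2 h3 h4 h5 h6
    refine ⟨w'' i, w'' j, w'' m, w'' n, ?_, ⟨hw''2 i, hw''2 j, hw''2 m, hw''2 n⟩,
      ⟨h1, h2, h3, h4⟩, h5, h6⟩
    ext p
    constructor
    · rintro ⟨l, rfl⟩
      rcases hl l with rfl | rfl | rfl | rfl <;> simp
    · rintro (rfl | rfl | rfl | rfl) <;> exact ⟨_, rfl⟩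
  have pi : 0 < w'' i 0 := by rw [hw''0]; exact hi
  have pj : 0 < w'' j 0 := by rw [hw''0]; exact hj
  have pm : w'' m 0 < 0 := by rw [hw''0]; exact hrest m hm.1 hm.2
  have pn : w'' n 0 < 0 := by rw [hw''0]; exact hrest n hn.1 hn.2
  have sij := slope_ne_of_rayIndep (hind'' i j hij) (hw''2 i) (hw''2 j) (mul_pos pi pj)
  have smn := slope_ne_of_rayIndep (hind'' m n hmn) (hw''2 m) (hw''2 n)
    (mul_pos_of_neg_of_neg pm pn)
  rcases lt_or_gt_of_ne sij with h5 | h5 <;> rcases lt_or_gt_of_ne smn with h6 | h6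
  · exact key i j m n hall pi pj pm pn h5 h6
  · exact key i j n m (fun l => by have := hall l; tauto) pi pj pn pm h5 h6
  · exact key j i m n (fun l => by have := hall l; tauto) pj pi pm pn h5 h6
  · exact key j i n m (fun l => by have := hall l; tauto) pj pi pn pm h5 h6

/-- An injective map that is straight along two rays sends independent rays to independent rays. -/
theorem RayIndep.image {A u v : Space} {h : Space → Space}
    (hh : Function.Injective h) {u' v' : Space} (huv : RayIndep u v)
    (hu : ∃ r₀ > 0, ∀ r ∈ Icc (0 : ℝ) r₀, h (A + r • u) = h A + r • u')
    (hv : ∃ r₀ > 0, ∀ r ∈ Icc (0 : ℝ) r₀, h (A + r • v) = h A + r • v') : RayIndep u' v' := by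
  have hne : ∀ w w' : Space, w ≠ 0 →
      (∃ r₀ > 0, ∀ r ∈ Icc (0 : ℝ) r₀, h (A + r • w) = h A + r • w') → w' ≠ 0 := by
    rintro w w' hw ⟨r, hr, hrw⟩ rfl
    have := hrw r ⟨hr.le, le_rfl⟩
    rw [smul_zero, add_zero] at this
    have := hh this
    rw [add_eq_left, smul_eq_zero] at this
    exact this.elim hr.ne' hw
  refine ⟨hne u u' huv.1 hu, hne v v' huv.2.1 hv, fun k hk he => ?_⟩
  obtain ⟨r, hr, hru⟩ := hu
  obtain ⟨s, hs, hsv⟩ := hv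
  have hm : 0 < min r (s / k) := lt_min hr (div_pos hs hk)
  have h1 := hru (min r (s / k)) ⟨hm.le, min_le_left _ _⟩
  have h2 := hsv (min r (s / k) * k) ⟨by positivity, (le_div_iff₀ hk).1 (min_le_right _ _)⟩
  rw [he, smul_smul, ← h2] at h1
  have h3 := hh h1
  rw [add_right_inj, mul_smul] at h3
  exact huv.2.2 k hk (smul_right_injective _ hm.ne' h3)

/-- Some ambient isotopy makes all templates horizontal near the singular points, and makes the
knot a flat cross there. -/
theorem exists_straightening (K : SingularKnot) : ∃ Φ : AmbientPLIsotopy,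
    (∀ p ∈ Φ.map 1 '' K.carrier \ Φ.map 1 '' K.singularPoints,
      ∃ u v, RayIndep u v ∧ LooksLike (Φ.map 1 '' K.carrier) p {u, v}) ∧
    ∀ B ∈ K.singularPoints,
      (∀ᶠ q in 𝓝 B, q ∈ K.template B ↔ Φ.map 1 q 2 = Φ.map 1 B 2) ∧
      ∃ V, FlatCross V ∧ LooksLike (Φ.map 1 '' K.carrier) (Φ.map 1 B) V := by
  have hex : ∀ B ∈ K.singularPoints, ∃ c, ConicalGerm c ∧
      (∀ p, B + p ∈ K.template B ↔ c p 2 = 0) ∧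
      ∃ W : Set Space, W.Finite ∧ (∀ w ∈ W, w ≠ 0) ∧ LooksLike K.carrier B W ∧
        FlatCross (c '' W) := by
    intro B hB
    obtain ⟨e, f, g, hinj, hT, q, hq, hL⟩ := K.exists_rays_of_singular hB
    obtain ⟨c, hc, hc0⟩ := exists_flattening hinj
    have hind : ∀ i j, i ≠ j → RayIndep (fold e f g (q i)) (fold e f g (q j)) := fun i j hij =>
      (hq i j hij).map hinj fun r hr p => fold_smul e f g hr p
    obtain ⟨c', hc', hc'2, hcross⟩ := exists_conicalGerm_flatCross
      (w := fun i => c (fold e f g (q i))) (fun i => (hc0 _).1 ⟨_, rfl⟩)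
      (fun i j hij => (hind i j hij).map hc.injective hc.smul)
    refine ⟨_, hc'.comp hc, fun p => ?_, _, Set.finite_range _, ?_, hL, ?_⟩
    · rw [hc'2, ← hc0, hT]
      constructor
      · rintro ⟨x, hx⟩; exact ⟨x, add_left_cancel hx⟩
      · rintro ⟨x, hx⟩; exact ⟨x, by rw [← hx]⟩
    · rintro _ ⟨i, rfl⟩
      obtain ⟨j, hj⟩ : ∃ j, i ≠ j := ⟨_, (exists_ne i).choose_spec.symm⟩
      exact (hind i j hj).1
    · rw [← Set.range_comp]; exact hcross
  choose! c hc hcT hcW using hex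
  obtain ⟨Φ, hΦ⟩ := exists_isotopy_of_germs K.finite c hc
  -- Regular points stay regular, since the isotopy is piecewise linear and its end is injective.
  refine ⟨Φ, ?_, fun B hB => ⟨?_, ?_⟩⟩
  · rintro _ ⟨⟨p, hp, rfl⟩, hps⟩
    have hps' : p ∉ K.singularPoints := fun h => hps (mem_image_of_mem _ h)
    obtain ⟨u, v, huv, hL⟩ := K.exists_rays_of_regular hp hps'
    choose d hd using fun w => (Φ.pl 1).exists_direction p w
    refine ⟨d u, d v, RayIndep.image (Φ.map 1).injective huv (hd u) (hd v), ?_⟩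
    have := hL.image (by simp) (by rintro w (rfl | rfl); exacts [huv.1, huv.2.1]) (Φ.map 1) d
      (fun w _ => hd w)
    rwa [image_pair] at this
  · have ht : Tendsto (fun q : Space => q - B) (𝓝 B) (𝓝 0) := by
      have : Continuous fun q : Space => q - B := by fun_prop
      exact this.tendsto' B 0 (sub_self B)
    have hB0 : Φ.map 1 B = B := by
      have := (hΦ B hB).self_of_nhds
      rwa [add_zero, (hc B hB).zero, add_zero] at this
    filter_upwards [ht.eventually (hΦ B hB)] with q hq
    rw [add_sub_cancel] at hq
    have h1 := hcT B hB (q - B)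
    rw [add_sub_cancel] at h1
    rw [h1, hq, hB0, Pi.add_apply, add_eq_left]
  · obtain ⟨W, hW, hW0, hL, hcross⟩ := hcW B hB
    refine ⟨_, hcross, hL.image hW hW0 _ _ fun w _ => ?_⟩
    have hB0 : Φ.map 1 B = B := by
      have := (hΦ B hB).self_of_nhds
      rwa [add_zero, (hc B hB).zero, add_zero] at this
    obtain ⟨r₀, h₀, h⟩ := exists_radius_of_eventually (w := w) (hΦ B hB)
    refine ⟨r₀, h₀, fun r hr => ?_⟩
    have := h r hr
    rw [zero_add] at this
    rw [this, hB0, (hc B hB).smul r hr.1]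

/-! ### General position -/

/-- The set `X` with the singular points `S` is in general position with respect to the
projection to the first two coordinates, and to the first coordinate. The finite set `P` contains
the singular points and all points where `X` is not straight. -/
structure IsGeneric (X S P : Set Space) : Prop where
  compact : IsCompact X
  finite : P.Finite
  singular_subset : S ⊆ P
  subset : P ⊆ X
  straight : ∃ M : ℝ, ∀ p ∈ X \ P, ∃ d : Space, d 0 = 1 ∧ |d 1| ≤ M ∧ LooksLike X p {d, -d}
  bend : ∀ p ∈ P \ S, ∃ u v : Space, u 0 ≠ 0 ∧ v 0 ≠ 0 ∧
    (0 < u 0 * v 0 → u 1 / u 0 ≠ v 1 / v 0) ∧ LooksLike X p {u, v}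
  cross : ∀ p ∈ S, ∃ V, FlatCross V ∧ LooksLike X p V
  double_notMem : ∀ p ∈ X, ∀ q ∈ X, p ≠ q → p 0 = q 0 → p 1 = q 1 → p ∉ P
  double_transverse : ∀ p ∈ X, ∀ q ∈ X, p ≠ q → p 0 = q 0 → p 1 = q 1 → ∀ d d' : Space,
    d 0 = 1 → d' 0 = 1 → LooksLike X p {d, -d} → LooksLike X q {d', -d'} → d 1 ≠ d' 1
  no_triple : ∀ p ∈ X, ∀ q ∈ X, ∀ r ∈ X, p ≠ q → p ≠ r → q ≠ r →
    p 0 = q 0 → p 1 = q 1 → p 0 = r 0 → p 1 ≠ r 1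
  finite_special : (P ∪ {p ∈ X | ∃ q ∈ X, p ≠ q ∧ p 0 = q 0 ∧ p 1 = q 1}).Finite
  separated : ∀ p ∈ P ∪ {p ∈ X | ∃ q ∈ X, p ≠ q ∧ p 0 = q 0 ∧ p 1 = q 1},
    ∀ q ∈ P ∪ {p ∈ X | ∃ q ∈ X, p ≠ q ∧ p 0 = q 0 ∧ p 1 = q 1}, p 0 = q 0 → p 1 = q 1

open MvPolynomial in
/-- Finitely many nonzero polynomials have a common point where none of them vanishes. -/
theorem exists_generic_point {F : Set (MvPolynomial (Fin 2) ℝ)} (hF : F.Finite) :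
    ∃ x : Fin 2 → ℝ, ∀ f ∈ F, eval x f = 0 → f = 0 := by
  classical
  have h0 : ∏ f ∈ hF.toFinset.filter (· ≠ 0), f ≠ 0 :=
    Finset.prod_ne_zero_iff.2 fun f hf => (Finset.mem_filter.1 hf).2
  obtain ⟨x, hx⟩ : ∃ x, eval x (∏ f ∈ hF.toFinset.filter (· ≠ 0), f) ≠ 0 := by
    by_contra! h
    exact h0 (MvPolynomial.funext fun x => by rw [h x, map_zero])
  refine ⟨x, fun f hf hfx => ?_⟩
  by_contra hne
  rw [map_prod, Finset.prod_ne_zero_iff] at hx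
  exact hx f (Finset.mem_filter.2 ⟨hF.mem_toFinset.2 hf, hne⟩) hfx

section Polynomials

open MvPolynomial

/-- The first coordinate of the projection of a point along `(x 0, x 1, 1)`, as a polynomial
in `x`. -/
noncomputable def polyA (p : Space) : MvPolynomial (Fin 2) ℝ := C (p 0) - X 0 * C (p 2)

/-- The second coordinate of the projection of a point along `(x 0, x 1, 1)`, as a polynomial
in `x`. -/
noncomputable def polyB (p : Space) : MvPolynomial (Fin 2) ℝ := C (p 1) - X 1 * C (p 2)

theorem eval_polyA (x : Fin 2 → ℝ) (p : Space) : eval x (polyA p) = p 0 - x 0 * p 2 := by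
  simp [polyA]

theorem eval_polyB (x : Fin 2 → ℝ) (p : Space) : eval x (polyB p) = p 1 - x 1 * p 2 := by
  simp [polyB]

/-- The determinant of the projections of two vectors along `(x 0, x 1, 1)`, as a polynomial in `x`.
It vanishes at the directions for which the projections are parallel. -/
noncomputable def polyCross (u v : Space) : MvPolynomial (Fin 2) ℝ :=
  polyA u * polyB v - polyB u * polyA v

/-- A polynomial in the direction `x` of the projection. It vanishes if the projections of the lines
through `pᵢ` in the direction `dᵢ` are concurrent. -/
noncomputable def polyConcurrent (p₁ d₁ p₂ d₂ p₃ d₃ : Space) : MvPolynomial (Fin 2) ℝ :=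
  polyCross p₁ d₁ * polyCross d₂ d₃ + polyCross p₂ d₂ * polyCross d₃ d₁ +
    polyCross p₃ d₃ * polyCross d₁ d₂

/-- The determinant of the projections of two vectors along `(x 0, x 1, 1)`. -/
def projCross (x : Fin 2 → ℝ) (u v : Space) : ℝ :=
  (u 0 - x 0 * u 2) * (v 1 - x 1 * v 2) - (u 1 - x 1 * u 2) * (v 0 - x 0 * v 2)

theorem eval_polyCross (x : Fin 2 → ℝ) (u v : Space) :
    eval x (polyCross u v) = projCross x u v := by
  simp [polyCross, eval_polyA, eval_polyB, projCross]

theorem eval_polyConcurrent (x : Fin 2 → ℝ) (p₁ d₁ p₂ d₂ p₃ d₃ : Space) :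
    eval x (polyConcurrent p₁ d₁ p₂ d₂ p₃ d₃) = projCross x p₁ d₁ * projCross x d₂ d₃ +
      projCross x p₂ d₂ * projCross x d₃ d₁ + projCross x p₃ d₃ * projCross x d₁ d₂ := by
  simp [polyConcurrent, eval_polyCross]

/-- Vectors with parallel projections in all directions are parallel. -/
theorem parallel_of_polyCross_eq_zero {u v : Space} (hu : u ≠ 0) (h : polyCross u v = 0) :
    ∃ k : ℝ, v = k • u := by
  have hx : ∀ x, projCross x u v = 0 := fun x => by rw [← eval_polyCross, h, map_zero]
  have h0 := hx ![0, 0]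
  have h1 := hx ![1, 0]
  have h2 := hx ![0, 1]
  simp only [projCross, Matrix.cons_val_zero, Matrix.cons_val_one] at h0 h1 h2
  by_cases u0 : u 0 = 0
  · by_cases u1 : u 1 = 0
    · have u2 : u 2 ≠ 0 := fun u2 => hu (by ext i; fin_cases i <;> assumption)
      refine ⟨v 2 / u 2, ?_⟩
      ext i
      rw [Pi.smul_apply, smul_eq_mul, div_mul_eq_mul_div, eq_div_iff u2]
      fin_cases i <;> simp <;> linarith
    · refine ⟨v 1 / u 1, ?_⟩
      ext i
      rw [Pi.smul_apply, smul_eq_mul, div_mul_eq_mul_div, eq_div_iff u1]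
      fin_cases i <;> simp <;> linarith
  · refine ⟨v 0 / u 0, ?_⟩
    ext i
    rw [Pi.smul_apply, smul_eq_mul, div_mul_eq_mul_div, eq_div_iff u0]
    fin_cases i <;> simp <;> linarith

/-- If the projections of three lines along `(x 0, x 1, 1)` are pairwise transverse, and meet in
one point that has different preimages on the lines, then they are not concurrent for some other
direction: shift the direction so that the first line moves in itself. -/
theorem polyConcurrent_ne_zero {x : Fin 2 → ℝ} {a₁ d₁ a₂ d₂ a₃ d₃ : Space}
    (h12 : projCross x d₁ d₂ ≠ 0) (h13 : projCross x d₁ d₃ ≠ 0)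
    (hA2 : a₂ 0 - x 0 * a₂ 2 = a₁ 0 - x 0 * a₁ 2) (hB2 : a₂ 1 - x 1 * a₂ 2 = a₁ 1 - x 1 * a₁ 2)
    (hA3 : a₃ 0 - x 0 * a₃ 2 = a₁ 0 - x 0 * a₁ 2) (hB3 : a₃ 1 - x 1 * a₃ 2 = a₁ 1 - x 1 * a₁ 2)
    (hz : a₂ 2 ≠ a₃ 2) : polyConcurrent a₁ d₁ a₂ d₂ a₃ d₃ ≠ 0 := by
  obtain ⟨s, hs, hs'⟩ : ∃ s : ℝ, s ≠ 0 ∧ 1 - s * d₁ 2 ≠ 0 := by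
    by_cases h : d₁ 2 = 1
    · exact ⟨2, two_ne_zero, by rw [h]; norm_num⟩
    · exact ⟨1, one_ne_zero, by rw [one_mul]; exact sub_ne_zero.2 (Ne.symm h)⟩
  intro h
  -- The new direction differs from `x` by a multiple of the projection of `d₁`.
  have h0 : eval ![x 0 + s * (d₁ 0 - x 0 * d₁ 2), x 1 + s * (d₁ 1 - x 1 * d₁ 2)]
      (polyConcurrent a₁ d₁ a₂ d₂ a₃ d₃) = 0 := by rw [h, map_zero]
  rw [eval_polyConcurrent] at h0
  have A1 : a₁ 0 = (a₁ 0 - x 0 * a₁ 2) + x 0 * a₁ 2 := by ring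
  have B1 : a₁ 1 = (a₁ 1 - x 1 * a₁ 2) + x 1 * a₁ 2 := by ring
  have A2 : a₂ 0 = (a₁ 0 - x 0 * a₁ 2) + x 0 * a₂ 2 := by linarith
  have B2 : a₂ 1 = (a₁ 1 - x 1 * a₁ 2) + x 1 * a₂ 2 := by linarith
  have A3 : a₃ 0 = (a₁ 0 - x 0 * a₁ 2) + x 0 * a₃ 2 := by linarith
  have B3 : a₃ 1 = (a₁ 1 - x 1 * a₁ 2) + x 1 * a₃ 2 := by linarith
  have key : s * (1 - s * d₁ 2) * (a₂ 2 - a₃ 2) * projCross x d₁ d₂ * projCross x d₁ d₃ = 0 := by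
    rw [← h0]
    simp only [projCross, Matrix.cons_val_zero, Matrix.cons_val_one]
    rw [A2, B2, A3, B3]
    ring
  have := mul_ne_zero (mul_ne_zero (mul_ne_zero (mul_ne_zero hs hs') (sub_ne_zero.2 hz)) h12) h13
  exact this key

end Polynomials

/-- If one of two opposite directions at `p` is a ray of `X` and so is the other one, they are the
only two rays in a two-ray picture. -/
theorem LooksLike.straight {X : Set Space} {p u v d : Space} (h : LooksLike X p {u, v})
    (hd : d ≠ 0) (h1 : HasRay X p d) (h2 : HasRay X p (-d)) : LooksLike X p {d, -d} := by
  have hpos : ∀ {w w' : Space} {k : ℝ}, w' ≠ 0 → 0 ≤ k → w' = k • w → w = k⁻¹ • w' ∧ 0 ≤ k⁻¹ := by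
    intro w w' k hw' hk he
    have hk0 : k ≠ 0 := by rintro rfl; simp at he; exact hw' he
    exact ⟨by rw [he, smul_smul, inv_mul_cancel₀ hk0, one_smul], inv_nonneg.2 hk⟩
  obtain ⟨a, ha, k, hk, hka⟩ := h.exists_of_hasRay h1
  obtain ⟨b, hb, l, hl, hlb⟩ := h.exists_of_hasRay h2
  obtain ⟨ea, hk'⟩ := hpos hd hk hka
  obtain ⟨eb, hl'⟩ := hpos (neg_ne_zero.2 hd) hl hlb
  have hab : a ≠ b := by
    rintro rfl
    have h0 : (k + l) • a = 0 := by rw [add_smul, ← hka, ← hlb, add_neg_cancel]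
    rcases smul_eq_zero.1 h0 with h0 | h0
    · have : k = 0 := by linarith
      rw [this, zero_smul] at hka
      exact hd hka
    · rw [h0, smul_zero] at hka
      exact hd hka
  refine h.congr_rays ?_ ?_
  · have hw : ∀ w ∈ ({u, v} : Set Space), w = a ∨ w = b := by
      intro w hw
      rcases ha with ha | ha <;> rcases hb with hb | hb <;> rcases hw with hw | hw
      all_goals first
        | exact Or.inl (hw.trans ha.symm)
        | exact Or.inr (hw.trans hb.symm)
        | exact absurd (ha.trans hb.symm) hab
    intro w hw'
    rcases hw w hw' with rfl | rfl
    · exact ⟨d, by simp, _, hk', ea⟩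
    · exact ⟨-d, by simp, _, hl', eb⟩
  · rintro w (rfl | rfl)
    · exact ⟨a, ha, k, hk, hka⟩
    · exact ⟨b, hb, l, hl, hlb⟩

/-- A point with two rays that is not the end of any of the segments lies in the interior of a
segment and is straight. -/
theorem exists_straight_of_segments {X : Set Space} {T : Set (Space × Space)}
    (hT : X = ⋃ e ∈ T, segment ℝ e.1 e.2) (hne : ∀ e ∈ T, e.1 ≠ e.2) {p : Space} (hp : p ∈ X)
    (hend : ∀ e ∈ T, p ≠ e.1 ∧ p ≠ e.2) (hreg : ∃ u v, LooksLike X p {u, v}) :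
    ∃ e ∈ T, LooksLike X p {e.2 - e.1, -(e.2 - e.1)} := by
  obtain ⟨u, v, huv⟩ := hreg
  have hp' := hp
  rw [hT] at hp'
  obtain ⟨e, he, hpe⟩ := mem_iUnion₂.1 hp'
  refine ⟨e, he, huv.straight (sub_ne_zero.2 (hne e he).symm) ?_ ?_⟩
  all_goals
    have hsub : segment ℝ e.1 e.2 ⊆ X := by
      rw [hT]; exact subset_biUnion_of_mem (u := fun e : Space × Space => segment ℝ e.1 e.2) he
    rw [segment_eq_image'] at hpe hsub
    obtain ⟨t, ht, rfl⟩ := hpe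
    have ht0 : 0 < t := lt_of_le_of_ne ht.1 (by
      rintro rfl; exact (hend e he).1 (by simp))
    have ht1 : t < 1 := lt_of_le_of_ne ht.2 (by
      rintro rfl; exact (hend e he).2 (by simp))
  · refine ⟨1 - t, sub_pos.2 ht1, fun r hr => hsub ⟨t + r, ⟨add_nonneg ht.1 hr.1, by
      linarith [hr.2]⟩, ?_⟩⟩
    simp only [add_smul, add_assoc]
  · refine ⟨t, ht0, fun r hr => hsub ⟨t - r, ⟨by linarith [hr.2], by linarith [hr.1]⟩, ?_⟩⟩
    simp only [sub_smul, smul_neg]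
    abel

theorem exists_notMem_of_finite {P : Set Space} (hP : P.Finite) (p : Space) {w : Space}
    (hw : w ≠ 0) {r₀ : ℝ} (h₀ : 0 < r₀) : ∃ r ∈ Ioo 0 r₀, p + r • w ∉ P := by
  have hinj : Function.Injective fun r : ℝ => p + r • w := fun r s h =>
    smul_left_injective ℝ hw (add_left_cancel h)
  obtain ⟨r, hr, hrP⟩ := ((Ioo_infinite h₀).sdiff (hP.preimage hinj.injOn)).nonempty
  exact ⟨r, hr, hrP⟩

/-- Every ray of `X` is parallel to one of the segments. -/
theorem exists_parallel_of_hasRay {X P : Set Space} {T : Set (Space × Space)} (hP : P.Finite)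
    (hst : ∀ p ∈ X \ P, ∃ e ∈ T, LooksLike X p {e.2 - e.1, -(e.2 - e.1)}) {p w : Space}
    (hw : w ≠ 0) (h : HasRay X p w) : ∃ e ∈ T, ∃ k : ℝ, k ≠ 0 ∧ w = k • (e.2 - e.1) := by
  obtain ⟨r₀, h₀, hr₀⟩ := h
  obtain ⟨r, hr, hrP⟩ := exists_notMem_of_finite hP p hw h₀
  obtain ⟨e, he, hL⟩ := hst _ ⟨hr₀ r ⟨hr.1.le, hr.2.le⟩, hrP⟩
  have hray : HasRay X (p + r • w) w := by
    refine ⟨r₀ - r, sub_pos.2 hr.2, fun s hs => ?_⟩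
    rw [add_assoc, ← add_smul]
    exact hr₀ _ ⟨by linarith [hr.1, hs.1], by linarith [hs.2]⟩
  obtain ⟨v, hv, k, hk, hkv⟩ := hL.exists_of_hasRay hray
  have hk0 : k ≠ 0 := by rintro rfl; rw [zero_smul] at hkv; exact hw hkv
  rcases hv with rfl | rfl
  · exact ⟨e, he, k, hk0, hkv⟩
  · exact ⟨e, he, -k, neg_ne_zero.2 hk0, by rw [hkv, smul_neg, neg_smul]⟩

/-- The two coordinates of the projection along `(x 0, x 1, 1)` agree for two points. -/
def SameProj (x : Fin 2 → ℝ) (p q : Space) : Prop :=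
  p 0 - x 0 * p 2 = q 0 - x 0 * q 2 ∧ p 1 - x 1 * p 2 = q 1 - x 1 * q 2

/-- A generic projection separates the points of `P`, sends no other point of `X` to the image of a
point of `P`, and has only transverse double points and no triple points. -/
theorem exists_generic_direction {P : Set Space} (hP : P.Finite) {T : Set (Space × Space)}
    (hTf : T.Finite) (hTP : ∀ e ∈ T, e.1 ∈ P ∧ e.2 ∈ P) (hne : ∀ e ∈ T, e.1 ≠ e.2) {X : Set Space}
    (hT : X = ⋃ e ∈ T, segment ℝ e.1 e.2) :
    ∃ x : Fin 2 → ℝ,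
      (∀ p ∈ P, ∀ q ∈ P, SameProj x p q → p = q) ∧
      (∀ p ∈ X, ∀ q ∈ X, p ≠ q → SameProj x p q → p ∉ P ∧
        ∀ e ∈ T, ∀ e' ∈ T, p ∈ segment ℝ e.1 e.2 → q ∈ segment ℝ e'.1 e'.2 →
          projCross x (e.2 - e.1) (e'.2 - e'.1) ≠ 0) ∧
      (∀ p ∈ X, ∀ q ∈ X, ∀ r ∈ X, p ≠ q → p ≠ r → q ≠ r → SameProj x p q → ¬ SameProj x p r) := by
  classical
  -- The conditions: different points of `P` have different projections, triples of points of `P`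
  -- that are not collinear have projections that are not collinear, and triples of edges that are
  -- not always concurrent are not concurrent.
  set F : Set (MvPolynomial (Fin 2) ℝ) :=
    ((fun z : Space × Space => polyA (z.2 - z.1)) '' (P ×ˢ P) ∪
    (fun z : Space × Space => polyB (z.2 - z.1)) '' (P ×ˢ P)) ∪
    ((fun z : Space × Space × Space => polyCross (z.2.1 - z.1) (z.2.2 - z.1)) '' (P ×ˢ P ×ˢ P) ∪
    (fun z : (Space × Space) × (Space × Space) × (Space × Space) =>
      polyConcurrent z.1.1 (z.1.2 - z.1.1) z.2.1.1 (z.2.1.2 - z.2.1.1) z.2.2.1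
        (z.2.2.2 - z.2.2.1)) '' (T ×ˢ T ×ˢ T)) with hF
  have hFf : F.Finite := (((hP.prod hP).image _).union ((hP.prod hP).image _)).union
    (((hP.prod (hP.prod hP)).image _).union ((hTf.prod (hTf.prod hTf)).image _))
  obtain ⟨x, hx⟩ := exists_generic_point hFf
  have hA : ∀ p ∈ P, ∀ q ∈ P, MvPolynomial.eval x (polyA (q - p)) = 0 → polyA (q - p) = 0 :=
    fun p hp q hq => hx _ (Or.inl (Or.inl ⟨(p, q), ⟨hp, hq⟩, rfl⟩))
  have hB : ∀ p ∈ P, ∀ q ∈ P, MvPolynomial.eval x (polyB (q - p)) = 0 → polyB (q - p) = 0 :=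
    fun p hp q hq => hx _ (Or.inl (Or.inr ⟨(p, q), ⟨hp, hq⟩, rfl⟩))
  have hC : ∀ p ∈ P, ∀ q ∈ P, ∀ r ∈ P, projCross x (q - p) (r - p) = 0 →
      polyCross (q - p) (r - p) = 0 := fun p hp q hq r hr h0 =>
    hx _ (Or.inr (Or.inl ⟨(p, q, r), ⟨hp, hq, hr⟩, rfl⟩)) (by rw [eval_polyCross, h0])
  have hQ : ∀ e₁ ∈ T, ∀ e₂ ∈ T, ∀ e₃ ∈ T, MvPolynomial.eval x (polyConcurrent e₁.1 (e₁.2 - e₁.1)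
      e₂.1 (e₂.2 - e₂.1) e₃.1 (e₃.2 - e₃.1)) = 0 → polyConcurrent e₁.1 (e₁.2 - e₁.1)
      e₂.1 (e₂.2 - e₂.1) e₃.1 (e₃.2 - e₃.1) = 0 := fun e₁ h₁ e₂ h₂ e₃ h₃ =>
    hx _ (Or.inr (Or.inr ⟨(e₁, e₂, e₃), ⟨h₁, h₂, h₃⟩, rfl⟩))
  have hdist : ∀ p ∈ P, ∀ q ∈ P, SameProj x p q → p = q := by
    intro p hp q hq h
    have h1 := hA p hp q hq (by
      rw [eval_polyA, Pi.sub_apply, Pi.sub_apply]; linarith [h.1])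
    have h2 := hB p hp q hq (by
      rw [eval_polyB, Pi.sub_apply, Pi.sub_apply]; linarith [h.2])
    have a0 := eval_polyA ![0, 0] (q - p)
    have a1 := eval_polyA ![1, 0] (q - p)
    have b0 := eval_polyB ![0, 0] (q - p)
    rw [h1, map_zero] at a0 a1
    rw [h2, map_zero] at b0
    simp at a0 a1 b0
    ext i; fin_cases i <;> simp <;> linarith
  have hmem : ∀ {p : Space}, p ∈ X → ∃ e ∈ T, p ∈ segment ℝ e.1 e.2 := by
    intro p hp; rw [hT] at hp; simpa using hp
  have hparam : ∀ {p : Space} {e : Space × Space}, p ∈ segment ℝ e.1 e.2 →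
      ∃ t : ℝ, p = e.1 + t • (e.2 - e.1) := by
    intro p e hp
    rw [segment_eq_image'] at hp
    obtain ⟨t, -, rfl⟩ := hp
    exact ⟨t, rfl⟩
  -- Two points of a line through points of `P` are distinguished by the projection.
  have hline : ∀ p ∈ P, ∀ q ∈ P, p ≠ q → ∀ s t : ℝ,
      SameProj x (p + s • (q - p)) (p + t • (q - p)) → s = t := by
    intro p hp q hq hpq s t h
    by_contra hst
    apply hpq
    apply hdist p hp q hq
    obtain ⟨h1, h2⟩ := h
    simp only [Pi.add_apply, Pi.smul_apply, Pi.sub_apply, smul_eq_mul] at h1 h2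
    have hst' := sub_ne_zero.2 hst
    constructor
    · apply mul_left_cancel₀ hst'; linarith
    · apply mul_left_cancel₀ hst'; linarith
  -- Edges with parallel projections that overlap lie on one line, since the ends of the second edge
  -- are collinear with the first one; such a line is projected injectively.
  have htrans : ∀ {p q : Space}, p ≠ q → SameProj x p q → ∀ e ∈ T, ∀ e' ∈ T,
      p ∈ segment ℝ e.1 e.2 → q ∈ segment ℝ e'.1 e'.2 →
      projCross x (e.2 - e.1) (e'.2 - e'.1) ≠ 0 := by
    intro p q hpq hs e he e' he' hpe hqe h0
    obtain ⟨t, rfl⟩ := hparam hpe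
    obtain ⟨t', rfl⟩ := hparam hqe
    have hd : e.2 - e.1 ≠ 0 := sub_ne_zero.2 (hne e he).symm
    obtain ⟨hs1, hs2⟩ := hs
    simp only [projCross, Pi.add_apply, Pi.smul_apply, Pi.sub_apply, smul_eq_mul] at hs1 hs2 h0
    obtain ⟨k, hk⟩ := parallel_of_polyCross_eq_zero hd (hC _ (hTP e he).1 _ (hTP e he).2 _
      (hTP e' he').1 (by
        simp only [projCross, Pi.sub_apply]
        linear_combination -t' * h0 - (e.2 0 - e.1 0 - x 0 * (e.2 2 - e.1 2)) * hs2 +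
          (e.2 1 - e.1 1 - x 1 * (e.2 2 - e.1 2)) * hs1))
    obtain ⟨k', hk'⟩ := parallel_of_polyCross_eq_zero hd (hC _ (hTP e he).1 _ (hTP e he).2 _
      (hTP e' he').2 (by
        simp only [projCross, Pi.sub_apply]
        linear_combination (1 - t') * h0 - (e.2 0 - e.1 0 - x 0 * (e.2 2 - e.1 2)) * hs2 +
          (e.2 1 - e.1 1 - x 1 * (e.2 2 - e.1 2)) * hs1))
    have e1 : e'.1 = e.1 + k • (e.2 - e.1) := by rw [← hk]; abel
    have e2 : e'.2 = e.1 + k' • (e.2 - e.1) := by rw [← hk']; abel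
    have e3 : e'.1 + t' • (e'.2 - e'.1) = e.1 + (k + t' * (k' - k)) • (e.2 - e.1) := by
      rw [e1, e2, add_sub_add_left_eq_sub, ← sub_smul, smul_smul, add_smul, add_assoc]
    rw [e3] at hpq
    have := hline _ (hTP e he).1 _ (hTP e he).2 (hne e he) t (k + t' * (k' - k)) (by
      rw [← e3]
      exact ⟨by simpa using hs1, by simpa using hs2⟩)
    rw [← this] at hpq
    exact hpq rfl
  refine ⟨x, hdist, fun p hp q hq hpq hs => ⟨fun hpP => ?_, fun e he e' he' h1 h2 =>
    htrans hpq hs e he e' he' h1 h2⟩, ?_⟩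
  · obtain ⟨e, he, hqe⟩ := hmem hq
    obtain ⟨t, rfl⟩ := hparam hqe
    have hd : e.2 - e.1 ≠ 0 := sub_ne_zero.2 (hne e he).symm
    obtain ⟨hs1, hs2⟩ := hs
    simp only [Pi.add_apply, Pi.smul_apply, Pi.sub_apply, smul_eq_mul] at hs1 hs2
    obtain ⟨k, hk⟩ := parallel_of_polyCross_eq_zero hd (hC _ (hTP e he).1 _ (hTP e he).2 _ hpP (by
        simp only [projCross, Pi.sub_apply]
        linear_combination (e.2 0 - e.1 0 - x 0 * (e.2 2 - e.1 2)) * hs2 -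
          (e.2 1 - e.1 1 - x 1 * (e.2 2 - e.1 2)) * hs1))
    have e1 : p = e.1 + k • (e.2 - e.1) := by rw [← hk]; abel
    have := hline _ (hTP e he).1 _ (hTP e he).2 (hne e he) k t (by
      rw [← e1]
      exact ⟨by simpa using hs1, by simpa using hs2⟩)
    rw [← this, ← e1] at hpq
    exact hpq rfl
  · intro p hp q hq r hr hpq hpr hqr h1 h2
    obtain ⟨e, he, hpe⟩ := hmem hp
    obtain ⟨e', he', hqe⟩ := hmem hq
    obtain ⟨e'', he'', hre⟩ := hmem hr
    have c12 := htrans hpq h1 e he e' he' hpe hqe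
    have c13 := htrans hpr h2 e he e'' he'' hpe hre
    obtain ⟨t, ht⟩ := hparam hpe
    obtain ⟨t', ht'⟩ := hparam hqe
    obtain ⟨t'', ht''⟩ := hparam hre
    -- The polynomial of three edges can be computed with any points of their lines, here with the
    -- three points that have the same projection.
    have hshift : ∀ y : Fin 2 → ℝ, MvPolynomial.eval y (polyConcurrent e.1 (e.2 - e.1) e'.1
        (e'.2 - e'.1) e''.1 (e''.2 - e''.1)) = MvPolynomial.eval y (polyConcurrent p (e.2 - e.1) q
        (e'.2 - e'.1) r (e''.2 - e''.1)) := by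
      intro y
      rw [eval_polyConcurrent, eval_polyConcurrent]
      have hsh : ∀ (a d : Space) (s : ℝ), projCross y (a + s • d) d = projCross y a d := by
        intro a d s
        simp only [projCross, Pi.add_apply, Pi.smul_apply, smul_eq_mul]
        ring
      rw [ht, ht', ht'', hsh, hsh, hsh]
    have heq : polyConcurrent p (e.2 - e.1) q (e'.2 - e'.1) r (e''.2 - e''.1) =
        polyConcurrent e.1 (e.2 - e.1) e'.1 (e'.2 - e'.1) e''.1 (e''.2 - e''.1) :=
      MvPolynomial.funext fun y => (hshift y).symm
    have hz : q 2 ≠ r 2 := by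
      intro hz
      apply hqr
      have a1 := h1.1
      have a2 := h1.2
      have a3 := h2.1
      have a4 := h2.2
      rw [hz] at a1 a2
      ext i; fin_cases i <;> simp <;> linarith
    refine polyConcurrent_ne_zero c12 c13 h1.1.symm h1.2.symm h2.1.symm h2.2.symm hz ?_
    rw [heq]
    apply hQ e he e' he' e'' he''
    rw [hshift, eval_polyConcurrent]
    simp only [projCross]
    rw [← h1.1, ← h1.2, ← h2.1, ← h2.2]
    ring

/-- A flat cross stays a flat cross under a slight horizontal shear. -/
theorem FlatCross.eventually_shear {V : Set Space} (h : FlatCross V) :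
    ∀ᶠ s in 𝓝 (0 : ℝ), ∀ L : Space → Space,
      (∀ p, p 2 = 0 → L p 0 = p 0 + s * p 1 ∧ L p 1 = p 1 ∧ L p 2 = 0) → FlatCross (L '' V) := by
  obtain ⟨u, u', v, v', rfl, ⟨hu, hu', hv, hv'⟩, ⟨pu, pu', pv, pv'⟩, h1, h2⟩ := h
  have ht : ∀ w : Space, Tendsto (fun s : ℝ => w 0 + s * w 1) (𝓝 0) (𝓝 (w 0)) := fun w => by
    have : Continuous fun s : ℝ => w 0 + s * w 1 := by fun_prop
    exact this.tendsto' 0 _ (by simp)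
  filter_upwards [(ht u).eventually (lt_mem_nhds pu), (ht u').eventually (lt_mem_nhds pu'),
    (ht v).eventually (gt_mem_nhds pv),
      (ht v').eventually (gt_mem_nhds pv')] with s e1 e2 e3 e4 L hL
  obtain ⟨a0, a1, a2⟩ := hL u hu
  obtain ⟨b0, b1, b2⟩ := hL u' hu'
  obtain ⟨c0, c1, c2⟩ := hL v hv
  obtain ⟨d0, d1, d2⟩ := hL v' hv'
  refine ⟨L u, L u', L v, L v', ?_, ⟨a2, b2, c2, d2⟩, ?_, ?_, ?_⟩
  · simp [image_insert_eq]
  · rw [a0, b0, c0, d0]; exact ⟨e1, e2, e3, e4⟩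
  · rw [a0, a1, b0, b1, div_lt_div_iff₀ e1 e2]
    rw [div_lt_div_iff₀ pu pu'] at h1
    linarith
  · rw [c0, c1, d0, d1, ← neg_div_neg_eq, ← neg_div_neg_eq (v' 1),
      div_lt_div_iff₀ (by linarith) (by linarith)]
    rw [← neg_div_neg_eq, ← neg_div_neg_eq (v' 1),
      div_lt_div_iff₀ (by linarith) (by linarith)] at h2
    linarith

/-- Almost every shear separates the abscissas of points with different ordinates. -/
theorem eventually_separated (a b a' b' : ℝ) :
    ∀ᶠ s in 𝓝[≠] (0 : ℝ), a + s * b = a' + s * b' → b = b' := by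
  by_cases hb : b = b'
  · exact Eventually.of_forall fun _ _ => hb
  · have : ∀ᶠ s in 𝓝[≠] (0 : ℝ), s ≠ (a' - a) / (b - b') := by
      by_cases h0 : (a' - a) / (b - b') = 0
      · rw [h0]; exact self_mem_nhdsWithin
      · exact mem_nhdsWithin_of_mem_nhds (isOpen_ne.mem_nhds (Ne.symm h0))
    filter_upwards [this] with s hs h
    exact absurd ((eq_div_iff (sub_ne_zero.2 hb)).2 (by linarith)) hs

/-- A linear projection and a slight shear, realized by an ambient isotopy, put a set that is
locally a union of rays in general position. -/
theorem exists_generic_position {X S : Set Space} (hX : IsCompact X) (hS : S.Finite) (hSX : S ⊆ X)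
    (hreg : ∀ p ∈ X \ S, ∃ u v, RayIndep u v ∧ LooksLike X p {u, v})
    (hcross : ∀ p ∈ S, ∃ V, FlatCross V ∧ LooksLike X p V) :
    ∃ (Φ : AmbientPLIsotopy) (P : Set Space),
      IsGeneric (Φ.map 1 '' X) (Φ.map 1 '' S) P ∧ ∀ p, Φ.map 1 p 2 = p 2 := by
  obtain ⟨T, hTf, hT, hTne⟩ := exists_finite_segments hX (fun _ => True) (by
    intro p hp
    by_cases hpS : p ∈ S
    · obtain ⟨V, ⟨u, u', v, v', rfl, -, ⟨h1, h2, h3, h4⟩, -⟩, hL⟩ := hcross p hpS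
      refine ⟨_, by simp, ?_, hL⟩
      rintro w (rfl | rfl | rfl | rfl) <;> refine ⟨?_, trivial⟩ <;> rintro rfl <;> simp at *
    · obtain ⟨u, v, huv, hL⟩ := hreg p ⟨hp, hpS⟩
      refine ⟨_, by simp, ?_, hL⟩
      rintro w (rfl | rfl)
      exacts [⟨huv.1, trivial⟩, ⟨huv.2.1, trivial⟩])
  have hne : ∀ e ∈ T, e.1 ≠ e.2 := by
    intro e he h
    obtain ⟨v, hv, -, r, hr, he'⟩ := hTne e he
    rw [← h, left_eq_add, smul_eq_zero] at he'
    exact he'.elim hr.ne' hv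
  set P₀ : Set Space := (Prod.fst '' T ∪ Prod.snd '' T) ∪ S with hP₀
  have hP₀f : P₀.Finite := ((hTf.image _).union (hTf.image _)).union hS
  have hTP : ∀ e ∈ T, e.1 ∈ P₀ ∧ e.2 ∈ P₀ := fun e he =>
    ⟨Or.inl (Or.inl ⟨e, he, rfl⟩), Or.inl (Or.inr ⟨e, he, rfl⟩)⟩
  have hsegX : ∀ e ∈ T, segment ℝ e.1 e.2 ⊆ X := by
    intro e he
    rw [hT]; exact subset_biUnion_of_mem (u := fun e : Space × Space => segment ℝ e.1 e.2) he
  have hP₀X : P₀ ⊆ X := by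
    rintro p ((⟨e, he, rfl⟩ | ⟨e, he, rfl⟩) | hp)
    · exact hsegX e he (left_mem_segment _ _ _)
    · exact hsegX e he (right_mem_segment _ _ _)
    · exact hSX hp
  have hst : ∀ p ∈ X \ P₀, ∃ e ∈ T, LooksLike X p {e.2 - e.1, -(e.2 - e.1)} := by
    rintro p ⟨hp, hpP⟩
    refine exists_straight_of_segments hT hne hp (fun e he => ⟨?_, ?_⟩) ?_
    · rintro rfl; exact hpP (hTP e he).1
    · rintro rfl; exact hpP (hTP e he).2
    · obtain ⟨u, v, -, h⟩ := hreg p ⟨hp, fun h => hpP (Or.inr h)⟩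
      exact ⟨u, v, h⟩
  obtain ⟨x, hx1, hx2, hx3⟩ := exists_generic_direction hP₀f hTf hTP hne hT
  have hmem : ∀ {p : Space}, p ∈ X → ∃ e ∈ T, p ∈ segment ℝ e.1 e.2 := by
    intro p hp; rw [hT] at hp; simpa using hp
  set D : Set Space := {p ∈ X | ∃ q ∈ X, p ≠ q ∧ SameProj x p q} with hD
  -- Two edges with transverse projections cross at most once.
  have hDf : D.Finite := by
    have : ∀ p ∈ D, ∃ z : (Space × Space) × (Space × Space), z ∈ T ×ˢ T ∧
        p ∈ segment ℝ z.1.1 z.1.2 ∧ ∃ q ∈ segment ℝ z.2.1 z.2.2, p ≠ q ∧ SameProj x p q := by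
      rintro p ⟨hp, q, hq, hpq, hs⟩
      obtain ⟨e, he, hpe⟩ := hmem hp
      obtain ⟨e', he', hqe⟩ := hmem hq
      exact ⟨(e, e'), ⟨he, he'⟩, hpe, q, hqe, hpq, hs⟩
    choose! z hzT hpz hq using this
    refine Set.Finite.of_injOn (f := z) (t := T ×ˢ T) hzT ?_ (hTf.prod hTf)
    intro p hp p' hp' he
    have h1 := hpz p hp
    obtain ⟨q, hqz, hpq, hs⟩ := hq p hp
    have h1' := hpz p' hp'
    obtain ⟨q', hqz', hpq', hs'⟩ := hq p' hp'
    rw [← he] at h1' hqz'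
    have hT' := hzT p hp
    have hcr := (hx2 p hp.1 q (hsegX _ hT'.2 hqz) hpq hs).2 _ hT'.1 _ hT'.2 h1 hqz
    rw [segment_eq_image'] at h1 h1' hqz hqz'
    clear he
    generalize z p = e at *
    obtain ⟨t, -, rfl⟩ := h1
    obtain ⟨t', -, rfl⟩ := h1'
    obtain ⟨r, -, rfl⟩ := hqz
    obtain ⟨r', -, rfl⟩ := hqz'
    obtain ⟨a1, a2⟩ := hs
    obtain ⟨b1, b2⟩ := hs'
    simp only [projCross, Pi.add_apply, Pi.smul_apply, Pi.sub_apply, smul_eq_mul] at a1 a2 b1 b2 hcr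
    have : t - t' = 0 := by
      apply (mul_eq_zero.1 (?_ : (t - t') * _ = 0)).resolve_right hcr
      linear_combination (e.2.2 1 - e.2.1 1 - x 1 * (e.2.2 2 - e.2.1 2)) * (a1 - b1) -
        (e.2.2 0 - e.2.1 0 - x 0 * (e.2.2 2 - e.2.1 2)) * (a2 - b2)
    rw [sub_eq_zero.1 this]
  choose! V hVc hVL using hcross
  -- The slight shear separates the abscissas of all special points, and keeps the flat crosses.
  have hev : ∀ᶠ s in 𝓝[≠] (0 : ℝ), (∀ p ∈ P₀ ∪ D, ∀ q ∈ P₀ ∪ D,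
      (p 0 - x 0 * p 2) + s * (p 1 - x 1 * p 2) = (q 0 - x 0 * q 2) + s * (q 1 - x 1 * q 2) →
        p 1 - x 1 * p 2 = q 1 - x 1 * q 2) ∧
      ∀ p ∈ S, ∀ L : Space → Space, (∀ p, p 2 = 0 → L p 0 = p 0 + s * p 1 ∧ L p 1 = p 1 ∧
        L p 2 = 0) → FlatCross (L '' V p) := by
    have hfin := hP₀f.union hDf
    refine Eventually.and ?_ ?_
    · exact (eventually_all_finite hfin).2 fun p _ => (eventually_all_finite hfin).2 fun q _ =>
        eventually_separated _ _ _ _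
    · exact (eventually_all_finite hS).2 fun p hp =>
        (hVc p hp).eventually_shear.filter_mono nhdsWithin_le_nhds
  obtain ⟨s, hs1, hs2⟩ := hev.exists
  set Φ : AmbientPLIsotopy :=
    (shear (fun p => p 2) ![-x 0, -x 1, 0] (PL.id.apply 2) (by simp)).trans
    (shear (fun p => s * p 1) ![1, 0, 0] ((PL.id.apply 1).const_mul s) (by simp)) with hΦ
  have hΦi : ∀ p, Φ.map 1 p = p + p 2 • ![-x 0, -x 1, 0] +
      (s * (p + p 2 • ![-x 0, -x 1, 0] : Space) 1) • ![1, 0, 0] := fun p => by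
    rw [hΦ, AmbientPLIsotopy.trans_apply, shear_apply, shear_apply]
  have hΦ0 : ∀ p, Φ.map 1 p 0 = (p 0 - x 0 * p 2) + s * (p 1 - x 1 * p 2) := fun p => by
    rw [hΦi]
    change p 0 + p 2 * -x 0 + s * (p 1 + p 2 * -x 1) * 1 = _
    ring
  have hΦ1 : ∀ p, Φ.map 1 p 1 = p 1 - x 1 * p 2 := fun p => by
    rw [hΦi]
    change p 1 + p 2 * -x 1 + s * (p 1 + p 2 * -x 1) * 0 = _
    ring
  have hΦ2 : ∀ p, Φ.map 1 p 2 = p 2 := fun p => by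
    rw [hΦi]
    change p 2 + p 2 * 0 + s * (p 1 + p 2 * -x 1) * 0 = _
    ring
  have hsame : ∀ p q, Φ.map 1 p 0 = Φ.map 1 q 0 → Φ.map 1 p 1 = Φ.map 1 q 1 → SameProj x p q := by
    intro p q h0 h1
    rw [hΦ0, hΦ0] at h0
    rw [hΦ1, hΦ1] at h1
    rw [h1] at h0
    exact ⟨by linarith, h1⟩
  have hadd : ∀ p q, Φ.map 1 (p + q) = Φ.map 1 p + Φ.map 1 q := by
    intro p q
    ext i; fin_cases i
    · simp [hΦ0]; ring
    · simp [hΦ1]; ring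
    · simp [hΦ2]
  have hsmul : ∀ (r : ℝ) p, Φ.map 1 (r • p) = r • Φ.map 1 p := by
    intro r p
    ext i; fin_cases i
    · simp [hΦ0]; ring
    · simp [hΦ1]; ring
    · simp [hΦ2]
  have hneg : ∀ p, Φ.map 1 (-p) = -Φ.map 1 p := fun p => by
    rw [← neg_one_smul ℝ p, hsmul, neg_one_smul]
  have hinj := (Φ.map 1).injective
  have himg : ∀ {p : Space} {V : Set Space}, LooksLike X p V → V.Finite → (∀ v ∈ V, v ≠ 0) →
      LooksLike (Φ.map 1 '' X) (Φ.map 1 p) (Φ.map 1 '' V) := fun hL hV hV0 =>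
    hL.image hV hV0 _ _ fun v _ => ⟨1, one_pos, fun r _ => by rw [hadd, hsmul]⟩
  -- No edge is orthogonal to the first axis.
  have hedge : ∀ e ∈ T, Φ.map 1 (e.2 - e.1) 0 ≠ 0 := by
    intro e he h0
    have h1 : Φ.map 1 e.1 0 = Φ.map 1 e.2 0 := by
      rw [sub_eq_add_neg, hadd, hneg] at h0
      simp only [Pi.add_apply, Pi.neg_apply] at h0
      linarith
    have h2 := hs1 e.1 (Or.inl (hTP e he).1) e.2 (Or.inl (hTP e he).2) (by rw [← hΦ0, ← hΦ0, h1])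
    rw [← hΦ1, ← hΦ1] at h2
    exact hne e he (hx1 _ (hTP e he).1 _ (hTP e he).2 (hsame _ _ h1 h2))
  have hspecial : Φ.map 1 '' P₀ ∪ {p ∈ Φ.map 1 '' X | ∃ q ∈ Φ.map 1 '' X, p ≠ q ∧ p 0 = q 0 ∧
      p 1 = q 1} ⊆ Φ.map 1 '' (P₀ ∪ D) := by
    rintro _ (⟨p, hp, rfl⟩ | ⟨⟨p, hp, rfl⟩, _, ⟨q, hq, rfl⟩, hpq, h0, h1⟩)
    · exact ⟨p, Or.inl hp, rfl⟩
    · exact ⟨p, Or.inr ⟨hp, q, hq, fun h => hpq (by rw [h]), hsame _ _ h0 h1⟩, rfl⟩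
  refine ⟨Φ, Φ.map 1 '' P₀, ?_, hΦ2⟩
  constructor
  · exact hX.image (Φ.map 1).continuous
  · exact hP₀f.image _
  · exact image_mono fun p hp => Or.inr hp
  · exact image_mono hP₀X
  · obtain ⟨M, hM⟩ := (hTf.image fun e =>
      |((Φ.map 1 (e.2 - e.1) 0)⁻¹ • Φ.map 1 (e.2 - e.1)) 1|).bddAbove
    refine ⟨M, ?_⟩
    rintro _ ⟨⟨p, hp, rfl⟩, hpP⟩
    obtain ⟨e, he, hL⟩ := hst p ⟨hp, fun h => hpP (mem_image_of_mem _ h)⟩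
    have hd : e.2 - e.1 ≠ 0 := sub_ne_zero.2 (hne e he).symm
    have h0 := hedge e he
    refine ⟨(Φ.map 1 (e.2 - e.1) 0)⁻¹ • Φ.map 1 (e.2 - e.1), ?_, hM ⟨e, he, rfl⟩, ?_⟩
    · rw [Pi.smul_apply, smul_eq_mul, inv_mul_cancel₀ h0]
    · have := himg hL (by simp) (by
        rintro v (rfl | rfl)
        exacts [hd, neg_ne_zero.2 hd])
      rw [image_pair, hneg] at this
      have hr := this.hasRay (v := Φ.map 1 (e.2 - e.1)) (by simp)
      have hr' := this.hasRay (v := -Φ.map 1 (e.2 - e.1)) (by simp)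
      have hne0 : (Φ.map 1 (e.2 - e.1) 0)⁻¹ • Φ.map 1 (e.2 - e.1) ≠ 0 := by
        intro h
        have := congrFun h 0
        rw [Pi.smul_apply, smul_eq_mul, inv_mul_cancel₀ h0] at this
        exact one_ne_zero this
      rcases lt_or_gt_of_ne h0 with hlt | hlt
      · refine this.straight hne0 ?_ ?_
        · have := hr'.smul (k := -(Φ.map 1 (e.2 - e.1) 0)⁻¹) (by
            rw [Left.neg_pos_iff]; exact inv_lt_zero.2 hlt)
          rwa [neg_smul_neg] at this
        · have := hr.smul (k := -(Φ.map 1 (e.2 - e.1) 0)⁻¹) (by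
            rw [Left.neg_pos_iff]; exact inv_lt_zero.2 hlt)
          rwa [neg_smul] at this
      · refine this.straight hne0 (hr.smul (inv_pos.2 hlt)) ?_
        have := hr'.smul (inv_pos.2 hlt)
        rwa [smul_neg] at this
  · rintro _ ⟨⟨p, hp, rfl⟩, hpS⟩
    obtain ⟨u, v, huv, hL⟩ := hreg p ⟨hP₀X hp, fun h => hpS (mem_image_of_mem _ h)⟩
    have hray0 : ∀ w : Space, w ≠ 0 → HasRay X p w → Φ.map 1 w 0 ≠ 0 := by
      intro w hw h
      obtain ⟨e, he, k, hk, rfl⟩ := exists_parallel_of_hasRay hP₀f hst hw h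
      rw [hsmul, Pi.smul_apply, smul_eq_mul]
      exact mul_ne_zero hk (hedge e he)
    have hu := hL.hasRay (v := u) (by simp)
    have hv := hL.hasRay (v := v) (by simp)
    have hu0 := hray0 u huv.1 hu
    have hv0 := hray0 v huv.2.1 hv
    refine ⟨Φ.map 1 u, Φ.map 1 v, hu0, hv0, fun hpos hslope => ?_, ?_⟩
    -- Rays with the same projection would give infinitely many double points.
    · have hk : 0 < Φ.map 1 u 0 / Φ.map 1 v 0 := by
        rw [← mul_div_mul_right _ _ hv0]
        exact div_pos hpos (mul_self_pos.2 hv0)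
      obtain ⟨r₀, h₀, hr₀⟩ := hu
      obtain ⟨r₁, h₁, hr₁⟩ := hv.smul hk
      obtain ⟨r, hr, hrD⟩ := exists_notMem_of_finite hDf p huv.1 (lt_min h₀ h₁)
      refine hrD ⟨hr₀ r ⟨hr.1.le, hr.2.le.trans (min_le_left _ _)⟩, _,
        hr₁ r ⟨hr.1.le, hr.2.le.trans (min_le_right _ _)⟩, ?_, ?_⟩
      · intro h
        exact huv.2.2 _ hk (smul_right_injective _ hr.1.ne' (add_left_cancel h))
      · apply hsame
        · simp only [hadd, hsmul, Pi.add_apply, Pi.smul_apply, smul_eq_mul]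
          rw [div_mul_cancel₀ _ hv0]
        · simp only [hadd, hsmul, Pi.add_apply, Pi.smul_apply, smul_eq_mul]
          rw [div_eq_div_iff hu0 hv0] at hslope
          field_simp
          linear_combination r * hslope
    · have := himg hL (by simp) (by rintro w (rfl | rfl); exacts [huv.1, huv.2.1])
      rwa [image_pair] at this
  · rintro _ ⟨p, hp, rfl⟩
    refine ⟨_, hs2 p hp (Φ.map 1) (fun q hq => ?_), himg (hVL p hp) ?_ ?_⟩
    · rw [hΦ0, hΦ1, hΦ2, hq]; simp
    · obtain ⟨u, u', v, v', h, -⟩ := hVc p hp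
      rw [h]; simp
    · obtain ⟨u, u', v, v', h, -, ⟨h1, h2, h3, h4⟩, -⟩ := hVc p hp
      rw [h]
      rintro w (rfl | rfl | rfl | rfl) <;> rintro rfl <;> simp at *
  · rintro _ ⟨p, hp, rfl⟩ _ ⟨q, hq, rfl⟩ hpq h0 h1 ⟨p', hp', he⟩
    rw [hinj he] at hp'
    exact (hx2 p hp q hq (fun h => hpq (by rw [h])) (hsame _ _ h0 h1)).1 hp'
  · rintro _ ⟨p, hp, rfl⟩ _ ⟨q, hq, rfl⟩ hpq h0 h1 d d' hd hd' hLd hLd' hslope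
    have hpq' : p ≠ q := fun h => hpq (by rw [h])
    have hs := hsame _ _ h0 h1
    have hpP := (hx2 p hp q hq hpq' hs).1
    have hqP := (hx2 q hq p hp hpq'.symm ⟨hs.1.symm, hs.2.symm⟩).1
    -- The straight directions are parallel to edges through the two points.
    have hdir : ∀ p ∈ X, ∀ d : Space, d 0 = 1 → p ∉ P₀ → LooksLike (Φ.map 1 '' X) (Φ.map 1 p)
      {d, -d} →
        ∃ e ∈ T, p ∈ segment ℝ e.1 e.2 ∧ ∃ k : ℝ, Φ.map 1 (e.2 - e.1) = k • d := by
      intro p hp d hd hpP hL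
      obtain ⟨e, he, hpe⟩ := hmem hp
      refine ⟨e, he, hpe, ?_⟩
      have hray : HasRay X p (e.2 - e.1) := by
        have hsub := hsegX e he
        rw [segment_eq_image'] at hsub hpe
        obtain ⟨t, ht, rfl⟩ := hpe
        have ht1 : t < 1 := lt_of_le_of_ne ht.2 (by
          rintro rfl; exact hpP (by simpa using (hTP e he).2))
        refine ⟨1 - t, sub_pos.2 ht1, fun r hr => hsub ⟨t + r, ⟨add_nonneg ht.1 hr.1, by
          linarith [hr.2]⟩, ?_⟩⟩
        simp only [add_smul, add_assoc]
      have hray' : HasRay (Φ.map 1 '' X) (Φ.map 1 p) (Φ.map 1 (e.2 - e.1)) := by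
        obtain ⟨r₀, h₀, h⟩ := hray
        exact ⟨r₀, h₀, fun r hr => ⟨_, h r hr, by rw [hadd, hsmul]⟩⟩
      obtain ⟨v, hv, k, -, hk⟩ := hL.exists_of_hasRay hray'
      rcases hv with rfl | rfl
      · exact ⟨k, hk⟩
      · exact ⟨-k, by rw [hk, smul_neg, neg_smul]⟩
    obtain ⟨e, he, hpe, k, hk⟩ := hdir p hp d hd hpP hLd
    obtain ⟨e', he', hqe, k', hk'⟩ := hdir q hq d' hd' hqP hLd'
    refine (hx2 p hp q hq hpq' hs).2 e he e' he' hpe hqe ?_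
    have a0 := congrFun hk 0
    have a1 := congrFun hk 1
    have b0 := congrFun hk' 0
    have b1 := congrFun hk' 1
    rw [hΦ0] at a0 b0
    rw [hΦ1] at a1 b1
    rw [Pi.smul_apply, smul_eq_mul] at a0 a1 b0 b1
    rw [hd, mul_one] at a0
    rw [hd', mul_one] at b0
    rw [projCross]
    rw [← hslope] at b1
    simp only [Pi.sub_apply] at a0 a1 b0 b1 ⊢
    linear_combination (e'.2 1 - e'.1 1 - x 1 * (e'.2 2 - e'.1 2)) * a0 -
      (e.2 1 - e.1 1 - x 1 * (e.2 2 - e.1 2)) * b0 + k * b1 - k' * a1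
  · rintro _ ⟨p, hp, rfl⟩ _ ⟨q, hq, rfl⟩ _ ⟨r, hr, rfl⟩ hpq hpr hqr h0 h1 h0' h1'
    exact hx3 p hp q hq r hr (fun h => hpq (by rw [h])) (fun h => hpr (by rw [h]))
      (fun h => hqr (by rw [h])) (hsame _ _ h0 h1) (hsame _ _ h0' h1')
  · exact ((hP₀f.union hDf).image _).subset hspecial
  · intro p hp q hq h0
    obtain ⟨p', hp', rfl⟩ := hspecial hp
    obtain ⟨q', hq', rfl⟩ := hspecial hq
    rw [hΦ1, hΦ1]
    rw [hΦ0, hΦ0] at h0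
    exact hs1 p' hp' q' hq' h0

/-! ### Piecewise linear height functions on the plane -/

/-- The case of functions of one variable on the unit interval. Nothing like it holds for arbitrary
continuous functions: it is used that a piecewise linear function vanishes to the first order. -/
theorem exists_le_mul_of_pl {h D : ℝ → ℝ} (hh : PL h) (hD : PL D) (h0 : ∀ t, 0 ≤ D t)
    (hz : ∀ t, D t = 0 → h t ≤ 0) : ∃ M, 0 ≤ M ∧ ∀ t ∈ Icc (0 : ℝ) 1, h t ≤ M * D t := by
  have hpt : ∀ t, ∃ M, 0 ≤ M ∧ h t ≤ M * D t := by
    intro t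
    rcases (h0 t).eq_or_lt with hd | hd
    · exact ⟨0, le_rfl, by rw [zero_mul]; exact hz t hd.symm⟩
    · refine ⟨|h t / D t|, abs_nonneg _, ?_⟩
      rw [← div_le_iff₀ hd]; exact le_abs_self _
  -- On a segment where both functions are affine it is enough to compare them at the ends.
  have hside : ∀ t v : ℝ, ∃ M, 0 ≤ M ∧ ∃ r₀ > 0, ∀ r ∈ Icc (0 : ℝ) r₀,
      h (t + r * v) ≤ M * D (t + r * v) := by
    intro t v
    obtain ⟨w, r₁, hr₁, hw⟩ := hh.exists_direction t v
    obtain ⟨w', r₂, hr₂, hw'⟩ := hD.exists_direction t v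
    have hm : 0 < min r₁ r₂ := lt_min hr₁ hr₂
    obtain ⟨M₀, hM₀, h1⟩ := hpt t
    obtain ⟨M₁, hM₁, h2⟩ := hpt (t + min r₁ r₂ * v)
    have e1 : h t ≤ max M₀ M₁ * D t :=
      h1.trans (mul_le_mul_of_nonneg_right (le_max_left _ _) (h0 _))
    have e2 : h (t + min r₁ r₂ * v) ≤ max M₀ M₁ * D (t + min r₁ r₂ * v) :=
      h2.trans (mul_le_mul_of_nonneg_right (le_max_right _ _) (h0 _))
    refine ⟨max M₀ M₁, hM₀.trans (le_max_left _ _), min r₁ r₂, hm, fun r hr => ?_⟩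
    simp only [smul_eq_mul] at hw hw'
    rw [hw _ ⟨hm.le, min_le_left _ _⟩, hw' _ ⟨hm.le, min_le_right _ _⟩] at e2
    rw [hw r ⟨hr.1, hr.2.trans (min_le_left _ _)⟩, hw' r ⟨hr.1, hr.2.trans (min_le_right _ _)⟩]
    generalize max M₀ M₁ = M at *
    generalize min r₁ r₂ = m at *
    have h3 : 0 ≤ 1 - r / m := by rw [sub_nonneg, div_le_one hm]; exact hr.2
    have h4 : 0 ≤ r / m := div_nonneg hr.1 hm.le
    have h5 : r = r / m * m := by field_simp
    have := add_le_add (mul_le_mul_of_nonneg_left e1 h3) (mul_le_mul_of_nonneg_left e2 h4)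
    generalize r / m = k at *
    rw [h5]
    linarith
  refine isCompact_Icc.induction_on (p := fun s : Set ℝ => ∃ M, 0 ≤ M ∧ ∀ t ∈ s, h t ≤ M * D t)
    ⟨0, le_rfl, by simp⟩ ?_ ?_ ?_
  · rintro s t hst ⟨M, hM, h⟩
    exact ⟨M, hM, fun x hx => h x (hst hx)⟩
  · rintro s t ⟨M, hM, h1⟩ ⟨M', hM', h2⟩
    refine ⟨max M M', hM.trans (le_max_left _ _), ?_⟩
    rintro x (hx | hx)
    · exact (h1 x hx).trans (mul_le_mul_of_nonneg_right (le_max_left _ _) (h0 _))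
    · exact (h2 x hx).trans (mul_le_mul_of_nonneg_right (le_max_right _ _) (h0 _))
  · intro t _
    obtain ⟨M, hM, r, hr, h1⟩ := hside t 1
    obtain ⟨M', hM', r', hr', h2⟩ := hside t (-1)
    refine ⟨Ioo (t - r') (t + r), mem_nhdsWithin_of_mem_nhds (Ioo_mem_nhds (by linarith)
      (by linarith)), max M M', hM.trans (le_max_left _ _), fun s hs => ?_⟩
    rcases le_total t s with hts | hts
    · have := h1 (s - t) ⟨sub_nonneg.2 hts, by linarith [hs.2]⟩
      rw [mul_one, add_sub_cancel] at this
      exact this.trans (mul_le_mul_of_nonneg_right (le_max_left _ _) (h0 _))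
    · have := h2 (t - s) ⟨sub_nonneg.2 hts, by linarith [hs.1]⟩
      rw [show t + (t - s) * -1 = s by ring] at this
      exact this.trans (mul_le_mul_of_nonneg_right (le_max_right _ _) (h0 _))

/-- If a nonnegative piecewise linear function `D` on a segment vanishes only where `h ≤ 0`, then
a multiple of `D` dominates `h`. -/
theorem exists_le_mul_on_segment {h D : ℝ × ℝ → ℝ} (hh : PL h) (hD : PL D) (h0 : ∀ q, 0 ≤ D q)
    {a b : ℝ × ℝ} (hz : ∀ q ∈ segment ℝ a b, D q = 0 → h q ≤ 0) :
    ∃ M, 0 ≤ M ∧ ∀ q ∈ segment ℝ a b, h q ≤ M * D q := by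
  have hγ : PL fun t : ℝ => a + max 0 (min t 1) • (b - a) :=
    (PL.const a).add (((PL.const 0).sup (PL.id.inf (PL.const 1))).smul_const _)
  have hseg : ∀ t : ℝ, a + max 0 (min t 1) • (b - a) ∈ segment ℝ a b := by
    intro t
    rw [segment_eq_image']
    exact ⟨_, ⟨le_max_left _ _, max_le zero_le_one (min_le_right _ _)⟩, rfl⟩
  obtain ⟨M, hM, h1⟩ := exists_le_mul_of_pl (hh.comp hγ) (hD.comp hγ) (fun t => h0 _)
    (fun t => hz _ (hseg t))
  refine ⟨M, hM, fun q hq => ?_⟩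
  rw [segment_eq_image'] at hq
  obtain ⟨t, ht, rfl⟩ := hq
  have := h1 t ht
  rwa [min_eq_left ht.2, max_eq_right ht.1] at this

/-- The projection of space to the horizontal plane. -/
def proj (p : Space) : ℝ × ℝ := (p 0, p 1)

theorem proj_mem_segment {p a b : Space} (h : p ∈ segment ℝ a b) :
    proj p ∈ segment ℝ (proj a) (proj b) := by
  obtain ⟨s, t, hs, ht, hst, rfl⟩ := h
  exact ⟨s, t, hs, ht, hst, rfl⟩

theorem exists_of_mem_segment_proj {q : ℝ × ℝ} {a b : Space}
    (h : q ∈ segment ℝ (proj a) (proj b)) : ∃ p ∈ segment ℝ a b, proj p = q := by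
  obtain ⟨s, t, hs, ht, hst, rfl⟩ := h
  exact ⟨_, ⟨s, t, hs, ht, hst, rfl⟩, rfl⟩

/-- A finite graph made of segments that projects injectively to the plane lies on the graph of a
piecewise linear function: the lower envelope of steep functions, one for each segment. -/
theorem exists_height {T : Set (Space × Space)} (hT : T.Finite) (hT0 : ∀ e ∈ T, e.1 0 ≠ e.2 0)
    (hinj : InjOn proj (⋃ e ∈ T, segment ℝ e.1 e.2)) :
    ∃ F : ℝ × ℝ → ℝ, PL F ∧ ∀ p ∈ ⋃ e ∈ T, segment ℝ e.1 e.2, F (proj p) = p 2 := by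
  have hsub : ∀ e ∈ T, segment ℝ e.1 e.2 ⊆ ⋃ e ∈ T, segment ℝ e.1 e.2 := fun e he =>
    subset_biUnion_of_mem (u := fun e : Space × Space => segment ℝ e.1 e.2) he
  -- For each segment, a piecewise linear function that is exact on it and dominates elsewhere.
  have hE : ∀ e ∈ T, ∃ E : ℝ × ℝ → ℝ, PL E ∧ (∀ p ∈ segment ℝ e.1 e.2, E (proj p) = p 2) ∧
      ∀ p ∈ ⋃ e ∈ T, segment ℝ e.1 e.2, p 2 ≤ E (proj p) := by
    intro e he
    have hne := sub_ne_zero.2 (hT0 e he).symm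
    set t : ℝ × ℝ → ℝ := fun q => (e.2 0 - e.1 0)⁻¹ * (q.1 - e.1 0) with ht
    have hx : PL fun q : ℝ × ℝ => q.1 := PL.of_linear (LinearMap.fst ℝ ℝ ℝ)
    have hy : PL fun q : ℝ × ℝ => q.2 := PL.of_linear (LinearMap.snd ℝ ℝ ℝ)
    have htPL : PL t := (hx.sub (PL.const _)).const_mul _
    set L : ℝ × ℝ → ℝ := fun q => e.1 2 + (e.2 2 - e.1 2) * t q with hL
    have hLPL : PL L := (PL.const _).add (htPL.const_mul _)
    -- `L` is the height of the line of the segment, and `D` is a distance from the projection of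
    -- the segment.
    set D : ℝ × ℝ → ℝ := fun q =>
      max |q.2 - (e.1 1 + (e.2 1 - e.1 1) * t q)| (max (-t q) (t q - 1)) with hD
    have hDPL : PL D := ((hy.sub ((PL.const _).add (htPL.const_mul _))).abs).sup
      (htPL.neg.sup (htPL.sub (PL.const 1)))
    have hD0 : ∀ q, 0 ≤ D q := fun q => (abs_nonneg _).trans (le_max_left _ _)
    have hpt : ∀ p ∈ segment ℝ e.1 e.2, D (proj p) = 0 ∧ L (proj p) = p 2 := by
      intro p hp
      rw [segment_eq_image'] at hp
      obtain ⟨r, hr, rfl⟩ := hp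
      have htr : t (proj (e.1 + r • (e.2 - e.1))) = r := by
        simp only [ht, proj, Pi.add_apply, Pi.smul_apply, Pi.sub_apply, smul_eq_mul]
        field_simp; ring
      constructor
      · simp only [hD, htr]
        rw [show (proj (e.1 + r • (e.2 - e.1))).2 - (e.1 1 + (e.2 1 - e.1 1) * r) = 0 by
          simp only [proj, Pi.add_apply, Pi.smul_apply, Pi.sub_apply, smul_eq_mul]; ring, abs_zero]
        exact max_eq_left (max_le (by linarith [hr.1]) (by linarith [hr.2]))
      · simp only [hL, htr, Pi.add_apply, Pi.smul_apply, Pi.sub_apply, smul_eq_mul]; ring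
    have hzero : ∀ q, D q = 0 → ∃ p ∈ segment ℝ e.1 e.2, proj p = q := by
      intro q hq
      have h1 : |q.2 - (e.1 1 + (e.2 1 - e.1 1) * t q)| ≤ 0 := hq ▸ le_max_left _ _
      have h2 : -t q ≤ 0 := hq ▸ (le_max_left _ _).trans (le_max_right _ _)
      have h3 : t q - 1 ≤ 0 := hq ▸ (le_max_right _ _).trans (le_max_right _ _)
      refine ⟨e.1 + t q • (e.2 - e.1), ?_, ?_⟩
      · rw [segment_eq_image']
        exact ⟨t q, ⟨by linarith, by linarith⟩, rfl⟩
      · have h4 := abs_nonpos_iff.1 h1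
        ext
        · simp only [proj, ht, Pi.add_apply, Pi.smul_apply, Pi.sub_apply, smul_eq_mul]
          field_simp; ring
        · simp only [proj, Pi.add_apply, Pi.smul_apply, Pi.sub_apply, smul_eq_mul]
          linarith
    -- Another segment over the projection of `e` is at the height of `e` by injectivity, so that a
    -- multiple of `D` dominates the difference of heights.
    have hM : ∀ e' ∈ T, ∃ M, 0 ≤ M ∧ ∀ p ∈ segment ℝ e'.1 e'.2,
        p 2 - L (proj p) ≤ M * D (proj p) := by
      intro e' he'
      have hne' := sub_ne_zero.2 (hT0 e' he').symm
      set L' : ℝ × ℝ → ℝ := fun q =>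
        e'.1 2 + (e'.2 2 - e'.1 2) * ((e'.2 0 - e'.1 0)⁻¹ * (q.1 - e'.1 0)) with hL'
      have hL'p : ∀ p ∈ segment ℝ e'.1 e'.2, L' (proj p) = p 2 := by
        intro p hp
        rw [segment_eq_image'] at hp
        obtain ⟨r, hr, rfl⟩ := hp
        simp only [hL', proj, Pi.add_apply, Pi.smul_apply, Pi.sub_apply, smul_eq_mul]
        field_simp; ring
      have hL'PL : PL L' :=
        (PL.const _).add (((hx.sub (PL.const _)).const_mul _).const_mul _)
      obtain ⟨M, hM, h⟩ := exists_le_mul_on_segment (a := proj e'.1) (b := proj e'.2)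
        (hL'PL.sub hLPL) hDPL hD0 (by
        intro q hq hq0
        obtain ⟨p, hp, rfl⟩ := exists_of_mem_segment_proj hq
        obtain ⟨p', hp', hpp⟩ := hzero _ hq0
        have := hinj (hsub e he hp') (hsub e' he' hp) hpp
        rw [hL'p p hp, (hpt p (this ▸ hp')).2, sub_self])
      refine ⟨M, hM, fun p hp => ?_⟩
      rw [← hL'p p hp]
      exact h _ (proj_mem_segment hp)
    choose! M hM0 hM using hM
    obtain ⟨N, hN⟩ := (hT.image M).bddAbove
    refine ⟨fun q => L q + N * D q, hLPL.add (hDPL.const_mul N), fun p hp => ?_, fun p hp => ?_⟩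
    · change L (proj p) + N * D (proj p) = p 2
      rw [(hpt p hp).1, (hpt p hp).2]; ring
    · obtain ⟨e', he', hp⟩ := mem_iUnion₂.1 hp
      have h1 := hM e' he' p hp
      have h2 := mul_le_mul_of_nonneg_right (hN ⟨e', he', rfl⟩) (hD0 (proj p))
      linarith
  choose! E hE1 hE2 hE3 using hE
  -- The minimum of the dominating functions.
  have hmin : ∀ T' ⊆ T, T'.Finite → ∃ F : ℝ × ℝ → ℝ, PL F ∧
      (∀ p ∈ ⋃ e ∈ T, segment ℝ e.1 e.2, p 2 ≤ F (proj p)) ∧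
      ∀ e ∈ T', ∀ p ∈ segment ℝ e.1 e.2, F (proj p) = p 2 := by
    intro T' hTT hf
    induction T', hf using Set.Finite.induction_on with
    | empty =>
      have hc : BddAbove ((fun p : Space => p 2) '' ⋃ e ∈ T, segment ℝ e.1 e.2) := by
        refine (IsCompact.image ?_ (continuous_apply 2)).bddAbove
        exact hT.isCompact_biUnion fun e _ => by
          rw [segment_eq_image_lineMap]
          exact isCompact_Icc.image (by fun_prop)
      obtain ⟨N, hN⟩ := hc
      exact ⟨fun _ => N, PL.const N, fun p hp => hN ⟨p, hp, rfl⟩, by simp⟩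
    | @insert e T' _ _ ih =>
      obtain ⟨F, hF1, hF2, hF3⟩ := ih ((subset_insert _ _).trans hTT)
      have he := hTT (mem_insert _ _)
      refine ⟨fun q => min (F q) (E e q), hF1.inf (hE1 e he), fun p hp =>
        le_min (hF2 p hp) (hE3 e he p hp), ?_⟩
      intro e' he' p hp
      apply le_antisymm
      · rcases he' with rfl | he'
        · exact (min_le_right _ _).trans (hE2 _ he p hp).le
        · exact (min_le_left _ _).trans (hF3 _ he' p hp).le
      · have hpT := hsub e' (hTT he') hp
        exact le_min (hF2 p hpT) (hE3 e he p hpT)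
  obtain ⟨F, hF1, -, hF3⟩ := hmin T subset_rfl hT
  refine ⟨F, hF1, fun p hp => ?_⟩
  obtain ⟨e, he, hp⟩ := mem_iUnion₂.1 hp
  exact hF3 e he p hp

/-- A height function can be made constant near the projection of a point where the graph is
horizontal, without changes near finitely many other points: clamp it between two steep pyramids
with a common flat part. -/
theorem exists_height_flat {T : Set (Space × Space)} (hT : T.Finite) {F : ℝ × ℝ → ℝ} (hF : PL F)
    (hFT : ∀ p ∈ ⋃ e ∈ T, segment ℝ e.1 e.2, F (proj p) = p 2) (B : Space) {δ : ℝ} (hδ : 0 < δ)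
    (hB : ∀ p ∈ ⋃ e ∈ T, segment ℝ e.1 e.2, dist (proj p) (proj B) ≤ δ → p 2 = B 2)
    {Q : Set (ℝ × ℝ)} (hQ : Q.Finite) (hQB : ∀ q ∈ Q, δ < dist q (proj B)) :
    ∃ G : ℝ × ℝ → ℝ, PL G ∧ (∀ p ∈ ⋃ e ∈ T, segment ℝ e.1 e.2, G (proj p) = p 2) ∧
      (∀ᶠ q in 𝓝 (proj B), G q = B 2) ∧ ∀ b ∈ Q, ∀ᶠ q in 𝓝 b, G q = F q := by
  have hx : PL fun q : ℝ × ℝ => q.1 := PL.of_linear (LinearMap.fst ℝ ℝ ℝ)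
  have hy : PL fun q : ℝ × ℝ => q.2 := PL.of_linear (LinearMap.snd ℝ ℝ ℝ)
  -- The distance from the square of radius `δ` around the projection of `B`.
  set D : ℝ × ℝ → ℝ := fun q => max 0 (max |q.1 - B 0| |q.2 - B 1| - δ) with hD
  have hdist : ∀ q : ℝ × ℝ, dist q (proj B) = max |q.1 - B 0| |q.2 - B 1| := fun q => by
    rw [Prod.dist_eq, Real.dist_eq, Real.dist_eq]; rfl
  have hDPL : PL D := (PL.const 0).sup
    (((hx.sub (PL.const _)).abs.sup (hy.sub (PL.const _)).abs).sub (PL.const δ))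
  have hD0 : ∀ q, 0 ≤ D q := fun q => le_max_left _ _
  have hz : ∀ q, D q = 0 → dist q (proj B) ≤ δ := by
    intro q hq
    rw [hdist, ← sub_nonpos, ← hq]; exact le_max_right _ _
  have hM : ∀ e ∈ T, ∃ M, ∀ p ∈ segment ℝ e.1 e.2, |p 2 - B 2| ≤ M * D (proj p) := by
    intro e he
    have hsub : segment ℝ e.1 e.2 ⊆ ⋃ e ∈ T, segment ℝ e.1 e.2 :=
      subset_biUnion_of_mem (u := fun e : Space × Space => segment ℝ e.1 e.2) he
    obtain ⟨M, hM, h⟩ := exists_le_mul_on_segment (a := proj e.1) (b := proj e.2)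
      (hF.sub (PL.const (B 2))).abs hDPL hD0 (by
        intro q hq hq0
        obtain ⟨p, hp, rfl⟩ := exists_of_mem_segment_proj hq
        rw [hFT p (hsub hp), hB p (hsub hp) (hz _ hq0)]; simp)
    refine ⟨M, fun p hp => ?_⟩
    rw [← hFT p (hsub hp)]
    exact h _ (proj_mem_segment hp)
  choose! M hM using hM
  obtain ⟨N₁, hN₁⟩ := (hT.image M).bddAbove
  have hDQ : ∀ q ∈ Q, 0 < D q := by
    intro q hq
    have := hQB q hq
    rw [hdist] at this
    exact lt_max_of_lt_right (sub_pos.2 this)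
  -- A slope that makes the pyramids irrelevant near the points of `Q`.
  obtain ⟨N₂, hN₂⟩ := (hQ.image fun q => (|F q - B 2| + 1) / D q).bddAbove
  set N := max N₁ N₂ with hN
  refine ⟨fun q => max (min (F q) (B 2 + N * D q)) (B 2 - N * D q),
    (hF.inf ((PL.const _).add (hDPL.const_mul N))).sup ((PL.const _).sub (hDPL.const_mul N)),
    fun p hp => ?_, ?_, fun b hb => ?_⟩
  · have hp' := hFT p hp
    obtain ⟨e, he, hpe⟩ := mem_iUnion₂.1 hp
    have h1 := (hM e he p hpe).trans (mul_le_mul_of_nonneg_right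
      ((hN₁ ⟨e, he, rfl⟩).trans (le_max_left _ N₂)) (hD0 (proj p)))
    rw [abs_le] at h1
    rw [← hN] at h1
    simp only [hp']
    rw [min_eq_left (by linarith), max_eq_left (by linarith)]
  · filter_upwards [Metric.ball_mem_nhds (proj B) hδ] with q hq
    have : D q = 0 := by
      have := Metric.mem_ball.1 hq
      rw [hdist] at this
      exact max_eq_left (by linarith)
    simp only [this, mul_zero, add_zero, sub_zero]
    exact max_eq_right (min_le_right _ _)
  · have h1 : (|F b - B 2| + 1) / D b ≤ N := (hN₂ ⟨b, hb, rfl⟩).trans (le_max_right _ _)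
    rw [div_le_iff₀ (hDQ b hb)] at h1
    have hlt : ∀ᶠ q in 𝓝 b, |F q - B 2| < N * D q := by
      have c1 : Continuous fun q => |F q - B 2| := (hF.continuous.sub continuous_const).abs
      have c2 : Continuous fun q => N * D q := continuous_const.mul hDPL.continuous
      exact c1.continuousAt.eventually_lt c2.continuousAt (by linarith)
    filter_upwards [hlt] with q hq
    have := abs_lt.1 hq
    rw [min_eq_left (by linarith), max_eq_left (by linarith)]

/-- A height function that is constant near the projections of finitely many given points. -/
theorem exists_height_flat_of_finite {T : Set (Space × Space)} (hT : T.Finite)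
    (hT0 : ∀ e ∈ T, e.1 0 ≠ e.2 0) (hinj : InjOn proj (⋃ e ∈ T, segment ℝ e.1 e.2))
    {S : Set Space} (hS : S.Finite) (hSinj : InjOn proj S)
    (hflat : ∀ B ∈ S, ∃ δ > 0, ∀ p ∈ ⋃ e ∈ T, segment ℝ e.1 e.2,
      dist (proj p) (proj B) ≤ δ → p 2 = B 2) :
    ∃ F : ℝ × ℝ → ℝ, PL F ∧ (∀ p ∈ ⋃ e ∈ T, segment ℝ e.1 e.2, F (proj p) = p 2) ∧
      ∀ B ∈ S, ∀ᶠ q in 𝓝 (proj B), F q = B 2 := by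
  have key : ∀ S' ⊆ S, S'.Finite → ∃ F : ℝ × ℝ → ℝ, PL F ∧
      (∀ p ∈ ⋃ e ∈ T, segment ℝ e.1 e.2, F (proj p) = p 2) ∧
      ∀ B ∈ S', ∀ᶠ q in 𝓝 (proj B), F q = B 2 := by
    intro S' hS' hf
    induction S', hf using Set.Finite.induction_on with
    | empty =>
      obtain ⟨F, h1, h2⟩ := exists_height hT hT0 hinj
      exact ⟨F, h1, h2, by simp⟩
    | @insert B S' hB hf ih =>
      obtain ⟨F, h1, h2, h3⟩ := ih ((subset_insert _ _).trans hS')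
      obtain ⟨δ, hδ, hδB⟩ := hflat B (hS' (mem_insert _ _))
      have hev : ∀ᶠ r in 𝓝[>] (0 : ℝ), ∀ C ∈ S', r < dist (proj C) (proj B) := by
        refine (eventually_all_finite hf).2 fun C hC => ?_
        refine mem_nhdsWithin_of_mem_nhds (Iio_mem_nhds (dist_pos.2 fun h => hB ?_))
        rwa [← hSinj (hS' (mem_insert_of_mem _ hC)) (hS' (mem_insert _ _)) h]
      obtain ⟨r, hr, hr0⟩ := (hev.and (Ioo_mem_nhdsGT hδ)).exists
      obtain ⟨G, g1, g2, g3, g4⟩ := exists_height_flat hT h1 h2 B hr0.1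
        (fun p hp h => hδB p hp (h.trans hr0.2.le)) (hf.image proj) (by
          rintro _ ⟨C, hC, rfl⟩; exact hr C hC)
      refine ⟨G, g1, g2, ?_⟩
      rintro C (rfl | hC)
      · exact g3
      · filter_upwards [g4 _ ⟨C, hC, rfl⟩, h3 C hC] with q e1 e2
        rw [e1, e2]
  exact key S subset_rfl hS

/-! ### The local course of the spine -/

/-- The slope `l` to the left and the slope `r` to the right. -/
noncomputable def sideSlope (l r s : ℝ) : ℝ := if 0 < s then r else l

/-- The position of the ray in the direction `w` with respect to the broken line through its
origin with the slopes `l` (left) and `r` (right): it is positive above this line and negative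
below it. -/
noncomputable def sideOf (l r : ℝ) (w : Space) : ℝ := w 1 - sideSlope l r (w 0) * w 0

/-- A broken line can be put between two rays with different projections. -/
theorem exists_slopes_of_bend {u v : Space} (hu : u 0 ≠ 0) (hv : v 0 ≠ 0)
    (huv : 0 < u 0 * v 0 → u 1 / u 0 ≠ v 1 / v 0) :
    ∃ l r, sideOf l r u * sideOf l r v < 0 := by
  have key : ∀ {w : Space} {m : ℝ}, w 0 ≠ 0 → w 1 - m * w 0 = w 0 * (w 1 / w 0 - m) := by
    intro w m hw; field_simp
  rcases lt_or_gt_of_ne hu with h | h <;> rcases lt_or_gt_of_ne hv with h' | h'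
  · have hne := huv (mul_pos_of_neg_of_neg h h')
    refine ⟨(u 1 / u 0 + v 1 / v 0) / 2, 0, ?_⟩
    simp only [sideOf, sideSlope, if_neg h.not_gt, if_neg h'.not_gt]
    rw [key hu, key hv]
    have : 0 < (u 0 * v 0) * ((u 1 / u 0 - v 1 / v 0) * (u 1 / u 0 - v 1 / v 0)) :=
      mul_pos (mul_pos_of_neg_of_neg h h') (mul_self_pos.2 (sub_ne_zero.2 hne))
    linarith
  · refine ⟨u 1 / u 0 - 1, v 1 / v 0 - 1, ?_⟩
    simp only [sideOf, sideSlope, if_neg h.not_gt, if_pos h']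
    rw [key hu, key hv]
    have := mul_neg_of_neg_of_pos h h'
    linarith
  · refine ⟨v 1 / v 0 - 1, u 1 / u 0 - 1, ?_⟩
    simp only [sideOf, sideSlope, if_pos h, if_neg h'.not_gt]
    rw [key hu, key hv]
    have := mul_neg_of_pos_of_neg h h'
    linarith
  · have hne := huv (mul_pos h h')
    refine ⟨0, (u 1 / u 0 + v 1 / v 0) / 2, ?_⟩
    simp only [sideOf, sideSlope, if_pos h, if_pos h']
    rw [key hu, key hv]
    have : 0 < (u 0 * v 0) * ((u 1 / u 0 - v 1 / v 0) * (u 1 / u 0 - v 1 / v 0)) :=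
      mul_pos (mul_pos h h') (mul_self_pos.2 (sub_ne_zero.2 hne))
    linarith

/-- The four rays in `V` are horizontal and lie in the four sectors into which the broken line with
the slopes `l`, `r` and the vertical line divide the plane. -/
def InSectors (l r : ℝ) (V : Set Space) : Prop :=
  ∃ u u' v v' : Space, V = {u, u', v, v'} ∧ (u 2 = 0 ∧ u' 2 = 0 ∧ v 2 = 0 ∧ v' 2 = 0) ∧
    (0 < u 0 ∧ 0 < u' 0 ∧ v 0 < 0 ∧ v' 0 < 0) ∧
    sideOf l r u < 0 ∧ 0 < sideOf l r u' ∧ sideOf l r v < 0 ∧ 0 < sideOf l r v'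

/-- The bisecting slopes on both sides separate the rays of a flat cross. -/
theorem FlatCross.exists_slopes {V : Set Space} (h : FlatCross V) :
    ∃ l r, InSectors l r V := by
  obtain ⟨u, u', v, v', hV, hz, ⟨pu, pu', pv, pv'⟩, h1, h2⟩ := h
  have key : ∀ {w : Space} {m : ℝ}, w 0 ≠ 0 → w 1 - m * w 0 = w 0 * (w 1 / w 0 - m) := by
    intro w m hw; field_simp
  refine ⟨(v 1 / v 0 + v' 1 / v' 0) / 2,
    (u 1 / u 0 + u' 1 / u' 0) / 2, u, u', v', v, ?_, ?_, ?_, ?_, ?_, ?_, ?_⟩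
  · rw [hV, pair_comm v]
  · exact ⟨hz.1, hz.2.1, hz.2.2.2, hz.2.2.1⟩
  · exact ⟨pu, pu', pv', pv⟩
  · simp only [sideOf, sideSlope, if_pos pu]
    rw [key pu.ne']
    exact mul_neg_of_pos_of_neg pu (by linarith)
  · simp only [sideOf, sideSlope, if_pos pu']
    rw [key pu'.ne']
    exact mul_pos pu' (by linarith)
  · simp only [sideOf, sideSlope, if_neg pv'.not_gt]
    rw [key pv'.ne]
    exact mul_neg_of_neg_of_pos pv' (by linarith)
  · simp only [sideOf, sideSlope, if_neg pv.not_gt]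
    rw [key pv.ne]
    exact mul_pos_of_neg_of_neg pv (by linarith)

theorem InSectors.sideOf_ne {l r : ℝ} {V : Set Space} (h : InSectors l r V) :
    ∀ w ∈ V, sideOf l r w ≠ 0 := by
  obtain ⟨u, u', v, v', rfl, -, -, h1, h2, h3, h4⟩ := h
  rintro w (rfl | rfl | rfl | rfl)
  exacts [h1.ne, h2.ne', h3.ne, h4.ne']

/-- A broken line through a point that avoids the rays of `X` at the points above it meets `X` only
there, or in the set `O` that contains the remaining rays. The set `O` serves for the strand that
the broken line follows at a crossing. -/
theorem eventually_tube {X : Set Space} (hX : IsCompact X) (c y l r : ℝ) (O : Space → Prop)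
    (hloc : ∀ p ∈ X, p 0 = c → p 1 = y → ∃ V, LooksLike X p V ∧
      ((∀ v ∈ V, sideOf l r v ≠ 0) ∨ ∀ v ∈ V, ∀ s : ℝ, 0 ≤ s → O (p + s • v))) :
    ∀ᶠ ε in 𝓝[>] (0 : ℝ), ∀ q ∈ X, |q 0 - c| ≤ ε → q 1 = y + sideSlope l r (q 0 - c) * (q 0 - c) →
      q 0 = c ∨ O q := by
  -- A suitable neighbourhood of each point of `X` above the point `(c, y)`.
  have hN : ∀ p, ∃ N : Set Space, (p ∈ X → proj p = (c, y) → N ∈ 𝓝 p) ∧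
      (p ∈ X → proj p = (c, y) → ∀ q ∈ N, q ∈ X →
        q 1 = y + sideSlope l r (q 0 - c) * (q 0 - c) → q 0 = c ∨ O q) := by
    intro p
    by_cases h : p ∈ X ∧ proj p = (c, y)
    · obtain ⟨hp, he⟩ := h
      have h0 : p 0 = c := congrArg Prod.fst he
      have h1 : p 1 = y := congrArg Prod.snd he
      obtain ⟨V, hV, hor⟩ := hloc p hp h0 h1
      refine ⟨_, fun _ _ => hV, fun _ _ q hq hqX hq1 => ?_⟩
      obtain ⟨v, hv, s, hs, rfl⟩ := hq.1 hqX
      rcases hor with hor | hor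
      · left
        rcases hs.eq_or_lt with rfl | hs
        · simpa using h0
        · exfalso
          apply hor v hv
          simp only [Pi.add_apply, Pi.smul_apply, smul_eq_mul, h0, h1, add_sub_cancel_left] at hq1
          have e : sideSlope l r (s * v 0) = sideSlope l r (v 0) := by
            simp only [sideSlope, mul_pos_iff_of_pos_left hs]
          rw [e] at hq1
          have : s * (v 1 - sideSlope l r (v 0) * v 0) = 0 := by linarith
          exact (mul_eq_zero.1 this).resolve_left hs.ne'
      · exact Or.inr (hor v hv s hs)
    · exact ⟨univ, fun hp he => absurd ⟨hp, he⟩ h, fun hp he => absurd ⟨hp, he⟩ h⟩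
  choose N hN1 hN2 using hN
  have hproj : Continuous proj := (continuous_apply 0).prodMk (continuous_apply 1)
  obtain ⟨δ, hδ, htube⟩ := exists_tube hX hproj (c, y) N hN1
  set K := 1 + |l| + |r| with hK
  have hKpos : 0 < K := by positivity
  filter_upwards [Ioo_mem_nhdsGT (div_pos hδ hKpos)] with ε hε q hq hqc hq1
  have hslope : |sideSlope l r (q 0 - c)| ≤ K := by
    rw [sideSlope]; split_ifs
    · linarith [abs_nonneg l]
    · linarith [abs_nonneg r]
  have hlt : ε * K < δ := (lt_div_iff₀ hKpos).1 hε.2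
  obtain ⟨p, hp, he, hqN⟩ := htube q hq (by
    rw [Prod.dist_eq, Real.dist_eq, Real.dist_eq]
    apply max_lt
    · have : 1 ≤ K := by rw [hK]; linarith [abs_nonneg l, abs_nonneg r]
      have := mul_le_mul_of_nonneg_left this hε.1.le
      exact lt_of_le_of_lt hqc (by linarith)
    · change |q 1 - y| < δ
      rw [hq1, add_sub_cancel_left, abs_mul]
      have := mul_le_mul hslope hqc (abs_nonneg _) hKpos.le
      linarith)
  exact hN2 p hp he q hqN hq hq1

/-- A straight point has straight neighbours. -/
theorem LooksLike.eventually_straight {X : Set Space} {p d : Space} (h : LooksLike X p {d, -d}) :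
    ∀ᶠ q in 𝓝 p, q ∈ X → LooksLike X q {d, -d} := by
  have hline : ∀ a q : Space, (∃ v ∈ ({d, -d} : Set Space), ∃ r : ℝ, 0 ≤ r ∧ q = a + r • v) ↔
      ∃ s : ℝ, q = a + s • d := by
    intro a q
    constructor
    · rintro ⟨v, rfl | rfl, r, -, rfl⟩
      · exact ⟨r, rfl⟩
      · exact ⟨-r, by rw [smul_neg, neg_smul]⟩
    · rintro ⟨s, rfl⟩
      rcases le_total 0 s with hs | hs
      · exact ⟨d, by simp, s, hs, rfl⟩
      · exact ⟨-d, by simp, -s, neg_nonneg.2 hs, by rw [smul_neg, neg_smul, neg_neg]⟩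
  have h' : ∀ᶠ q in 𝓝 p, q ∈ X ↔ ∃ s : ℝ, q = p + s • d := by
    filter_upwards [h] with q hq
    rw [hq, hline]
  filter_upwards [h', eventually_eventually_nhds.2 h'] with q hq hq' hqX
  obtain ⟨s, rfl⟩ := hq.1 hqX
  filter_upwards [hq'] with q hq
  rw [hq, hline]
  constructor
  · rintro ⟨t, rfl⟩; exact ⟨t - s, by rw [sub_smul]; abel⟩
  · rintro ⟨t, rfl⟩; exact ⟨s + t, by rw [add_smul]; abel⟩

/-! ### Spines -/

/-- The points of `X` that share their projection with another point of `X`. -/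
def doublePoints (X : Set Space) : Set Space := {p ∈ X | ∃ q ∈ X, p ≠ q ∧ p 0 = q 0 ∧ p 1 = q 1}

/-- The local data for a spine, that is, for the graph of a piecewise linear function that will be
moved to the axis. The finite set `C` consists of the abscissas of special points; near each
`c ∈ C` the spine is the broken line through `(c, y c)` with the slopes `l c` and `r c`. It passes
through each point of `P` so that it separates the arcs there, and at each crossing (with abscissa
in `D`) it follows the upper strand, which issues from the point `o c` in the directions
`± d c`, and is transverse to the lower strand, which issues from `u c` in the directions
`± d' c`. -/
structure Spine (X S P : Set Space) where
  C : Set ℝ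
  D : Set ℝ
  y : ℝ → ℝ
  l : ℝ → ℝ
  r : ℝ → ℝ
  o : ℝ → Space
  u : ℝ → Space
  d : ℝ → Space
  d' : ℝ → Space
  ε : ℝ
  finite : C.Finite
  D_subset : D ⊆ C
  eps_pos : 0 < ε
  sep : ∀ c ∈ C, ∀ c' ∈ C, c ≠ c' → 4 * ε < |c - c'|
  P_mem : ∀ p ∈ P, p 0 ∈ C \ D ∧ p 1 = y (p 0)
  double_mem : ∀ p ∈ doublePoints X, p 0 ∈ D ∧ p 1 = y (p 0)
  tube : ∀ c ∈ C, ∀ q ∈ X, |q 0 - c| ≤ ε → q 1 = y c + sideSlope (l c) (r c) (q 0 - c) * (q 0 - c) →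
    q 0 = c ∨ c ∈ D ∧ q = o c + (q 0 - c) • d c
  vertex : ∀ c ∈ C \ D, ∃ p ∈ P, p 0 = c ∧ (∀ q ∈ X, q 0 = c → q 1 = y c → q = p) ∧
    (p ∈ S → ∃ V, InSectors (l c) (r c) V ∧ LooksLike X p V) ∧
    (p ∉ S → ∃ u v : Space, u 0 ≠ 0 ∧ v 0 ≠ 0 ∧ sideOf (l c) (r c) u * sideOf (l c) (r c) v < 0 ∧
      LooksLike X p {u, v})
  cross : ∀ c ∈ D, (o c 0 = c ∧ o c 1 = y c) ∧ (u c ∈ X ∧ u c 0 = c ∧ u c 1 = y c) ∧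
    u c 2 < o c 2 ∧ (d c 0 = 1 ∧ d c 1 = l c ∧ d c 1 = r c) ∧ (d' c 0 = 1 ∧ d' c 1 ≠ l c) ∧
    LooksLike X (u c) {d' c, -d' c} ∧ (∀ q ∈ X, q 0 = c → q 1 = y c → q = o c ∨ q = u c) ∧
    ∀ τ, |τ| ≤ ε → o c + τ • d c ∈ X ∧ LooksLike X (o c + τ • d c) {d c, -d c}

theorem sideSlope_self (l s : ℝ) : sideSlope l l s = l := by simp [sideSlope]

/-- The local data at a crossing: the direction `d` of the upper strand, which the spine follows,
and the direction `d'` of the lower strand. -/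
theorem IsGeneric.exists_crossing {X S P : Set Space} (h : IsGeneric X S P) {o u : Space}
    (ho : o ∈ X) (hu : u ∈ X) (h0 : u 0 = o 0) (h1 : u 1 = o 1) (h2 : u 2 < o 2) :
    ∃ d d' : Space, (d 0 = 1 ∧ d' 0 = 1 ∧ d' 1 ≠ d 1) ∧ LooksLike X u {d', -d'} ∧
      (∀ q ∈ X, q 0 = o 0 → q 1 = o 1 → q = o ∨ q = u) ∧
      ∀ᶠ ε in 𝓝[>] (0 : ℝ), (∀ τ, |τ| ≤ ε → o + τ • d ∈ X ∧ LooksLike X (o + τ • d) {d, -d}) ∧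
        ∀ q ∈ X, |q 0 - o 0| ≤ ε →
          q 1 = o 1 + sideSlope (d 1) (d 1) (q 0 - o 0) * (q 0 - o 0) →
          q 0 = o 0 ∨ q = o + (q 0 - o 0) • d := by
  have hne : o ≠ u := by rintro rfl; exact h2.false
  have hoP := h.double_notMem o ho u hu hne h0.symm h1.symm
  have huP := h.double_notMem u hu o ho hne.symm h0 h1
  obtain ⟨M, hM⟩ := h.straight
  obtain ⟨d, hd0, -, hd⟩ := hM o ⟨ho, hoP⟩
  obtain ⟨d', hd'0, -, hd'⟩ := hM u ⟨hu, huP⟩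
  have hslope := h.double_transverse o ho u hu hne h0.symm h1.symm d d' hd0 hd'0 hd hd'
  have huniq : ∀ q ∈ X, q 0 = o 0 → q 1 = o 1 → q = o ∨ q = u := by
    intro q hq hq0 hq1
    by_contra! hc
    exact h.no_triple o ho u hu q hq hne (Ne.symm hc.1) (Ne.symm hc.2) h0.symm h1.symm
      hq0.symm hq1.symm
  refine ⟨d, d', ⟨hd0, hd'0, hslope.symm⟩, hd', huniq, ?_⟩
  have htube := eventually_tube h.compact (o 0) (o 1) (d 1) (d 1) (fun q => q = o + (q 0 - o 0) • d)
    (by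
      intro p hp hp0 hp1
      rcases huniq p hp hp0 hp1 with rfl | rfl
      · refine ⟨_, hd, Or.inr ?_⟩
        rintro v (rfl | rfl) s -
        · simp [hd0]
        · simp [hd0]
      · refine ⟨_, hd', Or.inl ?_⟩
        rintro v (rfl | rfl)
        · simp only [sideOf, sideSlope_self, hd'0]
          intro h; apply hslope; linarith
        · simp only [sideOf, sideSlope_self, Pi.neg_apply, hd'0]
          intro h; apply hslope; linarith)
  have hstr : ∀ᶠ τ in 𝓝 (0 : ℝ), o + τ • d ∈ X ∧ LooksLike X (o + τ • d) {d, -d} := by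
    filter_upwards [(tendsto_add_smul o d).eventually hd,
      (tendsto_add_smul o d).eventually hd.eventually_straight] with τ h1 h2
    have : o + τ • d ∈ X := by
      rw [h1]
      rcases le_total 0 τ with hτ | hτ
      · exact ⟨d, by simp, τ, hτ, rfl⟩
      · exact ⟨-d, by simp, -τ, neg_nonneg.2 hτ, by rw [smul_neg, neg_smul, neg_neg]⟩
    exact ⟨this, h2 this⟩
  obtain ⟨δ, hδ, hball⟩ := Metric.eventually_nhds_iff.1 hstr
  filter_upwards [htube, Ioo_mem_nhdsGT hδ] with ε h1 h2
  refine ⟨fun τ hτ => hball ?_, h1⟩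
  rw [dist_zero_right, Real.norm_eq_abs]
  exact hτ.trans_lt h2.2

/-- The local data at a point of `P`: slopes of a broken line that separates the arcs there. -/
theorem IsGeneric.exists_vertex {X S P : Set Space} (h : IsGeneric X S P) {p : Space}
    (hp : p ∈ P) (huniq : ∀ q ∈ X, q 0 = p 0 → q 1 = p 1 → q = p) :
    ∃ l r, (p ∈ S → ∃ V, InSectors l r V ∧ LooksLike X p V) ∧
      (p ∉ S → ∃ u v : Space, u 0 ≠ 0 ∧ v 0 ≠ 0 ∧ sideOf l r u * sideOf l r v < 0 ∧
        LooksLike X p {u, v}) ∧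
      ∀ᶠ ε in 𝓝[>] (0 : ℝ), ∀ q ∈ X, |q 0 - p 0| ≤ ε →
          q 1 = p 1 + sideSlope l r (q 0 - p 0) * (q 0 - p 0) → q 0 = p 0 := by
  by_cases hpS : p ∈ S
  · obtain ⟨V, hV, hL⟩ := h.cross p hpS
    obtain ⟨l, r, hlr⟩ := hV.exists_slopes
    refine ⟨l, r, fun _ => ⟨V, hlr, hL⟩, fun hn => absurd hpS hn, ?_⟩
    have := eventually_tube h.compact (p 0) (p 1) l r (fun _ => False) (by
      intro q hq h0 h1
      obtain rfl := huniq q hq h0 h1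
      exact ⟨V, hL, Or.inl hlr.sideOf_ne⟩)
    simpa using this
  · obtain ⟨u, v, hu, hv, huv, hL⟩ := h.bend p ⟨hp, hpS⟩
    obtain ⟨l, r, hlr⟩ := exists_slopes_of_bend hu hv huv
    refine ⟨l, r, fun hn => absurd hn hpS, fun _ => ⟨u, v, hu, hv, hlr, hL⟩, ?_⟩
    have := eventually_tube h.compact (p 0) (p 1) l r (fun _ => False) (by
      intro q hq h0 h1
      obtain rfl := huniq q hq h0 h1
      refine ⟨_, hL, Or.inl ?_⟩
      rintro w (rfl | rfl) hw <;> rw [hw] at hlr <;> simp at hlr)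
    simpa using this

theorem IsGeneric.exists_spine {X S P : Set Space} (h : IsGeneric X S P) :
    Nonempty (Spine X S P) := by
  -- The special abscissas are those of the points of `P` and of the double points; by general
  -- position, all special points with the same abscissa have the same projection.
  set C : Set ℝ := (fun p : Space => p 0) '' (P ∪ doublePoints X) with hC
  set D : Set ℝ := (fun p : Space => p 0) '' doublePoints X with hD
  have hCf : C.Finite := h.finite_special.image _
  have hDC : D ⊆ C := image_mono subset_union_right
  have hsep : ∀ p ∈ P ∪ doublePoints X, ∀ q ∈ P ∪ doublePoints X, p 0 = q 0 → p 1 = q 1 :=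
    h.separated
  have hy : ∀ c, ∃ y, ∀ p ∈ P ∪ doublePoints X, p 0 = c → p 1 = y := by
    intro c
    by_cases hc : c ∈ C
    · obtain ⟨q, hq, rfl⟩ := hc
      exact ⟨q 1, fun p hp h0 => hsep p hp q hq h0⟩
    · exact ⟨0, fun p hp h0 => absurd ⟨p, hp, h0⟩ hc⟩
  choose y hy using hy
  have hcr : ∀ c ∈ D, ∃ o u : Space, o ∈ X ∧ u ∈ X ∧ o 0 = c ∧ o 1 = y c ∧ u 0 = o 0 ∧ u 1 = o 1 ∧
      u 2 < o 2 := by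
    rintro c ⟨p, hp, rfl⟩
    have hp' := hp
    obtain ⟨hpX, q, hqX, hpq, h0, h1⟩ := hp'
    have hq : q ∈ doublePoints X := ⟨hqX, p, hpX, hpq.symm, h0.symm, h1.symm⟩
    have h2 : p 2 ≠ q 2 := fun h2 => hpq (by ext i; fin_cases i <;> assumption)
    rcases lt_or_gt_of_ne h2 with h2 | h2
    · exact ⟨q, p, hqX, hpX, h0.symm, hy _ q (Or.inr hq) h0.symm, h0, h1, h2⟩
    · exact ⟨p, q, hpX, hqX, rfl, hy _ p (Or.inr hp) rfl, h0.symm, h1.symm, h2⟩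
  choose! o u ho hu ho0 ho1 hu0 hu1 hu2 using hcr
  have hcr2 := fun c (hc : c ∈ D) => h.exists_crossing (ho c hc) (hu c hc) (hu0 c hc) (hu1 c hc)
    (hu2 c hc)
  choose! d d' hdd hLu huniq hev using hcr2
  have hvx : ∀ c ∈ C \ D, ∃ p ∈ P, p 0 = c ∧ p 1 = y c ∧
      ∀ q ∈ X, q 0 = p 0 → q 1 = p 1 → q = p := by
    rintro c ⟨⟨p, hp, rfl⟩, hcD⟩
    have hpP : p ∈ P := hp.resolve_right fun h => hcD ⟨p, h, rfl⟩
    refine ⟨p, hpP, rfl, hy _ p hp rfl, fun q hq h0 h1 => ?_⟩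
    by_contra hne
    exact hcD ⟨p, ⟨h.subset hpP, q, hq, Ne.symm hne, h0.symm, h1.symm⟩, rfl⟩
  choose! v hvP hv0 hv1 hvu using hvx
  have hvx2 := fun c (hc : c ∈ C \ D) => h.exists_vertex (hvP c hc) (hvu c hc)
  choose! l r hS hnS hev' using hvx2
  classical
  -- All finitely many conditions on `ε` hold if it is small.
  have hall : ∀ᶠ ε in 𝓝[>] (0 : ℝ), (∀ c ∈ D, (∀ τ, |τ| ≤ ε → o c + τ • d c ∈ X ∧
      LooksLike X (o c + τ • d c) {d c, -d c}) ∧ ∀ q ∈ X, |q 0 - o c 0| ≤ ε →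
        q 1 = o c 1 + sideSlope (d c 1) (d c 1) (q 0 - o c 0) * (q 0 - o c 0) →
          q 0 = o c 0 ∨ q = o c + (q 0 - o c 0) • d c) ∧
      (∀ c ∈ C \ D, ∀ q ∈ X, |q 0 - v c 0| ≤ ε →
        q 1 = v c 1 + sideSlope (l c) (r c) (q 0 - v c 0) * (q 0 - v c 0) → q 0 = v c 0) ∧
      (∀ c ∈ C, ∀ c' ∈ C, c ≠ c' → 4 * ε < |c - c'|) ∧ 0 < ε := by
    refine ((eventually_all_finite (hCf.subset hDC)).2 hev).and
      (((eventually_all_finite hCf.sdiff).2 hev').and (.and ?_ self_mem_nhdsWithin))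
    refine (eventually_all_finite hCf).2 fun c _ => (eventually_all_finite hCf).2 fun c' _ => ?_
    by_cases hcc : c = c'
    · exact Eventually.of_forall fun _ h => absurd hcc h
    · have h0 : 0 < |c - c'| / 4 := div_pos (abs_pos.2 (sub_ne_zero.2 hcc)) four_pos
      filter_upwards [Ioo_mem_nhdsGT h0] with ε hε _
      linarith [hε.2]
  obtain ⟨ε, hε1, hε2, hε3, hε0⟩ := hall.exists
  refine ⟨{
    C := C, D := D, y := y, o := o, u := u, d := d, d' := d', ε := ε
    l := fun c => if c ∈ D then d c 1 else l c
    r := fun c => if c ∈ D then d c 1 else r c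
    finite := hCf, D_subset := hDC, eps_pos := hε0, sep := hε3
    P_mem := ?_, double_mem := ?_, tube := ?_, vertex := ?_, cross := ?_ }⟩
  · intro p hp
    refine ⟨⟨⟨p, Or.inl hp, rfl⟩, ?_⟩, hy _ p (Or.inl hp) rfl⟩
    rintro ⟨q, hq, h0 : q 0 = p 0⟩
    have h1 := hsep q (Or.inr hq) p (Or.inl hp) h0
    obtain ⟨hqX, q', hqX', hqq, h0', h1'⟩ := hq
    by_cases hqp : p = q
    · subst hqp
      exact h.double_notMem p hqX q' hqX' hqq h0' h1' hp
    · exact h.double_notMem p (h.subset hp) q hqX hqp h0.symm h1.symm hp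
  · intro p hp
    exact ⟨⟨p, hp, rfl⟩, hy _ p (Or.inr hp) rfl⟩
  · intro c hc q hq hqc hq1
    by_cases hcD : c ∈ D
    · simp only [if_pos hcD] at hq1
      have := (hε1 c hcD).2 q hq
      rw [ho0 c hcD, ho1 c hcD] at this
      exact (this hqc hq1).imp_right fun h => ⟨hcD, h⟩
    · simp only [if_neg hcD] at hq1
      have := hε2 c ⟨hc, hcD⟩ q hq
      rw [hv0 c ⟨hc, hcD⟩, hv1 c ⟨hc, hcD⟩] at this
      exact Or.inl (this hqc hq1)
  · intro c hc
    have h0 := hv0 c hc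
    have h1 := hv1 c hc
    have h2 := hvu c hc
    rw [h0, h1] at h2
    have hS' := hS c hc
    have hnS' := hnS c hc
    simp only [if_neg hc.2]
    exact ⟨v c, hvP c hc, h0, h2, hS', hnS'⟩
  · intro c hc
    simp only [if_pos hc]
    have h0 := ho0 c hc
    have h1 := ho1 c hc
    have huq := huniq c hc
    rw [h0, h1] at huq
    obtain ⟨e1, e2, e3⟩ := hdd c hc
    exact ⟨⟨h0, h1⟩, ⟨hu c hc, (hu0 c hc).trans h0, (hu1 c hc).trans h1⟩, hu2 c hc,
      ⟨e1, trivial, trivial⟩, ⟨e2, e3⟩, hLu c hc, huq, (hε1 c hc).1⟩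

/-! ### Functions with a prescribed course near special points -/

/-- The minimum of finitely many piecewise linear functions no two of which are at most `Y` at the
same point. Below the level `Y` it coincides with one of them. -/
theorem exists_min_family {C : Set ℝ} (hC : C.Finite) {G : ℝ → ℝ → ℝ} (hG : ∀ c, PL (G c)) {Y : ℝ}
    (hY : ∀ c ∈ C, ∀ c' ∈ C, c ≠ c' → ∀ x, Y < G c x ∨ Y < G c' x) :
    ∃ g : ℝ → ℝ, PL g ∧ (∀ c ∈ C, ∀ x, G c x ≤ Y → g =ᶠ[𝓝 x] G c) ∧
      ∀ x, g x ≤ Y → ∃ c ∈ C, G c x ≤ Y := by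
  induction C, hC using Set.Finite.induction_on with
  | empty => exact ⟨fun _ => Y + 1, PL.const _, by simp, fun x hx => by linarith⟩
  | @insert e C he hC ih =>
    obtain ⟨g, h1, h2, h3⟩ := ih fun c hc c' hc' =>
      hY c (mem_insert_of_mem _ hc) c' (mem_insert_of_mem _ hc')
    refine ⟨fun x => min (g x) (G e x), h1.inf (hG e), ?_, fun x hx => ?_⟩
    · rintro c (rfl | hc) x hx
      · have hgx : Y < g x := by
          by_contra! hle
          obtain ⟨c', hc', h⟩ := h3 x hle
          rcases hY c (mem_insert _ _) c' (mem_insert_of_mem _ hc')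
            (by rintro rfl; exact he hc') x with h' | h' <;> linarith
        filter_upwards [(hG c).continuous.continuousAt.eventually_lt h1.continuous.continuousAt
          (hx.trans_lt hgx)] with z hz
        exact min_eq_right hz.le
      · have hex : Y < G e x := by
          rcases hY e (mem_insert _ _) c (mem_insert_of_mem _ hc)
            (by rintro rfl; exact he hc) x with h' | h'
          · exact h'
          · linarith
        filter_upwards [h2 c hc x hx, (hG c).continuous.continuousAt.eventually_lt
          (hG e).continuous.continuousAt (hx.trans_lt hex)] with z hz hz'
        rw [hz]
        exact min_eq_left hz'.le
    · rcases min_le_iff.1 hx with h | h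
      · obtain ⟨c, hc, hcx⟩ := h3 x h
        exact ⟨c, mem_insert_of_mem _ hc, hcx⟩
      · exact ⟨e, mem_insert _ _, h⟩

/-- A broken line through the point `(c, y)` that has the slopes `l` and `r` up to the distance `ε`
from this point and goes up with the slope `N` on both sides farther away. -/
noncomputable def wedge (c y l r ε N x : ℝ) : ℝ :=
  y + r * min (max (x - c) 0) ε - l * min (max (c - x) 0) ε + N * max (|x - c| - ε) 0

theorem pl_wedge (c y l r ε N : ℝ) : PL (wedge c y l r ε N) := by
  have h1 : PL fun x : ℝ => x - c := PL.id.sub (PL.const c)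
  have h2 : PL fun x : ℝ => c - x := (PL.const c).sub PL.id
  exact (((PL.const y).add (((h1.sup (PL.const 0)).inf (PL.const ε)).const_mul r)).sub
    (((h2.sup (PL.const 0)).inf (PL.const ε)).const_mul l)).add
    (((h1.abs.sub (PL.const ε)).sup (PL.const 0)).const_mul N)

theorem wedge_of_abs_le {c y l r ε N x : ℝ} (h : |x - c| ≤ ε) :
    wedge c y l r ε N x = y + sideSlope l r (x - c) * (x - c) := by
  have h' := abs_le.1 h
  rw [wedge, max_eq_right (sub_nonpos.2 h)]
  rcases lt_or_ge c x with hx | hx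
  · rw [max_eq_left (by linarith), min_eq_left (by linarith), max_eq_right (by linarith),
      min_eq_left (by linarith), sideSlope, if_pos (by linarith)]
    ring
  · rw [max_eq_right (by linarith), min_eq_left (by linarith), max_eq_left (by linarith),
      min_eq_left (by linarith), sideSlope, if_neg (by linarith)]
    ring

theorem wedge_right {c y l r ε N t : ℝ} (hε : 0 < ε) (ht : 0 ≤ t) :
    wedge c y l r ε N (c + ε + t) = y + r * ε + N * t := by
  rw [wedge, abs_of_nonneg (by linarith), max_eq_left (by linarith), min_eq_right (by linarith),
    max_eq_right (by linarith), min_eq_left hε.le, max_eq_left (by linarith)]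
  ring

theorem wedge_left {c y l r ε N t : ℝ} (hε : 0 < ε) (ht : 0 ≤ t) :
    wedge c y l r ε N (c - ε - t) = y - l * ε + N * t := by
  rw [wedge, abs_of_nonpos (by linarith), max_eq_right (by linarith), min_eq_left hε.le,
    max_eq_left (by linarith), min_eq_right (by linarith), max_eq_left (by linarith)]
  ring

/-- The spine as the graph of a function `g` that has the prescribed course near the abscissas in
`C` and rises with a slope `N` exceeding `M` next to these pieces. It leaves the range of `X` before
it meets the next special abscissa, so that `X` is met, away from the prescribed pieces, only where
the slope is `± N`. -/
theorem Spine.exists_function {X S P : Set Space} (s : Spine X S P) (hX : IsCompact X) (M : ℝ) :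
    ∃ g : ℝ → ℝ, PL g ∧
      (∀ c ∈ s.C, ∀ x, |x - c| ≤ s.ε →
        g x = s.y c + sideSlope (s.l c) (s.r c) (x - c) * (x - c)) ∧
      ∃ N > M, (∀ p ∈ X, p 1 = g (p 0) → (∃ c ∈ s.C, |p 0 - c| ≤ s.ε) ∨
        (∀ c ∈ s.C, p 0 ≠ c) ∧ ∃ σ : ℝ, |σ| = N ∧ ∀ᶠ x in 𝓝 (p 0), g x = g (p 0) + σ * (x - p 0)) ∧
      ∀ c ∈ s.C, ∀ᶠ t in 𝓝 (0 : ℝ), 0 ≤ t → g (c + s.ε + t) = g (c + s.ε) + N * t ∧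
        g (c - s.ε - t) = g (c - s.ε) + N * t := by
  have hε := s.eps_pos
  obtain ⟨Y₀, hY₀⟩ := (hX.image (continuous_apply 1)).bddAbove
  obtain ⟨K, hK⟩ := (s.finite.image fun c => |s.l c| + |s.r c|).bddAbove
  obtain ⟨Z, hZ⟩ := (s.finite.image fun c => |s.y c|).bddAbove
  have hev : ∀ᶠ η in 𝓝[>] (0 : ℝ), ∀ c ∈ s.C, ∀ c' ∈ s.C, c ≠ c' → 2 * s.ε + 2 * η < |c - c'| := by
    refine (eventually_all_finite s.finite).2 fun c hc =>
      (eventually_all_finite s.finite).2 fun c' hc' => ?_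
    by_cases hcc : c = c'
    · exact Eventually.of_forall fun _ h => absurd hcc h
    · have h0 : 0 < |c - c'| / 2 - s.ε := by linarith [s.sep c hc c' hc' hcc]
      filter_upwards [Ioo_mem_nhdsGT h0] with η hη _
      linarith [hη.2]
  -- The wedges leave the range of `X` within the distance `η` from the prescribed pieces.
  obtain ⟨η, hη, hη0⟩ := (hev.and self_mem_nhdsWithin).exists
  have hη0 : 0 < η := hη0
  -- The level `Y` exceeds the ordinates of `X` and those of the prescribed pieces. The slope `N` is
  -- large enough for the wedges to rise above `Y` within the distance `η`.
  set Y := max Y₀ (Z + K * s.ε) with hY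
  set N := max (M + 1) (max 0 ((Y + Z + K * s.ε + 1) / η)) with hN
  have hN0 : 0 ≤ N := (le_max_left _ _).trans (le_max_right _ _)
  have hNη : Y + Z + K * s.ε + 1 ≤ N * η := by
    rw [← div_le_iff₀ hη0]; exact (le_max_right _ _).trans (le_max_right _ _)
  set G : ℝ → ℝ → ℝ := fun c => wedge c (s.y c) (s.l c) (s.r c) s.ε N with hG
  have hKc : ∀ c ∈ s.C, |s.l c| ≤ K ∧ |s.r c| ≤ K := by
    intro c hc
    have : |s.l c| + |s.r c| ≤ K := hK ⟨c, hc, rfl⟩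
    exact ⟨by linarith [abs_nonneg (s.r c)], by linarith [abs_nonneg (s.l c)]⟩
  have hZc : ∀ c ∈ s.C, |s.y c| ≤ Z := fun c hc => hZ ⟨c, hc, rfl⟩
  have hsmall : ∀ c ∈ s.C, ∀ x, |x - c| ≤ s.ε → G c x ≤ Y := by
    intro c hc x hx
    rw [hG]; simp only
    rw [wedge_of_abs_le hx]
    have h1 : |sideSlope (s.l c) (s.r c) (x - c)| ≤ K := by
      rw [sideSlope]; split_ifs
      exacts [(hKc c hc).2, (hKc c hc).1]
    have h2 := mul_le_mul h1 hx (abs_nonneg _) ((abs_nonneg _).trans h1)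
    rw [← abs_mul] at h2
    have h3 := (abs_le.1 (hZc c hc)).2
    exact le_trans (by linarith [le_abs_self (sideSlope (s.l c) (s.r c) (x - c) * (x - c))])
      (le_max_right _ _)
  have hlarge : ∀ c ∈ s.C, ∀ x, s.ε + η ≤ |x - c| → Y < G c x := by
    intro c hc x hx
    have hz := (abs_le.1 (hZc c hc)).1
    obtain ⟨h1, h2⟩ := hKc c hc
    have h1' := mul_le_mul_of_nonneg_right (abs_le.1 h1).2 hε.le
    have h2' := mul_le_mul_of_nonneg_right (abs_le.1 h2).1 hε.le
    rcases le_total c x with hcx | hcx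
    · rw [abs_of_nonneg (sub_nonneg.2 hcx)] at hx
      have e : x = c + s.ε + (x - c - s.ε) := by ring
      rw [e, hG]; simp only
      rw [wedge_right hε (by linarith)]
      have := mul_le_mul_of_nonneg_left (show η ≤ x - c - s.ε by linarith) hN0
      linarith
    · rw [abs_of_nonpos (sub_nonpos.2 hcx)] at hx
      have e : x = c - s.ε - (c - x - s.ε) := by ring
      rw [e, hG]; simp only
      rw [wedge_left hε (by linarith)]
      have := mul_le_mul_of_nonneg_left (show η ≤ c - x - s.ε by linarith) hN0
      linarith
  obtain ⟨g, hg, hg1, hg2⟩ := exists_min_family (G := G) (Y := Y) s.finite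
    (fun c => pl_wedge _ _ _ _ _ _) (by
      intro c hc c' hc' hne x
      by_contra! hcon
      have h1 : |x - c| < s.ε + η := by
        by_contra! h; exact (hlarge c hc x h).not_ge hcon.1
      have h2 : |x - c'| < s.ε + η := by
        by_contra! h; exact (hlarge c' hc' x h).not_ge hcon.2
      have h3 := hη c hc c' hc' hne
      have h4 := abs_sub_le c x c'
      rw [abs_sub_comm c x] at h4
      linarith)
  refine ⟨g, hg, fun c hc x hx => ?_, N, (lt_add_one M).trans_le (le_max_left _ _), ?_, ?_⟩
  · rw [(hg1 c hc x (hsmall c hc x hx)).eq_of_nhds, hG]; simp only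
    exact wedge_of_abs_le hx
  · intro p hp hpg
    have hpY : g (p 0) ≤ Y := by
      rw [← hpg]; exact (hY₀ ⟨p, hp, rfl⟩).trans (le_max_left _ _)
    obtain ⟨c, hc, hcY⟩ := hg2 _ hpY
    have hgc := hg1 c hc _ hcY
    by_cases hpc : |p 0 - c| ≤ s.ε
    · exact Or.inl ⟨c, hc, hpc⟩
    · right
      rw [not_le] at hpc
      refine ⟨?_, ?_⟩
      · intro c' hc' h
        have hcc : c' ≠ c := by rintro rfl; rw [h, sub_self, abs_zero] at hpc; linarith
        have h2 : |p 0 - c| < s.ε + η := by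
          by_contra! h; exact (hlarge c hc _ h).not_ge hcY
        have h3 := hη c' hc' c hc hcc
        rw [h] at h2
        linarith
      · rcases lt_abs.1 hpc with h | h
        · refine ⟨N, abs_of_nonneg hN0, ?_⟩
          have hin : ∀ᶠ x in 𝓝 (p 0), c + s.ε < x := lt_mem_nhds (by linarith)
          filter_upwards [hgc, hin] with x hx hcx
          have e : x = c + s.ε + (x - c - s.ε) := by ring
          have e' : p 0 = c + s.ε + (p 0 - c - s.ε) := by ring
          rw [hx, hgc.eq_of_nhds]
          nth_rw 1 [e, e']
          rw [hG]; simp only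
          rw [wedge_right hε (by linarith), wedge_right hε (by linarith)]
          ring
        · refine ⟨-N, by rw [abs_neg, abs_of_nonneg hN0], ?_⟩
          have hin : ∀ᶠ x in 𝓝 (p 0), x < c - s.ε := gt_mem_nhds (by linarith)
          filter_upwards [hgc, hin] with x hx hcx
          have e : x = c - s.ε - (c - x - s.ε) := by ring
          have e' : p 0 = c - s.ε - (c - p 0 - s.ε) := by ring
          rw [hx, hgc.eq_of_nhds]
          nth_rw 1 [e, e']
          rw [hG]; simp only
          rw [wedge_left hε (by linarith), wedge_left hε (by linarith)]
          ring
  · intro c hc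
    have hR := hg1 c hc (c + s.ε) (hsmall c hc _ (by simp [abs_of_pos hε]))
    have hL := hg1 c hc (c - s.ε) (hsmall c hc _ (by simp [abs_of_pos hε]))
    have tR : Tendsto (fun t : ℝ => c + s.ε + t) (𝓝 0) (𝓝 (c + s.ε)) := by
      have : Continuous fun t : ℝ => c + s.ε + t := by fun_prop
      simpa using this.tendsto 0
    have tL : Tendsto (fun t : ℝ => c - s.ε - t) (𝓝 0) (𝓝 (c - s.ε)) := by
      have : Continuous fun t : ℝ => c - s.ε - t := by fun_prop
      simpa using this.tendsto 0
    filter_upwards [tR.eventually hR, tL.eventually hL] with t h1 h2 ht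
    have e1 := wedge_right (c := c) (y := s.y c) (l := s.l c) (r := s.r c) (N := N) hε le_rfl
    have e2 := wedge_left (c := c) (y := s.y c) (l := s.l c) (r := s.r c) (N := N) hε le_rfl
    rw [add_zero] at e1
    rw [sub_zero] at e2
    rw [h1, h2, hR.eq_of_nhds, hL.eq_of_nhds]
    simp only [hG]
    rw [wedge_right hε ht, wedge_left hε ht, e1, e2]
    constructor <;> ring

/-! ### Bridges -/

/-- All rays of a set in general position are transverse to the planes orthogonal to the first axis.
-/
theorem IsGeneric.exists_rays {X S P : Set Space} (h : IsGeneric X S P) {p : Space} (hp : p ∈ X) :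
    ∃ V : Set Space, V.Finite ∧ (∀ v ∈ V, v 0 ≠ 0) ∧ LooksLike X p V := by
  by_cases hpP : p ∈ P
  · by_cases hpS : p ∈ S
    · obtain ⟨V, ⟨u, u', v, v', rfl, -, ⟨h1, h2, h3, h4⟩, -⟩, hL⟩ := h.cross p hpS
      refine ⟨_, by simp, ?_, hL⟩
      rintro w (rfl | rfl | rfl | rfl)
      exacts [h1.ne', h2.ne', h3.ne, h4.ne]
    · obtain ⟨u, v, hu, hv, -, hL⟩ := h.bend p ⟨hpP, hpS⟩
      refine ⟨_, by simp, ?_, hL⟩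
      rintro w (rfl | rfl)
      exacts [hu, hv]
  · obtain ⟨M, hM⟩ := h.straight
    obtain ⟨d, hd, -, hL⟩ := hM p ⟨hp, hpP⟩
    refine ⟨_, by simp, ?_, hL⟩
    rintro w (rfl | rfl)
    · rw [hd]; exact one_ne_zero
    · rw [Pi.neg_apply, hd]; exact neg_ne_zero.2 one_ne_zero

namespace Spine

variable {X S P : Set Space} (s : Spine X S P)

/-- The point of the upper strand over the abscissa `c + τ`, where `c` is the abscissa of a
crossing. -/
noncomputable def upper (c τ : ℝ) : Space := s.o c + τ • s.d c

/-- The bridge at the crossing `c`: a short open part of the upper strand. -/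
def bridge (c : ℝ) : Set Space := {q | ∃ τ, |τ| < s.ε ∧ q = s.upper c τ}

/-- The part of `X` without the bridges. -/
def ground : Set Space := X \ ⋃ c ∈ s.D, s.bridge c

/-- The broken line with the same projection and the same ends as the bridge, which is lowered to
the under-crossing point. -/
noncomputable def sunk (c τ : ℝ) : Space :=
  s.u c + (|τ| / s.ε) • (s.o c - s.u c) + τ • s.d c

theorem upper_zero {c : ℝ} (hc : c ∈ s.D) (τ : ℝ) : s.upper c τ 0 = c + τ := by
  obtain ⟨⟨h0, h1⟩, -, -, ⟨e0, e1, -⟩, -⟩ := s.cross c hc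
  simp [upper, h0, e0]

theorem upper_one {c : ℝ} (hc : c ∈ s.D) (τ : ℝ) : s.upper c τ 1 = s.y c + τ * s.l c := by
  obtain ⟨⟨h0, h1⟩, -, -, ⟨e0, e1, -⟩, -⟩ := s.cross c hc
  simp [upper, h1, e1]

theorem proj_sunk {c : ℝ} (hc : c ∈ s.D) (τ : ℝ) : proj (s.sunk c τ) = proj (s.upper c τ) := by
  obtain ⟨⟨h0, h1⟩, ⟨-, h0', h1'⟩, -⟩ := s.cross c hc
  ext
  · simp [proj, sunk, upper, h0, h0']
  · simp [proj, sunk, upper, h1, h1']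

theorem sunk_zero {c : ℝ} (hc : c ∈ s.D) (τ : ℝ) : s.sunk c τ 0 = c + τ := by
  rw [← s.upper_zero hc]; exact congrArg Prod.fst (s.proj_sunk hc τ)

theorem sunk_one {c : ℝ} (hc : c ∈ s.D) (τ : ℝ) : s.sunk c τ 1 = s.y c + τ * s.l c := by
  rw [← s.upper_one hc]; exact congrArg Prod.snd (s.proj_sunk hc τ)

theorem sunk_self {c : ℝ} : s.sunk c 0 = s.u c := by simp [sunk]

theorem sunk_of_abs_eq {c τ : ℝ} (h : |τ| = s.ε) : s.sunk c τ = s.upper c τ := by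
  rw [sunk, h, div_self s.eps_pos.ne', one_smul, add_sub_cancel, upper]

theorem upper_mem {c τ : ℝ} (hc : c ∈ s.D) (hτ : |τ| ≤ s.ε) : s.upper c τ ∈ X :=
  ((s.cross c hc).2.2.2.2.2.2.2 τ hτ).1

theorem upper_straight {c τ : ℝ} (hc : c ∈ s.D) (hτ : |τ| ≤ s.ε) :
    LooksLike X (s.upper c τ) {s.d c, -s.d c} :=
  ((s.cross c hc).2.2.2.2.2.2.2 τ hτ).2

theorem eq_of_near {c c' x : ℝ} (hc : c ∈ s.C) (hc' : c' ∈ s.C) (h : |x - c| ≤ s.ε)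
    (h' : |x - c'| ≤ s.ε) : c = c' := by
  by_contra hne
  have h1 := s.sep c hc c' hc' hne
  have h2 := abs_sub_le c x c'
  rw [abs_sub_comm c x] at h2
  linarith [s.eps_pos]

theorem upper_mem_ground_iff {c τ : ℝ} (hc : c ∈ s.D) (hτ : |τ| ≤ s.ε) :
    s.upper c τ ∈ s.ground ↔ |τ| = s.ε := by
  constructor
  · intro h
    by_contra hne
    exact h.2 (mem_biUnion hc ⟨τ, lt_of_le_of_ne hτ hne, rfl⟩)
  · refine fun h => ⟨s.upper_mem hc hτ, fun hb => ?_⟩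
    obtain ⟨c', hc', τ', hτ', he⟩ := mem_iUnion₂.1 hb
    have h0 := congrFun he 0
    rw [s.upper_zero hc, s.upper_zero hc'] at h0
    obtain rfl : c = c' := s.eq_of_near (x := c + τ) (s.D_subset hc) (s.D_subset hc')
      (by rwa [add_sub_cancel_left]) (by rw [h0, add_sub_cancel_left]; exact hτ'.le)
    rw [add_left_cancel h0] at h
    exact hτ'.ne h

/-- Near a point outside the closed bridges nothing is removed. -/
theorem ground_eventually_eq {p : Space}
    (hp : ∀ c ∈ s.D, ∀ τ, |τ| ≤ s.ε → p ≠ s.upper c τ) : ∀ᶠ q in 𝓝 p, q ∈ s.ground ↔ q ∈ X := by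
  have hK : IsClosed (⋃ c ∈ s.D, s.upper c '' Icc (-s.ε) s.ε) := by
    refine (s.finite.subset s.D_subset).isClosed_biUnion fun c _ => ?_
    refine (isCompact_Icc.image ?_).isClosed
    unfold upper; fun_prop
  have hpK : p ∉ ⋃ c ∈ s.D, s.upper c '' Icc (-s.ε) s.ε := by
    intro h
    obtain ⟨c, hc, τ, hτ, he⟩ := mem_iUnion₂.1 h
    exact hp c hc τ (abs_le.2 hτ) he.symm
  filter_upwards [hK.isOpen_compl.mem_nhds hpK] with q hq
  refine ⟨fun h => h.1, fun h => ⟨h, fun hb => hq ?_⟩⟩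
  obtain ⟨c, hc, τ, hτ, rfl⟩ := mem_iUnion₂.1 hb
  exact mem_biUnion hc ⟨τ, abs_le.1 hτ.le, rfl⟩

theorem bridge_eventually {p : Space} (hp : p ∈ X) {c : ℝ} (hc : c ∈ s.D) (hpb : p ∈ s.bridge c) :
    ∀ᶠ q in 𝓝 p, q ∈ X → q ∈ s.bridge c := by
  obtain ⟨τ, hτ, rfl⟩ := hpb
  have h1 : ∀ᶠ q : Space in 𝓝 (s.upper c τ), |q 0 - c| < s.ε := by
    have : Continuous fun q : Space => |q 0 - c| := by fun_prop
    refine this.continuousAt.eventually_lt continuousAt_const ?_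
    rwa [s.upper_zero hc, add_sub_cancel_left]
  filter_upwards [h1, s.upper_straight hc hτ.le] with q hq hL hqX
  obtain ⟨d0, -⟩ := (s.cross c hc).2.2.2.1
  have : ∃ t : ℝ, q = s.upper c t := by
    obtain ⟨v, rfl | rfl, r, -, rfl⟩ := hL.1 hqX
    · exact ⟨τ + r, by simp only [upper, add_smul, add_assoc]⟩
    · exact ⟨τ - r, by simp only [upper, sub_smul, smul_neg]; abel⟩
  obtain ⟨t, rfl⟩ := this
  rw [s.upper_zero hc, add_sub_cancel_left] at hq
  exact ⟨t, hq, rfl⟩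

theorem isCompact_ground (hX : IsCompact X) : IsCompact s.ground := by
  refine hX.of_isClosed_subset ?_ sdiff_subset
  rw [← isOpen_compl_iff, isOpen_iff_mem_nhds]
  intro p hp
  by_cases hpX : p ∈ X
  · obtain ⟨c, hc, hb⟩ := mem_iUnion₂.1 (not_not.1 fun h => hp ⟨hpX, h⟩)
    filter_upwards [s.bridge_eventually hpX hc hb] with q hq hqg
    exact hqg.2 (mem_biUnion hc (hq hqg.1))
  · filter_upwards [hX.isClosed.isOpen_compl.mem_nhds hpX] with q hq hqg
    exact hq hqg.1

/-- At an end of a bridge one arc remains. -/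
theorem ground_looksLike_end {c σ : ℝ} (hc : c ∈ s.D) (hσ : |σ| = 1) :
    LooksLike s.ground (s.upper c (σ * s.ε)) {σ • s.d c} := by
  have hε := s.eps_pos
  have habs : |σ * s.ε| = s.ε := by rw [abs_mul, hσ, one_mul, abs_of_pos hε]
  have hσ2 : σ * σ = 1 := by rw [← abs_mul_abs_self, hσ, one_mul]
  obtain ⟨d0, -⟩ := (s.cross c hc).2.2.2.1
  have h1 : ∀ᶠ q : Space in 𝓝 (s.upper c (σ * s.ε)), 0 < σ * (q 0 - c) := by
    have : Continuous fun q : Space => σ * (q 0 - c) := by fun_prop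
    refine continuousAt_const.eventually_lt this.continuousAt ?_
    rw [s.upper_zero hc, add_sub_cancel_left, ← mul_assoc, hσ2, one_mul]; exact hε
  have h2 : ∀ᶠ q : Space in 𝓝 (s.upper c (σ * s.ε)), |q 0 - (c + σ * s.ε)| < s.ε := by
    have : Continuous fun q : Space => |q 0 - (c + σ * s.ε)| := by fun_prop
    refine this.continuousAt.eventually_lt continuousAt_const ?_
    rw [s.upper_zero hc, sub_self, abs_zero]; exact hε
  filter_upwards [h1, h2, s.upper_straight hc habs.le] with q hq hq2 hL
  constructor
  · intro hqg
    have hline : ∃ t : ℝ, q = s.upper c t := by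
      obtain ⟨v, rfl | rfl, r, -, rfl⟩ := hL.1 hqg.1
      · exact ⟨σ * s.ε + r, by simp only [upper, add_smul, add_assoc]⟩
      · exact ⟨σ * s.ε - r, by simp only [upper, sub_smul, smul_neg]; abel⟩
    obtain ⟨t, rfl⟩ := hline
    have hge : s.ε ≤ |t| := by
      by_contra! h
      exact hqg.2 (mem_biUnion hc ⟨t, h, rfl⟩)
    rw [s.upper_zero hc, add_sub_cancel_left] at hq
    have ht : |t| = σ * t := by
      rw [← abs_of_pos hq, abs_mul, hσ, one_mul]
    refine ⟨_, rfl, σ * t - s.ε, by linarith, ?_⟩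
    simp only [upper, smul_smul, add_assoc, ← add_smul]
    rw [show σ * s.ε + (σ * t - s.ε) * σ = t by linear_combination t * hσ2]
  · rintro ⟨v, rfl, r, hr, rfl⟩
    have e : s.upper c (σ * s.ε) + r • σ • s.d c = s.upper c (σ * (s.ε + r)) := by
      simp only [upper, smul_smul, add_assoc, ← add_smul]
      rw [show σ * s.ε + r * σ = σ * (s.ε + r) by ring]
    rw [e] at hq hq2 ⊢
    have hX : s.upper c (σ * (s.ε + r)) ∈ X := by
      rw [← e, hL]
      rcases abs_eq (zero_le_one' ℝ) |>.1 hσ with rfl | rfl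
      · exact ⟨_, Or.inl rfl, r, hr, by simp⟩
      · exact ⟨_, Or.inr rfl, r, hr, by simp⟩
    refine ⟨hX, fun hb => ?_⟩
    obtain ⟨c', hc', τ, hτ, he⟩ := mem_iUnion₂.1 hb
    have h0 := congrFun he 0
    rw [s.upper_zero hc, s.upper_zero hc'] at h0
    rw [s.upper_zero hc] at hq2
    -- Other bridges are far away.
    by_cases hcc : c = c'
    · subst hcc
      have := add_left_cancel h0
      rw [← this, abs_mul, hσ, one_mul, abs_of_nonneg (by linarith)] at hτ
      linarith
    · have h3 := s.sep c (s.D_subset hc) c' (s.D_subset hc') hcc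
      have h4 := abs_sub_le c (c' + τ) c'
      have h5 := abs_sub_le c (c + σ * s.ε) (c' + τ)
      rw [h0, abs_sub_comm] at hq2
      rw [sub_add_cancel_left, abs_neg, habs] at h5
      rw [add_sub_cancel_left] at h4
      linarith

/-- The ground is locally a finite union of rays, so that it is a finite union of segments. -/
theorem exists_rays_ground (h : IsGeneric X S P) {p : Space} (hp : p ∈ s.ground) :
    ∃ V : Set Space, V.Finite ∧ (∀ v ∈ V, v 0 ≠ 0) ∧ LooksLike s.ground p V := by
  by_cases hb : ∀ c ∈ s.D, ∀ τ, |τ| ≤ s.ε → p ≠ s.upper c τ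
  · obtain ⟨V, h1, h2, h3⟩ := h.exists_rays hp.1
    refine ⟨V, h1, h2, ?_⟩
    filter_upwards [h3, s.ground_eventually_eq hb] with q e1 e2
    rw [e2, e1]
  · push Not at hb
    obtain ⟨c, hc, τ, hτ, rfl⟩ := hb
    have hτ' := (s.upper_mem_ground_iff hc hτ).1 hp
    obtain ⟨d0, -⟩ := (s.cross c hc).2.2.2.1
    have hσ : |τ / s.ε| = 1 := by
      rw [abs_div, hτ', abs_of_pos s.eps_pos, div_self s.eps_pos.ne']
    have := s.ground_looksLike_end hc hσ
    rw [div_mul_cancel₀ _ s.eps_pos.ne'] at this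
    refine ⟨_, finite_singleton _, ?_, this⟩
    rintro v rfl
    rw [Pi.smul_apply, d0, smul_eq_mul, mul_one]
    intro h0
    rw [h0, abs_zero] at hσ
    exact zero_ne_one hσ

/-- The lowered bridge is the union of two segments that issue from the under-crossing point. -/
theorem mem_segment_sunk {c σ : ℝ} (hσ : |σ| = 1) {q : Space} :
    q ∈ segment ℝ (s.u c) (s.upper c (σ * s.ε)) ↔ ∃ t ∈ Icc (0 : ℝ) s.ε, q = s.sunk c (σ * t) := by
  have hε := s.eps_pos
  have key : ∀ t : ℝ, 0 ≤ t → s.u c + t • (s.upper c (σ * s.ε) - s.u c) =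
      s.sunk c (σ * (t * s.ε)) := by
    intro t ht
    rw [sunk, upper, abs_mul, hσ, one_mul, abs_of_nonneg (mul_nonneg ht hε.le),
      mul_div_cancel_right₀ _ hε.ne']
    module
  rw [segment_eq_image']
  constructor
  · rintro ⟨t, ht, rfl⟩
    exact ⟨t * s.ε, ⟨mul_nonneg ht.1 hε.le, by
      simpa using mul_le_mul_of_nonneg_right ht.2 hε.le⟩, key t ht.1⟩
  · rintro ⟨t, ht, rfl⟩
    refine ⟨t / s.ε, ⟨div_nonneg ht.1 hε.le, (div_le_one hε).2 ht.2⟩, ?_⟩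
    simp only
    rw [key _ (div_nonneg ht.1 hε.le), div_mul_cancel₀ _ hε.ne']

/-- No two points of the ground have the same projection. -/
theorem proj_injOn_ground : InjOn proj s.ground := by
  intro p hp q hq he
  by_contra hne
  have h0 : p 0 = q 0 := congrArg Prod.fst he
  have h1 : p 1 = q 1 := congrArg Prod.snd he
  obtain ⟨hc, hy⟩ := s.double_mem p ⟨hp.1, q, hq.1, hne, h0, h1⟩
  have huniq := (s.cross _ hc).2.2.2.2.2.2.1
  have ho : s.o (p 0) ∉ s.ground := fun h => h.2
    (mem_biUnion hc ⟨0, by rw [abs_zero]; exact s.eps_pos, by simp [upper]⟩)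
  rcases huniq p hp.1 rfl hy with hp' | hp'
  · rw [hp'] at hp; exact ho hp
  · rcases huniq q hq.1 h0.symm (h1 ▸ hy) with hq' | hq'
    · rw [hq'] at hq; exact ho hq
    · exact hne (hp'.trans hq'.symm)

/-- The lowered bridge shares its projection with the ground only at points of the ground. -/
theorem eq_sunk_of_proj {c τ : ℝ} (hc : c ∈ s.D) (hτ : |τ| ≤ s.ε) {p : Space} (hp : p ∈ s.ground)
    (he : proj p = proj (s.sunk c τ)) : p = s.sunk c τ := by
  have h0 : p 0 = c + τ := (congrArg Prod.fst he).trans (s.sunk_zero hc τ)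
  have h1 : p 1 = s.y c + τ * s.l c := (congrArg Prod.snd he).trans (s.sunk_one hc τ)
  obtain ⟨⟨o0, o1⟩, -, -, ⟨-, e1, e2⟩, -, -, huniq, -⟩ := s.cross c hc
  rcases s.tube c (s.D_subset hc) p hp.1 (by rwa [h0, add_sub_cancel_left]) (by
    rw [h1, h0, add_sub_cancel_left, ← e2, ← e1, sideSlope_self]; ring) with h | ⟨-, h⟩
  · obtain rfl : τ = 0 := by linarith
    rw [sunk_self]
    refine (huniq p hp.1 h (by simpa using h1)).resolve_left ?_
    rintro rfl
    exact hp.2 (mem_biUnion hc ⟨0, by rw [abs_zero]; exact s.eps_pos, by simp [upper]⟩)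
  · rw [h0, add_sub_cancel_left] at h
    change p = s.upper c τ at h
    rw [h, s.upper_mem_ground_iff hc hτ] at hp
    rw [s.sunk_of_abs_eq hp, h]

theorem sunk_inj {c c' τ τ' : ℝ} (hc : c ∈ s.D) (hc' : c' ∈ s.D) (hτ : |τ| ≤ s.ε) (hτ' : |τ'| ≤ s.ε)
    (he : proj (s.sunk c τ) = proj (s.sunk c' τ')) : s.sunk c τ = s.sunk c' τ' := by
  have h0 : s.sunk c τ 0 = s.sunk c' τ' 0 := congrArg Prod.fst he
  rw [s.sunk_zero hc, s.sunk_zero hc'] at h0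
  obtain rfl : c = c' := s.eq_of_near (x := c + τ) (s.D_subset hc) (s.D_subset hc')
      (by rwa [add_sub_cancel_left]) (by rwa [h0, add_sub_cancel_left])
  rw [add_left_cancel h0]

/-- A height function for the ground and the lowered bridges. -/
theorem exists_ground_height (h : IsGeneric X S P) :
    ∃ F : ℝ × ℝ → ℝ, PL F ∧ (∀ p ∈ s.ground, F (proj p) = p 2) ∧
      (∀ c ∈ s.D, ∀ τ, |τ| ≤ s.ε → F (proj (s.upper c τ)) = s.sunk c τ 2) ∧
      ∀ B ∈ S, ∀ᶠ q in 𝓝 (proj B), F q = B 2 := by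
  have hε := s.eps_pos
  obtain ⟨T, hTf, hT, hTe⟩ := exists_finite_segments (s.isCompact_ground h.compact)
    (fun v => v 0 ≠ 0) (by
      intro p hp
      obtain ⟨V, h1, h2, h3⟩ := s.exists_rays_ground h hp
      exact ⟨V, h1, fun v hv => ⟨fun h0 => h2 v hv (by rw [h0]; rfl), h2 v hv⟩, h3⟩)
  -- The segments of the ground and those of the lowered bridges.
  set T' : Set (Space × Space) := T ∪ ((fun c => (s.u c, s.upper c (1 * s.ε))) '' s.D ∪
    (fun c => (s.u c, s.upper c (-1 * s.ε))) '' s.D) with hT'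
  have hDf := s.finite.subset s.D_subset
  have hT'f : T'.Finite := hTf.union ((hDf.image _).union (hDf.image _))
  have hmem : ∀ p, p ∈ ⋃ e ∈ T', segment ℝ e.1 e.2 ↔
      p ∈ s.ground ∨ ∃ c ∈ s.D, ∃ τ, |τ| ≤ s.ε ∧ p = s.sunk c τ := by
    intro p
    rw [hT', biUnion_union, biUnion_union, ← hT, biUnion_image, biUnion_image]
    simp only [mem_union, mem_iUnion, exists_prop]
    refine or_congr_right ⟨?_, ?_⟩
    · rintro (⟨c, hc, hp⟩ | ⟨c, hc, hp⟩)
      · obtain ⟨t, ht, rfl⟩ := (s.mem_segment_sunk (by simp)).1 hp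
        exact ⟨c, hc, _, by rw [one_mul, abs_of_nonneg ht.1]; exact ht.2, rfl⟩
      · obtain ⟨t, ht, rfl⟩ := (s.mem_segment_sunk (by simp)).1 hp
        exact ⟨c, hc, _, by rw [neg_one_mul, abs_neg, abs_of_nonneg ht.1]; exact ht.2, rfl⟩
    · rintro ⟨c, hc, τ, hτ, rfl⟩
      rcases le_total 0 τ with h0 | h0
      · exact Or.inl ⟨c, hc, (s.mem_segment_sunk (by simp)).2
          ⟨τ, ⟨h0, (abs_le.1 hτ).2⟩, by rw [one_mul]⟩⟩
      · exact Or.inr ⟨c, hc, (s.mem_segment_sunk (by simp)).2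
          ⟨-τ, ⟨neg_nonneg.2 h0, by linarith [(abs_le.1 hτ).1]⟩, by rw [neg_one_mul, neg_neg]⟩⟩
  have hT'0 : ∀ e ∈ T', e.1 0 ≠ e.2 0 := by
    rintro e (he | ⟨c, hc, rfl⟩ | ⟨c, hc, rfl⟩)
    · obtain ⟨v, -, hv, r, hr, he'⟩ := hTe e he
      rw [he']
      simpa using ⟨hr.ne', hv⟩
    · simp only [s.upper_zero hc, (s.cross c hc).2.1.2.1]
      intro h; linarith
    · simp only [s.upper_zero hc, (s.cross c hc).2.1.2.1]
      intro h; linarith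
  have hinj : InjOn proj (⋃ e ∈ T', segment ℝ e.1 e.2) := by
    intro p hp q hq he
    rw [hmem] at hp hq
    rcases hp with hp | ⟨c, hc, τ, hτ, rfl⟩ <;> rcases hq with hq | ⟨c', hc', τ', hτ', rfl⟩
    · exact s.proj_injOn_ground hp hq he
    · exact s.eq_sunk_of_proj hc' hτ' hp he
    · exact (s.eq_sunk_of_proj hc hτ hq he.symm).symm
    · exact s.sunk_inj hc hc' hτ hτ' he
  have hproj : Continuous proj := (continuous_apply 0).prodMk (continuous_apply 1)
  have huniq : ∀ B ∈ S, ∀ p ∈ X, proj p = proj B → p = B := by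
    intro B hB p hp he
    by_contra hne
    exact h.double_notMem B (h.subset (h.singular_subset hB)) p hp (Ne.symm hne)
      (congrArg Prod.fst he).symm (congrArg Prod.snd he).symm (h.singular_subset hB)
  have hflat : ∀ B ∈ S, ∃ δ > 0, ∀ p ∈ ⋃ e ∈ T', segment ℝ e.1 e.2,
      dist (proj p) (proj B) ≤ δ → p 2 = B 2 := by
    intro B hB
    obtain ⟨V, ⟨u, u', v, v', hV, ⟨hz1, hz2, hz3, hz4⟩, -⟩, hL⟩ := h.cross B hB
    obtain ⟨δ, hδ, ht⟩ := exists_tube h.compact hproj (proj B)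
      (fun _ => {q | q ∈ X → q 2 = B 2}) (by
        intro p hp he
        rw [huniq B hB p hp he]
        filter_upwards [hL] with q hq hqX
        obtain ⟨w, hw, r, -, rfl⟩ := hq.1 hqX
        rw [hV] at hw
        have : w 2 = 0 := by rcases hw with rfl | rfl | rfl | rfl <;> assumption
        simp [this])
    have hm : 0 < min δ s.ε := lt_min hδ hε
    refine ⟨min δ s.ε / 2, half_pos hm, fun p hp hd => ?_⟩
    rcases (hmem p).1 hp with hp | ⟨c, hc, τ, hτ, rfl⟩
    · obtain ⟨q, -, -, hq⟩ := ht p hp.1 (by linarith [min_le_left δ s.ε])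
      exact hq hp.1
    -- A lowered bridge is far from the singular points.
    · exfalso
      have hBC := (s.P_mem B (h.singular_subset hB)).1
      have hd0 : |c + τ - B 0| ≤ s.ε := by
        rw [Prod.dist_eq] at hd
        have := (le_max_left _ _).trans hd
        rw [Real.dist_eq] at this
        change |s.sunk c τ 0 - B 0| ≤ _ at this
        rw [s.sunk_zero hc] at this
        linarith [min_le_right δ s.ε]
      have := s.eq_of_near (s.D_subset hc) hBC.1 (by rwa [add_sub_cancel_left]) hd0
      exact hBC.2 (this ▸ hc)
  obtain ⟨F, h1, h2, h3⟩ := exists_height_flat_of_finite hT'f hT'0 hinj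
    (h.finite.subset h.singular_subset) (fun B hB B' hB' he =>
      huniq B' hB' B (h.subset (h.singular_subset hB)) he) hflat
  refine ⟨F, h1, fun p hp => h2 p ((hmem p).2 (Or.inl hp)), fun c hc τ hτ => ?_, h3⟩
  rw [← s.proj_sunk hc]
  exact h2 _ ((hmem _).2 (Or.inr ⟨c, hc, τ, hτ, rfl⟩))

end Spine

/-! ### The spine becomes the axis -/

/-- The local pictures of a set `Y` in the book: arcs that run monotonically inside the pages, and
letters on the axis. The points of `Z` are those with the letter `x 1`. -/
structure BookPicture (Y Z : Set Space) : Prop where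
  compact : IsCompact Y
  subset_book : Y ⊆ book
  axis : ∀ A ∈ Y, A ∈ axis → A ∉ Z → ∃ k k' : ZMod 3 × Side, k.1 ≠ k'.1 ∧
    ∃ u ∈ arcDirections k, ∃ v ∈ arcDirections k', LooksLike Y A {u, v}
  singular : ∀ A ∈ Z, A ∈ Y ∧ A ∈ ThreePage.axis ∧ ∃ v : ZMod 3 × Side → Space,
    (∀ k ∈ (Letter.x 1).arcs, v k ∈ arcDirections k) ∧ LooksLike Y A (v '' (Letter.x 1).arcs)
  off_axis : ∀ A ∈ Y, A ∉ ThreePage.axis → ∃ u v : Space, u 0 < 0 ∧ 0 < v 0 ∧ LooksLike Y A {u, v}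

theorem mem_page_zero {p : Space} : p ∈ page 0 ↔ p 2 = 0 ∧ 0 ≤ p 1 := by simp [page]

theorem mem_page_one {p : Space} : p ∈ page 1 ↔ p 1 = 0 ∧ 0 ≤ p 2 := by simp [page]

theorem mem_page_two {p : Space} : p ∈ page 2 ↔ p 2 = 0 ∧ p 1 ≤ 0 := by
  rw [page, if_neg (by decide), if_neg (by decide)]; rfl

/-- The side to which a direction points. -/
noncomputable def sideOfReal (a : ℝ) : Side := if 0 < a then .right else .left

/-- A direction in a page, but not in the axis, is an arc to the side given by its abscissa. -/
theorem mem_arcDirections {j : ZMod 3} {w : Space} (hj : w ∈ page j) (h : w ∉ axis) (h0 : w 0 ≠ 0) :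
    w ∈ arcDirections (j, sideOfReal (w 0)) := by
  rw [sideOfReal]
  split_ifs with hw
  · exact ⟨hj, h, hw⟩
  · exact ⟨hj, h, lt_of_le_of_ne (not_lt.1 hw) h0⟩

/-- The page of the horizontal plane that contains the points with the second coordinate `b`. -/
noncomputable def pageOfReal (b : ℝ) : ZMod 3 := if 0 < b then 0 else 2

theorem mem_arcDirections_horizontal {w : Space} (h2 : w 2 = 0) (h1 : w 1 ≠ 0) (h0 : w 0 ≠ 0) :
    w ∈ arcDirections (pageOfReal (w 1), sideOfReal (w 0)) := by
  refine mem_arcDirections ?_ (fun h => h1 h.1) h0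
  rw [pageOfReal]
  split_ifs with hw
  · exact mem_page_zero.2 ⟨h2, hw.le⟩
  · exact mem_page_two.2 ⟨h2, not_lt.1 hw⟩

/-- Two horizontal arcs on different sides of the axis lie in different pages. -/
theorem exists_arcs_of_opposite {Y : Set Space} {A u v : Space} (hu : u 0 ≠ 0) (hv : v 0 ≠ 0)
    (hu2 : u 2 = 0) (hv2 : v 2 = 0) (huv : u 1 * v 1 < 0) (hL : LooksLike Y A {u, v}) :
    ∃ k k' : ZMod 3 × Side, k.1 ≠ k'.1 ∧
      ∃ u ∈ arcDirections k, ∃ v ∈ arcDirections k', LooksLike Y A {u, v} := by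
  have hu1 : u 1 ≠ 0 := by intro h; simp [h] at huv
  have hv1 : v 1 ≠ 0 := by intro h; simp [h] at huv
  refine ⟨_, _, ?_, u, mem_arcDirections_horizontal hu2 hu1 hu, v,
    mem_arcDirections_horizontal hv2 hv1 hv, hL⟩
  simp only [pageOfReal]
  rcases mul_neg_iff.1 huv with ⟨h1, h2⟩ | ⟨h1, h2⟩
  · rw [if_pos h1, if_neg h2.not_gt]; decide
  · rw [if_neg h1.not_gt, if_pos h2]; decide

theorem pl_proj : PL proj :=
  (PL.id.apply 0).prodMk (PL.id.apply 1)

theorem proj_add_vertical (p : Space) (t : ℝ) : proj (p + t • ![0, 0, 1]) = proj p := by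
  simp [proj]

/-- The isotopy that moves the graph of `F` to the horizontal plane and then the graph of `g` to the
axis. -/
noncomputable def flatten {F : ℝ × ℝ → ℝ} {g : ℝ → ℝ} (hF : PL F) (hg : PL g) : AmbientPLIsotopy :=
  (shear (fun p => -F (proj p)) ![0, 0, 1] (hF.comp pl_proj).neg
    fun p t => congrArg (fun q => -F q) (proj_add_vertical p t)).trans
    (shear (fun p => -g (p 0)) ![0, 1, 0] (hg.comp (PL.id.apply 0)).neg (by simp))

theorem flatten_apply {F : ℝ × ℝ → ℝ} {g : ℝ → ℝ} (hF : PL F) (hg : PL g) (p : Space) :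
    (flatten hF hg).map 1 p = ![p 0, p 1 - g (p 0), p 2 - F (proj p)] := by
  rw [flatten, AmbientPLIsotopy.trans_apply, shear_apply, shear_apply]
  ext i
  fin_cases i
  · change p 0 + -F (proj p) * 0 + _ * 0 = p 0
    ring
  · change p 1 + -F (proj p) * 0 + -g (p 0 + -F (proj p) * 0) * 1 = p 1 - g (p 0)
    rw [mul_zero, add_zero, add_zero]; ring
  · change p 2 + -F (proj p) * 1 + _ * 0 = p 2 - F (proj p)
    ring

/-- The picture of `X` near a point of the ground outside the closed bridges. -/
theorem Spine.looksLike_flatten {X S P : Set Space} (s : Spine X S P) {F : ℝ × ℝ → ℝ} {g : ℝ → ℝ}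
    (hF : PL F) (hg : PL g) (hFg : ∀ p ∈ s.ground, F (proj p) = p 2) {p : Space}
    (hp : ∀ᶠ q in 𝓝 p, q ∈ s.ground ↔ q ∈ X) {V : Set Space} (hV : V.Finite)
    (hV0 : ∀ v ∈ V, v 0 ≠ 0) (hL : LooksLike X p V) (γ : Space → ℝ)
    (hγ : ∀ v ∈ V, ∃ r₀ > 0, ∀ r ∈ Icc (0 : ℝ) r₀, g (p 0 + r * v 0) = g (p 0) + r * γ v) :
    LooksLike ((flatten hF hg).map 1 '' X) ((flatten hF hg).map 1 p)
      ((fun v => ![v 0, v 1 - γ v, 0]) '' V) := by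
  refine hL.image hV (fun v hv h => hV0 v hv (by rw [h]; rfl)) _ _ fun v hv => ?_
  obtain ⟨r₀, h₀, h1⟩ := hγ v hv
  obtain ⟨r₁, h₁, h2⟩ := exists_radius_of_eventually (w := v) hp
  obtain ⟨r₂, h₂, h3⟩ := hL.hasRay hv
  refine ⟨min r₀ (min r₁ r₂), lt_min h₀ (lt_min h₁ h₂), fun r hr => ?_⟩
  have hr0 : r ≤ r₀ := hr.2.trans (min_le_left _ _)
  have hr1 : r ≤ r₁ := hr.2.trans ((min_le_right _ _).trans (min_le_left _ _))
  have hr2 : r ≤ r₂ := hr.2.trans ((min_le_right _ _).trans (min_le_right _ _))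
  have hg0 : p ∈ s.ground := hp.self_of_nhds.2 (by simpa using h3 0 ⟨le_rfl, h₂.le⟩)
  have hgr := (h2 r ⟨hr.1, hr1⟩).2 (h3 r ⟨hr.1, hr2⟩)
  rw [flatten_apply, flatten_apply, hFg _ hgr, hFg _ hg0]
  have e0 : (p + r • v : Space) 0 = p 0 + r * v 0 := rfl
  rw [e0, h1 r ⟨hr.1, hr0⟩]
  ext i
  fin_cases i
  · rfl
  · change p 1 + r * v 1 - (g (p 0) + r * γ v) = p 1 - g (p 0) + r * (v 1 - γ v)
    ring
  · change (p + r • v : Space) 2 - (p + r • v : Space) 2 = p 2 - p 2 + r * 0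
    ring

theorem sideSlope_mul {l r t a : ℝ} (ht : 0 ≤ t) :
    sideSlope l r (t * a) * (t * a) = t * (sideSlope l r a * a) := by
  rcases ht.eq_or_lt with rfl | ht
  · simp
  · have : sideSlope l r (t * a) = sideSlope l r a := by
      simp only [sideSlope, mul_pos_iff_of_pos_left ht]
    rw [this]; ring

theorem mem_book {p : Space} {i : ZMod 3} (h : p ∈ page i) : p ∈ book := mem_iUnion.2 ⟨i, h⟩

theorem mem_book_of_zero {p : Space} (h : p 2 = 0) : p ∈ book := by
  rcases le_total 0 (p 1) with h1 | h1
  · exact mem_book (mem_page_zero.2 ⟨h, h1⟩)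
  · exact mem_book (mem_page_two.2 ⟨h, h1⟩)

/-! ### The picture in the book -/

/-- A bridge is carried to a tent in the page `1`: its projection lies on the spine, and its height
is measured from the lowered bridge. -/
theorem Spine.flatten_upper {X S P : Set Space} (s : Spine X S P) {F : ℝ × ℝ → ℝ} {g : ℝ → ℝ}
    (hF : PL F) (hg : PL g)
    (hFs : ∀ c ∈ s.D, ∀ τ, |τ| ≤ s.ε → F (proj (s.upper c τ)) = s.sunk c τ 2)
    (hgs : ∀ c ∈ s.C, ∀ x, |x - c| ≤ s.ε →
        g x = s.y c + sideSlope (s.l c) (s.r c) (x - c) * (x - c)) {c τ : ℝ} (hc : c ∈ s.D)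
    (hτ : |τ| ≤ s.ε) : (flatten hF hg).map 1 (s.upper c τ) =
      ![c + τ, 0, (s.o c 2 - s.u c 2) * (1 - |τ| / s.ε)] := by
  obtain ⟨-, -, -, ⟨-, e1, e2⟩, -⟩ := s.cross c hc
  rw [flatten_apply, hFs c hc τ hτ, s.upper_zero hc, s.upper_one hc,
    hgs c (s.D_subset hc) _ (by rwa [add_sub_cancel_left]), add_sub_cancel_left, ← e2, ← e1,
    sideSlope_self]
  ext i
  fin_cases i
  · rfl
  · change s.y c + τ * _ - (s.y c + _ * τ) = 0
    ring
  · change s.o c 2 + τ * s.d c 2 - (s.u c 2 + |τ| / s.ε * (s.o c 2 - s.u c 2) + τ * s.d c 2) = _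
    change _ = (s.o c 2 - s.u c 2) * (1 - |τ| / s.ε)
    ring

theorem exists_direction_real {g : ℝ → ℝ} (hg : PL g) (x v : ℝ) :
    ∃ w, ∃ r₀ > 0, ∀ r ∈ Icc (0 : ℝ) r₀, g (x + r * v) = g x + r * w := by
  simpa only [smul_eq_mul] using hg.exists_direction x v

/-- Over the interior of the bridge the image runs along the tent. -/
theorem Spine.bridge_picture {X S P : Set Space} (s : Spine X S P) {Φ : Space ≃ₜ Space}
    {c τ : ℝ} (hc : c ∈ s.D) (hΦ : ∀ t, |t| ≤ s.ε → Φ (s.upper c t) =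
      ![c + t, 0, (s.o c 2 - s.u c 2) * (1 - |t| / s.ε)]) (hτ : |τ| < s.ε) :
    ∃ u v : Space, u 0 < 0 ∧ 0 < v 0 ∧ LooksLike (Φ '' X) (Φ (s.upper c τ)) {u, v} := by
  have hε := s.eps_pos
  obtain ⟨d0, -⟩ := (s.cross c hc).2.2.2.1
  have hray : ∀ σ : ℝ, ∃ w : ℝ, ∃ r₀ > 0, ∀ r ∈ Icc (0 : ℝ) r₀,
      Φ (s.upper c τ + r • σ • s.d c) = Φ (s.upper c τ) + r • ![σ, 0, w] := by
    intro σ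
    obtain ⟨w, r₀, h₀, hw⟩ := exists_direction_real (PL.id (E := ℝ)).abs τ σ
    have hcont : Tendsto (fun r : ℝ => |τ + r * σ|) (𝓝 0) (𝓝 |τ|) := by
      have : Continuous fun r : ℝ => |τ + r * σ| := by fun_prop
      simpa using this.tendsto 0
    obtain ⟨r₁, h₁, hr₁⟩ := Metric.eventually_nhds_iff.1 (hcont.eventually (gt_mem_nhds hτ))
    refine ⟨-(s.o c 2 - s.u c 2) * w / s.ε, min r₀ (r₁ / 2), lt_min h₀ (half_pos h₁), fun r hr =>
      ?_⟩
    have e : s.upper c τ + r • σ • s.d c = s.upper c (τ + r * σ) := by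
      simp only [upper]; module
    have h2 : |τ + r * σ| < s.ε := hr₁ (by
      rw [dist_zero_right, Real.norm_of_nonneg hr.1]
      linarith [hr.2.trans (min_le_right _ _)])
    rw [e, hΦ _ h2.le, hΦ _ hτ.le, hw r ⟨hr.1, hr.2.trans (min_le_left _ _)⟩]
    ext i
    fin_cases i
    · change c + (τ + r * σ) = c + τ + r * σ
      ring
    · change (0 : ℝ) = 0 + r * 0
      ring
    · change (s.o c 2 - s.u c 2) * (1 - (|τ| + r * w) / s.ε) =
        (s.o c 2 - s.u c 2) * (1 - |τ| / s.ε) + r * (-(s.o c 2 - s.u c 2) * w / s.ε)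
      ring
  choose w hw using hray
  have hdne : s.d c ≠ 0 := by intro h; rw [h] at d0; exact zero_ne_one d0
  have hne : s.d c ≠ -s.d c := by
    intro h
    have := congrFun h 0
    rw [Pi.neg_apply, d0] at this
    norm_num at this
  classical
  have := (s.upper_straight hc hτ.le).image (by simp) (by
    rintro v (rfl | rfl)
    exacts [hdne, neg_ne_zero.2 hdne]) Φ
    (fun v => if v = s.d c then ![1, 0, w 1] else ![-1, 0, w (-1)]) (by
    rintro v (rfl | rfl)
    · simpa using hw 1
    · simpa [hne.symm] using hw (-1))
  rw [image_pair, if_pos rfl, if_neg hne.symm, pair_comm] at this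
  exact ⟨_, _, by simp, by simp, this⟩

/-- At the end of a bridge the tent in the page `1` meets an arc in the page `2`, since the spine
turns up there more steeply than the strand. -/
theorem Spine.bridge_end_picture {X S P : Set Space} (s : Spine X S P) {F : ℝ × ℝ → ℝ} {g : ℝ → ℝ}
    (hF : PL F) (hg : PL g) (hFg : ∀ p ∈ s.ground, F (proj p) = p 2) {c σ N : ℝ} (hc : c ∈ s.D)
    (hσ : |σ| = 1) (hΦ : ∀ t, |t| ≤ s.ε → (flatten hF hg).map 1 (s.upper c t) =
      ![c + t, 0, (s.o c 2 - s.u c 2) * (1 - |t| / s.ε)]) (hN : |s.l c| < N)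
    (hgN : ∀ᶠ t in 𝓝 (0 : ℝ), 0 ≤ t → g (c + σ * s.ε + σ * t) = g (c + σ * s.ε) + N * t) :
    ∃ k k' : ZMod 3 × Side, k.1 ≠ k'.1 ∧ ∃ u ∈ arcDirections k, ∃ v ∈ arcDirections k',
      LooksLike ((flatten hF hg).map 1 '' X)
        ((flatten hF hg).map 1 (s.upper c (σ * s.ε))) {u, v} := by
  have hε := s.eps_pos
  obtain ⟨d0, d1, -⟩ := (s.cross c hc).2.2.2.1
  have hou := (s.cross c hc).2.2.1
  set Φ := (flatten hF hg).map 1 with hΦdef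
  have hσ0 : σ ≠ 0 := by rintro rfl; simp at hσ
  have habs : |σ * s.ε| = s.ε := by rw [abs_mul, hσ, one_mul, abs_of_pos hε]
  have hσ2 : σ * σ = 1 := by rw [← abs_mul_abs_self, hσ, one_mul]
  -- The arc outside the bridge is carried to the horizontal plane, and drops below the spine there.
  have hout : ∃ r₀ > 0, ∀ r ∈ Icc (0 : ℝ) r₀, Φ (s.upper c (σ * s.ε) + r • σ • s.d c) =
      Φ (s.upper c (σ * s.ε)) + r • ![σ, σ * s.l c - N, 0] := by
    obtain ⟨r₁, h₁, hr₁⟩ := (s.ground_looksLike_end hc hσ).hasRay rfl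
    obtain ⟨r₂, h₂, hr₂⟩ := Metric.eventually_nhds_iff.1 hgN
    refine ⟨min r₁ (r₂ / 2), lt_min h₁ (half_pos h₂), fun r hr => ?_⟩
    have hm := hr₁ r ⟨hr.1, hr.2.trans (min_le_left _ _)⟩
    have hm0 := hr₁ 0 ⟨le_rfl, h₁.le⟩
    rw [zero_smul, add_zero] at hm0
    have e : s.upper c (σ * s.ε) + r • σ • s.d c = s.upper c (σ * s.ε + σ * r) := by
      simp only [upper]; module
    have hgr := hr₂ (y := r) (by
      rw [dist_zero_right, Real.norm_of_nonneg hr.1]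
      linarith [hr.2.trans (min_le_right _ _)]) hr.1
    rw [e] at hm ⊢
    rw [hΦdef, flatten_apply, flatten_apply, hFg _ hm, hFg _ hm0, s.upper_zero hc, s.upper_one hc,
      s.upper_zero hc, s.upper_one hc, ← add_assoc, hgr]
    ext i
    fin_cases i
    · change c + σ * s.ε + σ * r = c + σ * s.ε + r * σ
      ring
    · change s.y c + (σ * s.ε + σ * r) * s.l c - (g (c + σ * s.ε) + N * r) =
        s.y c + σ * s.ε * s.l c - g (c + σ * s.ε) + r * (σ * s.l c - N)
      ring
    · change _ - _ = _ - _ + r * 0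
      ring
  -- The arc inside the bridge is carried to a side of the tent.
  have hin : ∃ r₀ > 0, ∀ r ∈ Icc (0 : ℝ) r₀, Φ (s.upper c (σ * s.ε) + r • -(σ • s.d c)) =
      Φ (s.upper c (σ * s.ε)) + r • ![-σ, 0, (s.o c 2 - s.u c 2) / s.ε] := by
    refine ⟨s.ε, hε, fun r hr => ?_⟩
    have e : s.upper c (σ * s.ε) + r • -(σ • s.d c) = s.upper c (σ * (s.ε - r)) := by
      simp only [upper]; module
    have ha : |σ * (s.ε - r)| = s.ε - r := by
      rw [abs_mul, hσ, one_mul, abs_of_nonneg (by linarith [hr.2])]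
    rw [e, hΦ _ (by rw [ha]; linarith [hr.1]), hΦ _ habs.le, ha, habs]
    ext i
    fin_cases i
    · change c + σ * (s.ε - r) = c + σ * s.ε + r * -σ
      ring
    · change (0 : ℝ) = 0 + r * 0
      ring
    · change (s.o c 2 - s.u c 2) * (1 - (s.ε - r) / s.ε) =
        (s.o c 2 - s.u c 2) * (1 - s.ε / s.ε) + r * ((s.o c 2 - s.u c 2) / s.ε)
      field_simp; ring
  have hX : LooksLike X (s.upper c (σ * s.ε)) {σ • s.d c, -(σ • s.d c)} := by
    have := s.upper_straight hc habs.le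
    rcases (abs_eq (zero_le_one' ℝ)).1 hσ with rfl | rfl
    · simpa using this
    · rw [neg_one_smul, neg_neg, pair_comm]; exact this
  have hdne : σ • s.d c ≠ 0 := by
    intro h
    have := congrFun h 0
    rw [Pi.smul_apply, d0, smul_eq_mul, mul_one] at this
    exact hσ0 this
  have hne : σ • s.d c ≠ -(σ • s.d c) := by
    intro h
    have := congrFun h 0
    rw [Pi.neg_apply, Pi.smul_apply, d0, smul_eq_mul, mul_one] at this
    exact hσ0 (by linarith)
  classical
  have := hX.image (by simp) (by
    rintro v (rfl | rfl)
    exacts [hdne, neg_ne_zero.2 hdne]) Φ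
    (fun v => if v = σ • s.d c then ![σ, σ * s.l c - N, 0]
      else ![-σ, 0, (s.o c 2 - s.u c 2) / s.ε]) (by
    rintro v (rfl | rfl)
    · simpa using hout
    · simpa [hne.symm] using hin)
  rw [image_pair, if_pos rfl, if_neg hne.symm] at this
  have hlt : σ * s.l c - N < 0 := by
    have : σ * s.l c ≤ |s.l c| := (le_abs_self _).trans (by rw [abs_mul, hσ, one_mul])
    linarith
  have hpos : 0 < (s.o c 2 - s.u c 2) / s.ε := div_pos (sub_pos.2 hou) hε
  refine ⟨(2, sideOfReal σ), (1, sideOfReal (-σ)),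
    by change (2 : ZMod 3) ≠ 1; decide, _, mem_arcDirections
    (w := ![σ, σ * s.l c - N, 0]) (mem_page_two.2 ⟨rfl, hlt.le⟩) (fun h => hlt.ne h.1) hσ0, _,
    mem_arcDirections (w := ![-σ, 0, (s.o c 2 - s.u c 2) / s.ε])
      (mem_page_one.2 ⟨rfl, hpos.le⟩) (fun h => hpos.ne' h.2) (neg_ne_zero.2 hσ0), this⟩

/-- The four arcs in the four sectors form the letter `x 1`, with two arcs in each of the pages `0`
and `2`. -/
theorem InSectors.letter {Y V : Set Space} {A : Space} {l r : ℝ} (hV : InSectors l r V)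
    (hL : LooksLike Y A ((fun v : Space => ![v 0, sideOf l r v, 0]) '' V)) :
    ∃ v : ZMod 3 × Side → Space, (∀ k ∈ (Letter.x 1).arcs, v k ∈ arcDirections k) ∧
      LooksLike Y A (v '' (Letter.x 1).arcs) := by
  obtain ⟨u, u', v, v', rfl, -, ⟨pu, pu', pv, pv'⟩, hu, hu', hv, hv'⟩ := hV
  have key : ∀ {w : Space}, w 0 ≠ 0 → sideOf l r w ≠ 0 → (![w 0, sideOf l r w, 0] : Space) ∈
      arcDirections (pageOfReal (sideOf l r w), sideOfReal (w 0)) := fun {w} h0 h1 =>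
    mem_arcDirections_horizontal (w := ![w 0, sideOf l r w, 0]) rfl h1 h0
  have ku := key pu.ne' hu.ne
  have ku' := key pu'.ne' hu'.ne'
  have kv := key pv.ne hv.ne
  have kv' := key pv'.ne hv'.ne'
  rw [pageOfReal, sideOfReal, if_neg hu.not_gt, if_pos pu] at ku
  rw [pageOfReal, sideOfReal, if_pos hu', if_pos pu'] at ku'
  rw [pageOfReal, sideOfReal, if_neg hv.not_gt, if_neg pv.not_gt] at kv
  rw [pageOfReal, sideOfReal, if_pos hv', if_neg pv'.not_gt] at kv'
  have harcs : (Letter.x 1).arcs = {(0, .left), (0, .right), (2, .left), (2, .right)} := rfl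
  have h20 : (2 : ZMod 3) ≠ 0 := by decide
  refine ⟨fun k => match k.2 with
    | .right => if k.1 = 0 then ![u' 0, sideOf l r u', 0] else ![u 0, sideOf l r u, 0]
    | .left => if k.1 = 0 then ![v' 0, sideOf l r v', 0] else ![v 0, sideOf l r v, 0], ?_, ?_⟩
  · rw [harcs]
    rintro k (rfl | rfl | rfl | rfl)
    · exact kv'
    · exact ku'
    · simpa only [if_neg h20] using kv
    · simpa only [if_neg h20] using ku
  · rw [harcs]
    convert hL using 1
    simp only [image_insert_eq, image_singleton, if_neg h20, if_true]
    ext w; simp only [mem_insert_iff, mem_singleton_iff]; tauto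

/-- A set in general position is carried to a picture in the book. Near the singular points the
isotopy preserves the horizontal planes, so that it respects the templates. -/
theorem IsGeneric.exists_bookPicture {X S P : Set Space} (h : IsGeneric X S P) :
    ∃ Φ : AmbientPLIsotopy, BookPicture (Φ.map 1 '' X) (Φ.map 1 '' S) ∧
      ∀ B ∈ S, ∀ᶠ q in 𝓝 B, Φ.map 1 q 2 = 0 ↔ q 2 = B 2 := by
  obtain ⟨s⟩ := h.exists_spine
  obtain ⟨M₀, hM₀⟩ := h.straight
  obtain ⟨M₁, hM₁⟩ := (s.finite.image fun c => |s.l c|).bddAbove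
  -- The steep parts of the spine are steeper than all straight strands and than all prescribed
  -- pieces, so that they are transverse to `X`.
  obtain ⟨g, hg, hgs, N, hN, hgX, hgN⟩ := s.exists_function h.compact (max M₀ M₁)
  obtain ⟨F, hF, hFg, hFs, hFS⟩ := s.exists_ground_height h
  have hε := s.eps_pos
  have hΦup := fun c (hc : c ∈ s.D) τ (hτ : |τ| ≤ s.ε) => s.flatten_upper hF hg hFs hgs hc hτ
  set Φ := flatten hF hg with hΦ
  have hinj := (Φ.map 1).injective
  have hgc : ∀ c ∈ s.C, g c = s.y c := by
    intro c hc
    rw [hgs c hc c (by simpa using hε.le)]; simp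
  -- Directional derivatives of the spine at the abscissas of special points.
  have hslope : ∀ c ∈ s.C, ∀ v : Space, ∃ r₀ > 0, ∀ r ∈ Icc (0 : ℝ) r₀,
      g (c + r * v 0) = g c + r * (sideSlope (s.l c) (s.r c) (v 0) * v 0) := by
    intro c hc v
    have hpos : 0 < |v 0| + 1 := by positivity
    refine ⟨s.ε / (|v 0| + 1), div_pos hε hpos, fun r hr => ?_⟩
    have hr' : r * (|v 0| + 1) ≤ s.ε := (le_div_iff₀ hpos).1 hr.2
    rw [hgs c hc (c + r * v 0) (by
      rw [add_sub_cancel_left, abs_mul, abs_of_nonneg hr.1]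
      linarith [hr.1]), hgc c hc, add_sub_cancel_left, sideSlope_mul hr.1]
  -- Away from the closed bridges, the image is at the height zero.
  have hground : ∀ p ∈ X, (∀ c ∈ s.D, ∀ τ, |τ| ≤ s.ε → p ≠ s.upper c τ) → Φ.map 1 p 2 = 0 := by
    intro p hp hnb
    have := (s.ground_eventually_eq hnb).self_of_nhds.2 hp
    rw [hΦ, flatten_apply, hFg p this]
    exact sub_self _
  have hΦ0 : ∀ p, Φ.map 1 p 0 = p 0 := fun p => by rw [hΦ, flatten_apply]; rfl
  have hΦ1 : ∀ p, Φ.map 1 p 1 = p 1 - g (p 0) := fun p => by rw [hΦ, flatten_apply]; rfl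
  have hΦ2 : ∀ p, Φ.map 1 p 2 = p 2 - F (proj p) := fun p => by rw [hΦ, flatten_apply]; rfl
  have hPg : ∀ p ∈ P, p 1 = g (p 0) := fun p hp => by
    rw [(s.P_mem p hp).2, hgc _ (s.P_mem p hp).1.1]
  have hPnb : ∀ p, p 0 ∈ s.C \ s.D → ∀ c ∈ s.D, ∀ τ, |τ| ≤ s.ε → p ≠ s.upper c τ := by
    rintro _ hp c hc τ hτ rfl
    rw [s.upper_zero hc] at hp
    have he := s.eq_of_near (x := c + τ) hp.1 (s.D_subset hc) (by simpa using hε.le)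
      (by simpa using hτ)
    rw [he] at hp
    exact hp.2 hc
  refine ⟨Φ, ⟨h.compact.image (Φ.map 1).continuous, ?_, ?_, ?_, ?_⟩, ?_⟩
  · rintro _ ⟨p, hp, rfl⟩
    by_cases hb : ∃ c ∈ s.D, ∃ τ, |τ| ≤ s.ε ∧ p = s.upper c τ
    · obtain ⟨c, hc, τ, hτ, rfl⟩ := hb
      rw [hΦup c hc τ hτ]
      refine mem_book (i := 1) (mem_page_one.2 ⟨rfl, mul_nonneg ?_ ?_⟩)
      · exact sub_nonneg.2 (s.cross c hc).2.2.1.le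
      · exact sub_nonneg.2 ((div_le_one hε).2 hτ)
    · push Not at hb
      exact mem_book_of_zero (hground p hp hb)
  · rintro _ ⟨p, hp, rfl⟩ hA hAS
    have hpS : p ∉ S := fun h => hAS (mem_image_of_mem _ h)
    -- A point of the axis is an end of a bridge, an under-crossing point, a vertex, or a point
    -- where a strand crosses a steep part of the spine.
    by_cases hb : ∃ c ∈ s.D, ∃ τ, |τ| ≤ s.ε ∧ p = s.upper c τ
    · obtain ⟨c, hc, τ, hτ, rfl⟩ := hb
      have hz : Φ.map 1 (s.upper c τ) 2 = 0 := hA.2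
      rw [hΦup c hc τ hτ] at hz
      have hτε : |τ| = s.ε := by
        have : (1 - |τ| / s.ε) = 0 := (mul_eq_zero.1 hz).resolve_left
          (sub_pos.2 (s.cross c hc).2.2.1).ne'
        rw [sub_eq_zero, eq_div_iff hε.ne'] at this
        linarith
      have hσ : |τ / s.ε| = 1 := by
        rw [abs_div, hτε, abs_of_pos hε, div_self hε.ne']
      have := s.bridge_end_picture hF hg hFg (σ := τ / s.ε) (N := N) hc hσ (hΦup c hc)
        (((hM₁ ⟨c, s.D_subset hc, rfl⟩).trans (le_max_right _ _)).trans_lt hN) (by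
          filter_upwards [hgN c (s.D_subset hc)] with t ht ht0
          rcases (abs_eq (zero_le_one' ℝ)).1 hσ with h1 | h1
          · rw [h1, one_mul, one_mul]; exact (ht ht0).1
          · rw [h1, neg_one_mul, neg_one_mul]; exact (ht ht0).2)
      rwa [div_mul_cancel₀ _ hε.ne'] at this
    · push Not at hb
      have hgr := s.ground_eventually_eq hb
      have hpg : p 1 = g (p 0) := by
        have : Φ.map 1 p 1 = 0 := hA.1
        rw [hΦ1] at this
        linarith
      by_cases hnear : ∃ c ∈ s.C, |p 0 - c| ≤ s.ε
      · obtain ⟨c, hc, hpc⟩ := hnear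
        obtain rfl | ⟨hcD, he⟩ := s.tube c hc p hp hpc (by rw [hpg, hgs c hc _ hpc])
        · have hpy : p 1 = s.y (p 0) := by rw [hpg, hgc _ hc]
          by_cases hcD : p 0 ∈ s.D
          -- An under-crossing point.
          · obtain ⟨-, -, -, ⟨-, -, elr⟩, ⟨d0, d1⟩, hL, huniq, -⟩ := s.cross _ hcD
            rcases huniq p hp rfl hpy with hpo | hpu
            · exact absurd (by rw [Spine.upper, zero_smul, add_zero]; exact hpo)
                (hb _ hcD 0 (by rw [abs_zero]; exact hε.le))
            · rw [← hpu] at hL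
              have e1 : s.r (p 0) = s.l (p 0) := by
                rw [← elr]; exact (s.cross _ hcD).2.2.2.1.2.1
              have := s.looksLike_flatten hF hg hFg hgr (by simp) (by
                rintro v (rfl | rfl)
                · rw [d0]; exact one_ne_zero
                · rw [Pi.neg_apply, d0]; exact neg_ne_zero.2 one_ne_zero) hL _
                (fun v _ => hslope _ hc v)
              rw [image_pair] at this
              refine exists_arcs_of_opposite ?_ ?_ rfl rfl ?_ this
              · change s.d' (p 0) 0 ≠ 0
                rw [d0]; exact one_ne_zero
              · change -s.d' (p 0) 0 ≠ 0
                rw [d0]; exact neg_ne_zero.2 one_ne_zero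
              · change (s.d' (p 0) 1 - sideSlope _ _ (s.d' (p 0) 0) * s.d' (p 0) 0) *
                  (-s.d' (p 0) 1 - sideSlope _ _ (-s.d' (p 0) 0) * -s.d' (p 0) 0) < 0
                rw [e1, sideSlope_self, sideSlope_self, d0]
                have := mul_self_pos.2 (sub_ne_zero.2 d1)
                linarith
          -- A vertex.
          · obtain ⟨q, hqP, hq0, huniq, -, hq⟩ := s.vertex _ ⟨hc, hcD⟩
            obtain rfl := huniq p hp rfl hpy
            obtain ⟨u, v, hu, hv, huv, hL⟩ := hq hpS
            have := s.looksLike_flatten hF hg hFg hgr (by simp) (by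
              rintro w (rfl | rfl) <;> assumption) hL _ (fun v _ => hslope _ hc v)
            rw [image_pair] at this
            exact exists_arcs_of_opposite (u := ![u 0, sideOf _ _ u, 0])
              (v := ![v 0, sideOf _ _ v, 0]) hu hv rfl rfl huv this
        · exact absurd he (hb c hcD _ hpc)
      -- A point on a steep part of the spine.
      · obtain ⟨hpc, σ, hσ, hgσ⟩ := (hgX p hp hpg).resolve_left hnear
        have hpP : p ∉ P := fun hpP => hpc _ (s.P_mem p hpP).1.1 rfl
        obtain ⟨d, d0, dM, hL⟩ := hM₀ p ⟨hp, hpP⟩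
        have hdir : ∀ v : Space, ∃ r₀ > 0, ∀ r ∈ Icc (0 : ℝ) r₀,
            g (p 0 + r * v 0) = g (p 0) + r * (σ * v 0) := by
          intro v
          have hcont : Tendsto (fun r : ℝ => p 0 + r * v 0) (𝓝 0) (𝓝 (p 0)) := by
            have : Continuous fun r : ℝ => p 0 + r * v 0 := by fun_prop
            simpa using this.tendsto 0
          obtain ⟨r₀, h₀, hr⟩ := Metric.eventually_nhds_iff.1 (hcont.eventually hgσ)
          refine ⟨r₀ / 2, half_pos h₀, fun r hr' => ?_⟩
          rw [hr (by rw [dist_zero_right, Real.norm_of_nonneg hr'.1]; linarith [hr'.2])]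
          ring
        have := s.looksLike_flatten hF hg hFg hgr (by simp) (by
          rintro v (rfl | rfl)
          · rw [d0]; exact one_ne_zero
          · rw [Pi.neg_apply, d0]; exact neg_ne_zero.2 one_ne_zero) hL _ (fun v _ => hdir v)
        rw [image_pair] at this
        refine exists_arcs_of_opposite ?_ ?_ rfl rfl ?_ this
        · change d 0 ≠ 0
          rw [d0]; exact one_ne_zero
        · change -d 0 ≠ 0
          rw [d0]; exact neg_ne_zero.2 one_ne_zero
        · change (d 1 - σ * d 0) * (-d 1 - σ * -d 0) < 0
          rw [d0]
          have hne : d 1 - σ ≠ 0 := by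
            intro h0
            rw [sub_eq_zero] at h0
            rw [h0, hσ] at dM
            linarith [le_max_left M₀ M₁]
          have := mul_self_pos.2 hne
          linarith
  · rintro _ ⟨p, hpS, rfl⟩
    have hpP := h.singular_subset hpS
    have hp := h.subset hpP
    have hc := (s.P_mem p hpP).1
    have hnb := hPnb p hc
    refine ⟨mem_image_of_mem _ hp, ⟨?_, hground p hp hnb⟩, ?_⟩
    · rw [hΦ1, hPg p hpP, sub_self]
    · obtain ⟨q, -, -, huniq, hq, -⟩ := s.vertex _ hc
      obtain rfl := huniq p hp rfl (s.P_mem p hpP).2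
      obtain ⟨V, hV, hL⟩ := hq hpS
      have hV' := hV
      obtain ⟨u, u', v, v', hVe, -, ⟨pu, pu', pv, pv'⟩, -⟩ := hV'
      have := s.looksLike_flatten hF hg hFg (s.ground_eventually_eq hnb) (by rw [hVe]; simp) (by
        rw [hVe]
        rintro w (rfl | rfl | rfl | rfl)
        exacts [pu.ne', pu'.ne', pv.ne, pv'.ne]) hL _ (fun v _ => hslope _ hc.1 v)
      exact hV.letter this
  · rintro _ ⟨p, hp, rfl⟩ hA
    by_cases hb : ∃ c ∈ s.D, ∃ τ, |τ| ≤ s.ε ∧ p = s.upper c τ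
    · obtain ⟨c, hc, τ, hτ, rfl⟩ := hb
      refine s.bridge_picture hc (hΦup c hc) (lt_of_le_of_ne hτ fun he => hA ?_)
      rw [hΦup c hc τ hτ, he, div_self hε.ne', sub_self, mul_zero]
      exact ⟨rfl, rfl⟩
    · push Not at hb
      have hpP : p ∉ P := fun hpP => hA ⟨by rw [hΦ1, hPg p hpP, sub_self], hground p hp hb⟩
      obtain ⟨d, d0, -, hL⟩ := hM₀ p ⟨hp, hpP⟩
      have hdir := fun v : Space => exists_direction_real hg (p 0) (v 0)
      choose γ hγ using hdir
      have := s.looksLike_flatten hF hg hFg (s.ground_eventually_eq hb) (by simp) (by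
          rintro v (rfl | rfl)
          · rw [d0]; exact one_ne_zero
          · rw [Pi.neg_apply, d0]; exact neg_ne_zero.2 one_ne_zero) hL γ (fun v _ => hγ v)
      rw [image_pair, pair_comm] at this
      refine ⟨_, _, ?_, ?_, this⟩
      · change -d 0 < 0
        rw [d0]; norm_num
      · change 0 < d 0
        rw [d0]; exact one_pos
  · intro B hB
    have hproj : Tendsto proj (𝓝 B) (𝓝 (proj B)) := pl_proj.continuous.tendsto B
    filter_upwards [hproj.eventually (hFS B hB)] with q hq
    rw [hΦ2, hq, sub_eq_zero]

/-! ### Unions of monotone strands -/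

/-- Near `p` the set `Z` consists of `p`, of an open arc to the left of `p` if `l` holds and of an
open arc to the right of `p` if `r` holds. -/
def IsStrandAt (Z : Set Space) (p : Space) (l r : Prop) : Prop :=
  ∃ u v : Space, u 0 < 0 ∧ 0 < v 0 ∧ ∀ᶠ q in 𝓝 p, q ∈ Z ↔
    q = p ∨ (l ∧ ∃ t > (0 : ℝ), q = p + t • u) ∨ (r ∧ ∃ t > (0 : ℝ), q = p + t • v)

/-- The points of `Z` with the abscissa `b`. -/
def fibre (Z : Set Space) (b : ℝ) : Set Space := {p ∈ Z | p 0 = b}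

theorem finite_fibre {Z : Set Space} (hZc : IsCompact Z) {l r : Space → Prop}
    (hZ : ∀ p ∈ Z, IsStrandAt Z p (l p) (r p)) (b : ℝ) : (fibre Z b).Finite := by
  have hF : IsCompact (fibre Z b) :=
    hZc.inter_right (isClosed_eq (continuous_apply 0) continuous_const)
  obtain ⟨t, -, ht⟩ := hF.elim_nhds_subcover (fun p => {q | q ∈ fibre Z b → q = p}) (by
    intro p hp
    obtain ⟨u, v, hu, hv, h⟩ := hZ p hp.1
    filter_upwards [h] with q hq hqF
    rcases hq.1 hqF.1 with h | ⟨-, t, ht, rfl⟩ | ⟨-, t, ht, rfl⟩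
    · exact h
    · have := hqF.2
      simp [hp.2, ht.ne', hu.ne] at this
    · have := hqF.2
      simp [hp.2, ht.ne', hv.ne'] at this)
  refine t.finite_toSet.subset fun p hp => ?_
  obtain ⟨q, hq, h⟩ := mem_iUnion₂.1 (ht hp)
  rw [h hp]; exact hq

/-- Over the open interval of radius `δ` around `b`, the points of `Z` are labelled by the points of
the fibre over `b` on the same strand. The propositions `l p` and `r p` tell whether the strand of
`p` extends to the left and to the right. -/
structure IsLabelling (Z : Set Space) (l r : Space → Prop) (b δ : ℝ) (Λ : Space → Space) :
    Prop where
  mem : ∀ q ∈ Z, |q 0 - b| < δ → Λ q ∈ fibre Z b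
  self : ∀ q ∈ Z, q 0 = b → Λ q = q
  left : ∀ q ∈ Z, |q 0 - b| < δ → q 0 < b → l (Λ q)
  right : ∀ q ∈ Z, |q 0 - b| < δ → b < q 0 → r (Λ q)
  eventually_eq : ∀ q ∈ Z, |q 0 - b| < δ → ∀ᶠ q' in 𝓝 q, q' ∈ Z → Λ q' = Λ q
  inj : ∀ q ∈ Z, ∀ q' ∈ Z, |q 0 - b| < δ → q 0 = q' 0 → Λ q = Λ q' → q = q'
  surj_left : ∀ p ∈ fibre Z b, l p → ∀ x, b - δ < x → x < b → ∃ q ∈ Z, q 0 = x ∧ Λ q = p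
  surj_right : ∀ p ∈ fibre Z b, r p → ∀ x, b < x → x < b + δ → ∃ q ∈ Z, q 0 = x ∧ Λ q = p

/-- By compactness, `Z` is covered over a short interval by the strand neighbourhoods of the points
of the fibre over its centre. -/
theorem exists_labelling {Z : Set Space} (hZc : IsCompact Z) {l r : Space → Prop}
    (hZ : ∀ p ∈ Z, IsStrandAt Z p (l p) (r p)) (b : ℝ) : ∃ δ > 0, ∃ Λ, IsLabelling Z l r b δ Λ := by
  classical
  have hFf := finite_fibre hZc hZ b
  obtain ⟨W, hW, hWd⟩ := hFf.t2_separation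
  choose! u v hu hv hev using hZ
  have hO : ∀ p ∈ Z, ∃ O : Set Space, IsOpen O ∧ p ∈ O ∧ ∀ q ∈ O, q ∈ Z ↔
      q = p ∨ (l p ∧ ∃ t > (0 : ℝ), q = p + t • u p) ∨ (r p ∧ ∃ t > (0 : ℝ), q = p + t • v p) := by
    intro p hp
    obtain ⟨O, h1, h2, h3⟩ := eventually_nhds_iff.1 (hev p hp)
    exact ⟨O, h2, h3, h1⟩
  choose! O hOo hOp hOq using hO
  set N : Space → Set Space := fun p => O p ∩ W p with hN
  have hNo : ∀ p ∈ Z, IsOpen (N p) := fun p hp => (hOo p hp).inter (hW p).2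
  have hNp : ∀ p ∈ Z, p ∈ N p := fun p hp => ⟨hOp p hp, (hW p).1⟩
  have huniq : ∀ p ∈ fibre Z b, ∀ p' ∈ fibre Z b, ∀ q, q ∈ N p → q ∈ N p' → p = p' := by
    intro p hp p' hp' q hq hq'
    by_contra hne
    exact disjoint_left.1 (hWd hp hp' hne) hq.2 hq'.2
  set Λ : Space → Space := fun q => if h : ∃ p ∈ fibre Z b, q ∈ N p then h.choose else q with hΛ
  have hΛeq : ∀ p ∈ fibre Z b, ∀ q ∈ N p, Λ q = p := by
    intro p hp q hq
    have h : ∃ p ∈ fibre Z b, q ∈ N p := ⟨p, hp, hq⟩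
    simp only [hΛ, dif_pos h]
    exact huniq _ h.choose_spec.1 _ hp q h.choose_spec.2 hq
  obtain ⟨δ₁, hδ₁, htube⟩ := exists_tube hZc (continuous_apply (0 : Fin 3)) b N
    (fun p hp _ => (hNo p hp).mem_nhds (hNp p hp))
  have hsurj : ∀ p ∈ fibre Z b, ∀ w : Space, w 0 ≠ 0 → ∀ᶠ x in 𝓝 b,
      p + ((x - b) / w 0) • w ∈ N p := by
    intro p hp w hw
    have hc : Continuous fun x : ℝ => p + ((x - b) / w 0) • w := by fun_prop
    refine hc.continuousAt.eventually ?_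
    simpa using (hNo p hp.1).mem_nhds (hNp p hp.1)
  obtain ⟨δ₂, hδ₂, hball⟩ := Metric.eventually_nhds_iff.1 ((eventually_all_finite hFf).2 fun p hp =>
    (hsurj p hp (u p) (hu p hp.1).ne).and (hsurj p hp (v p) (hv p hp.1).ne'))
  have hcov : ∀ q ∈ Z, |q 0 - b| < min δ₁ δ₂ → ∃ p ∈ fibre Z b, q ∈ N p := by
    intro q hq hqb
    obtain ⟨p, hp, hpb, hqN⟩ := htube q hq (by
      rw [Real.dist_eq]; exact hqb.trans_le (min_le_left _ _))
    exact ⟨p, ⟨hp, hpb⟩, hqN⟩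
  refine ⟨min δ₁ δ₂, lt_min hδ₁ hδ₂, Λ, ?_, ?_, ?_, ?_, ?_, ?_, ?_, ?_⟩
  · intro q hq hqb
    obtain ⟨p, hp, hqN⟩ := hcov q hq hqb
    rw [hΛeq p hp q hqN]; exact hp
  · intro q hq hqb
    exact hΛeq q ⟨hq, hqb⟩ q (hNp q hq)
  · intro q hq hqb hlt
    obtain ⟨p, hp, hqN⟩ := hcov q hq hqb
    rw [hΛeq p hp q hqN]
    rcases (hOq p hp.1 q hqN.1).1 hq with rfl | ⟨h, -⟩ | ⟨-, t, ht, rfl⟩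
    · exact absurd hp.2 hlt.ne
    · exact h
    · have := mul_pos ht (hv p hp.1)
      simp only [Pi.add_apply, Pi.smul_apply, smul_eq_mul, hp.2] at hlt
      linarith
  · intro q hq hqb hlt
    obtain ⟨p, hp, hqN⟩ := hcov q hq hqb
    rw [hΛeq p hp q hqN]
    rcases (hOq p hp.1 q hqN.1).1 hq with rfl | ⟨-, t, ht, rfl⟩ | ⟨h, -⟩
    · exact absurd hp.2 hlt.ne'
    · have := mul_neg_of_pos_of_neg ht (hu p hp.1)
      simp only [Pi.add_apply, Pi.smul_apply, smul_eq_mul, hp.2] at hlt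
      linarith
    · exact h
  · intro q hq hqb
    obtain ⟨p, hp, hqN⟩ := hcov q hq hqb
    filter_upwards [(hNo p hp.1).mem_nhds hqN] with q' hq' _
    rw [hΛeq p hp q hqN, hΛeq p hp q' hq']
  · intro q hq q' hq' hqb he hΛe
    obtain ⟨p, hp, hqN⟩ := hcov q hq hqb
    obtain ⟨p', hp', hqN'⟩ := hcov q' hq' (he ▸ hqb)
    rw [hΛeq p hp q hqN, hΛeq p' hp' q' hqN'] at hΛe
    subst hΛe
    have hu0 := hu p hp.1
    have hv0 := hv p hp.1
    rcases (hOq p hp.1 q hqN.1).1 hq with rfl | ⟨-, t, ht, rfl⟩ | ⟨-, t, ht, rfl⟩ <;>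
    rcases (hOq _ hp.1 q' hqN'.1).1 hq' with rfl | ⟨-, t', ht', rfl⟩ | ⟨-, t', ht', rfl⟩ <;>
    simp only [Pi.add_apply, Pi.smul_apply, smul_eq_mul] at he <;>
    first
      | rfl
      | (exfalso; nlinarith)
      | skip
    · rw [mul_right_cancel₀ hu0.ne (add_left_cancel he)]
    · rw [mul_right_cancel₀ hv0.ne' (add_left_cancel he)]
  · intro p hp hl x hx1 hx2
    have hmem := (hball (y := x) (by
      rw [Real.dist_eq, abs_sub_lt_iff]
      constructor <;> linarith [min_le_right δ₁ δ₂]) p hp).1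
    have hu0 := hu p hp.1
    refine ⟨_, (hOq p hp.1 _ hmem.1).2 (Or.inr (Or.inl ⟨hl, _, ?_, rfl⟩)), ?_, hΛeq p hp _ hmem⟩
    · exact div_pos_of_neg_of_neg (by linarith) hu0
    · simp only [Pi.add_apply, Pi.smul_apply, smul_eq_mul, hp.2]
      rw [div_mul_cancel₀ _ hu0.ne]; ring
  · intro p hp hr x hx1 hx2
    have hmem := (hball (y := x) (by
      rw [Real.dist_eq, abs_sub_lt_iff]
      constructor <;> linarith [min_le_right δ₁ δ₂]) p hp).2
    have hv0 := hv p hp.1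
    refine ⟨_, (hOq p hp.1 _ hmem.1).2 (Or.inr (Or.inr ⟨hr, _, ?_, rfl⟩)), ?_, hΛeq p hp _ hmem⟩
    · exact div_pos (by linarith) hv0
    · simp only [Pi.add_apply, Pi.smul_apply, smul_eq_mul, hp.2]
      rw [div_mul_cancel₀ _ hv0.ne']; ring

/-- The number of points in the fibres on the right of `b`. -/
theorem IsLabelling.ncard_right {Z : Set Space} {l r : Space → Prop} {b δ : ℝ}
    {Λ : Space → Space} (h : IsLabelling Z l r b δ Λ) {x : ℝ}
    (h1 : b < x) (h2 : x < b + δ) : (fibre Z x).ncard = {p ∈ fibre Z b | r p}.ncard := by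
  have habs : ∀ q ∈ fibre Z x, |q 0 - b| < δ := by
    intro q hq
    rw [hq.2, abs_sub_lt_iff]; constructor <;> linarith
  refine ncard_congr (fun q _ => Λ q) (fun q hq => ⟨h.mem q hq.1 (habs q hq),
    h.right q hq.1 (habs q hq) (by rw [hq.2]; exact h1)⟩)
    (fun q q' hq hq' he => h.inj q hq.1 q' hq'.1 (habs q hq) (hq.2.trans hq'.2.symm) he) ?_
  rintro p ⟨hp, hr⟩
  obtain ⟨q, hq, hqx, he⟩ := h.surj_right p hp hr x h1 h2
  exact ⟨q, ⟨hq, hqx⟩, he⟩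

/-- The number of points in the fibres on the left of `b`. -/
theorem IsLabelling.ncard_left {Z : Set Space} {l r : Space → Prop} {b δ : ℝ}
    {Λ : Space → Space} (h : IsLabelling Z l r b δ Λ) {x : ℝ}
    (h1 : b - δ < x) (h2 : x < b) : (fibre Z x).ncard = {p ∈ fibre Z b | l p}.ncard := by
  have habs : ∀ q ∈ fibre Z x, |q 0 - b| < δ := by
    intro q hq
    rw [hq.2, abs_sub_lt_iff]; constructor <;> linarith
  refine ncard_congr (fun q _ => Λ q) (fun q hq => ⟨h.mem q hq.1 (habs q hq),
    h.left q hq.1 (habs q hq) (by rw [hq.2]; exact h2)⟩)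
    (fun q q' hq hq' he => h.inj q hq.1 q' hq'.1 (habs q hq) (hq.2.trans hq'.2.symm) he) ?_
  rintro p ⟨hp, hr⟩
  obtain ⟨q, hq, hqx, he⟩ := h.surj_left p hp hr x h1 h2
  exact ⟨q, ⟨hq, hqx⟩, he⟩

/-- Over the interval `[a, b]` the set `Z` splits into open and closed pieces (indexed by labels)
each of which is projected injectively. -/
def SplitsOver (Z : Set Space) (a b : ℝ) : Prop :=
  ∃ (ι : Type) (μ : Space → ι), (∀ q ∈ Z, q 0 ∈ Icc a b → ∀ᶠ q' in 𝓝 q, q' ∈ Z → q' 0 ∈ Icc a b →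
    μ q' = μ q) ∧ ∀ q ∈ Z, ∀ q' ∈ Z, q 0 ∈ Icc a b → q 0 = q' 0 → μ q = μ q' → q = q'

/-- The pieces over two adjacent intervals are glued along the points of the common fibre. -/
theorem SplitsOver.glue {Z : Set Space} {a b c : ℝ} (hab : a ≤ b) (hbc : b ≤ c)
    (h1 : SplitsOver Z a b) (h2 : SplitsOver Z b c) : SplitsOver Z a c := by
  classical
  obtain ⟨ι, μ, hμ, hμi⟩ := h1
  obtain ⟨κ, η, hη, hηi⟩ := h2
  -- A piece that meets the common fibre is labelled by its only point in this fibre, on both sides.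
  set α : Space → Space ⊕ (ι ⊕ κ) := fun q =>
    if h : ∃ z ∈ fibre Z b, μ z = μ q then .inl h.choose else .inr (.inl (μ q)) with hα
  set β : Space → Space ⊕ (ι ⊕ κ) := fun q =>
    if h : ∃ z ∈ fibre Z b, η z = η q then .inl h.choose else .inr (.inr (η q)) with hβ
  have hbab : b ∈ Icc a b := ⟨hab, le_rfl⟩
  have hbbc : b ∈ Icc b c := ⟨le_rfl, hbc⟩
  have hαb : ∀ q ∈ fibre Z b, α q = .inl q := by
    intro q hq
    have h : ∃ z ∈ fibre Z b, μ z = μ q := ⟨q, hq, rfl⟩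
    simp only [hα, dif_pos h, Sum.inl.injEq]
    obtain ⟨h3, h4⟩ := h.choose_spec
    exact hμi _ h3.1 _ hq.1 (by rw [h3.2]; exact hbab) (h3.2.trans hq.2.symm) h4
  have hβb : ∀ q ∈ fibre Z b, β q = .inl q := by
    intro q hq
    have h : ∃ z ∈ fibre Z b, η z = η q := ⟨q, hq, rfl⟩
    simp only [hβ, dif_pos h, Sum.inl.injEq]
    obtain ⟨h3, h4⟩ := h.choose_spec
    exact hηi _ h3.1 _ hq.1 (by rw [h3.2]; exact hbbc) (h3.2.trans hq.2.symm) h4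
  have hαμ : ∀ q q', μ q = μ q' → α q = α q' := by
    intro q q' h; simp only [hα, h]
  have hβη : ∀ q q', η q = η q' → β q = β q' := by
    intro q q' h; simp only [hβ, h]
  have hμα : ∀ q q', α q = α q' → μ q = μ q' := by
    intro q q' h
    simp only [hα] at h
    split_ifs at h with e1 e2 e2
    · rw [← e1.choose_spec.2, ← e2.choose_spec.2, Sum.inl.inj h]
    · exact Sum.inl.inj (Sum.inr.inj h)
  have hηβ : ∀ q q', β q = β q' → η q = η q' := by
    intro q q' h
    simp only [hβ] at h
    split_ifs at h with e1 e2 e2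
    · rw [← e1.choose_spec.2, ← e2.choose_spec.2, Sum.inl.inj h]
    · exact Sum.inr.inj (Sum.inr.inj h)
  refine ⟨_, fun q => if q 0 ≤ b then α q else β q, ?_, ?_⟩
  · intro q hq hqI
    rcases lt_trichotomy (q 0) b with hlt | heq | hlt
    · have hev : ∀ᶠ q' : Space in 𝓝 q, q' 0 < b :=
        (continuous_apply (0 : Fin 3)).continuousAt.eventually (gt_mem_nhds hlt)
      filter_upwards [hev, hμ q hq ⟨hqI.1, hlt.le⟩] with q' h3 h4 hq' hI
      rw [if_pos h3.le, if_pos hlt.le]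
      exact hαμ _ _ (h4 hq' ⟨hI.1, h3.le⟩)
    · filter_upwards [hμ q hq (by rw [heq]; exact hbab), hη q hq (by rw [heq]; exact hbbc)]
        with q' h3 h4 hq' hI
      rw [if_pos heq.le, hαb q ⟨hq, heq⟩]
      split_ifs with h5
      · rw [hαμ _ _ (h3 hq' ⟨hI.1, h5⟩), hαb q ⟨hq, heq⟩]
      · rw [hβη _ _ (h4 hq' ⟨(not_le.1 h5).le, hI.2⟩), hβb q ⟨hq, heq⟩]
    · have hev : ∀ᶠ q' : Space in 𝓝 q, b < q' 0 :=
        (continuous_apply (0 : Fin 3)).continuousAt.eventually (lt_mem_nhds hlt)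
      filter_upwards [hev, hη q hq ⟨hlt.le, hqI.2⟩] with q' h3 h4 hq' hI
      rw [if_neg h3.not_ge, if_neg hlt.not_ge]
      exact hβη _ _ (h4 hq' ⟨h3.le, hI.2⟩)
  · intro q hq q' hq' hqI he h
    simp only [← he] at h
    split_ifs at h with h5
    · exact hμi q hq q' hq' ⟨hqI.1, h5⟩ he (hμα _ _ h)
    · exact hηi q hq q' hq' ⟨(not_le.1 h5).le, hqI.2⟩ he (hηβ _ _ h)

/-- A finite cover of the interval by short intervals with labellings is glued together. -/
theorem splitsOver_Icc {Z : Set Space} (hZc : IsCompact Z) {l r : Space → Prop}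
    (hZ : ∀ p ∈ Z, IsStrandAt Z p (l p) (r p)) {a b : ℝ} (hab : a ≤ b) : SplitsOver Z a b := by
  choose δ hδ Λ hΛ using exists_labelling hZc hZ
  have hloc : ∀ x s t, Icc s t ⊆ Ioo (x - δ x) (x + δ x) → SplitsOver Z s t := by
    intro x s t hst
    have habs : ∀ q : Space, q 0 ∈ Icc s t → |q 0 - x| < δ x := by
      intro q hq
      have := hst hq
      rw [abs_sub_lt_iff]; constructor <;> linarith [this.1, this.2]
    refine ⟨Space, Λ x, fun q hq hI => ?_, fun q hq q' hq' hI he h =>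
      (hΛ x).inj q hq q' hq' (habs q hI) he h⟩
    filter_upwards [(hΛ x).eventually_eq q hq (habs q hI)] with q' h hq' _
    exact h hq'
  obtain ⟨t, ht0, htm, ⟨m, hm⟩, htc⟩ := exists_monotone_Icc_subset_open_cover_Icc hab
    (c := fun x : ℝ => {y : Icc a b | (y : ℝ) ∈ Ioo (x - δ x) (x + δ x)})
    (fun x => isOpen_Ioo.preimage continuous_subtype_val)
    (fun y _ => mem_iUnion.2 ⟨(y : ℝ), by
      simp only [mem_ofPred_eq, mem_Ioo]; constructor <;> linarith [hδ (y : ℝ)]⟩)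
  have hsub : ∀ n, SplitsOver Z (t n) (t (n + 1)) := by
    intro n
    obtain ⟨x, hx⟩ := htc n
    refine hloc x _ _ fun y hy => ?_
    exact hx (a := ⟨y, (t n).2.1.trans hy.1, hy.2.trans (t (n + 1)).2.2⟩) hy
  have hall : ∀ n, SplitsOver Z a (t (n + 1)) := by
    intro n
    induction n with
    | zero => have := hsub 0; rwa [ht0] at this
    | succ n ih =>
      exact ih.glue (t (n + 1)).2.1 (htm (Nat.le_succ _)) (hsub (n + 1))
  have := hall m
  rwa [hm (m + 1) (Nat.le_succ m)] at this

/-- The abscissa is injective on each connected component of a compact union of strands. -/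
theorem injOn_connectedComponentIn {Z : Set Space} (hZc : IsCompact Z) {l r : Space → Prop}
    (hZ : ∀ p ∈ Z, IsStrandAt Z p (l p) (r p)) (p : Space) :
    InjOn (fun q : Space => q 0) (connectedComponentIn Z p) := by
  intro q hq q' hq' he
  have hsub := connectedComponentIn_subset Z p
  obtain ⟨R, hR⟩ := (hZc.image (continuous_apply (0 : Fin 3))).isBounded.subset_closedBall 0
  have hI : ∀ z ∈ Z, z 0 ∈ Icc (-R) R := by
    intro z hz
    have := hR ⟨z, hz, rfl⟩
    rw [mem_closedBall_zero_iff, Real.norm_eq_abs] at this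
    exact abs_le.1 this
  obtain ⟨ι, μ, hμ, hinj⟩ := splitsOver_Icc hZc hZ ((hI q (hsub hq)).1.trans (hI q (hsub hq)).2)
  -- The labels are locally constant, hence constant on connected sets.
  let _ : TopologicalSpace ι := ⊥
  have : DiscreteTopology ι := ⟨rfl⟩
  have hcont : ContinuousOn μ (connectedComponentIn Z p) := by
    intro z hz
    have : μ =ᶠ[𝓝[connectedComponentIn Z p] z] fun _ => μ z := by
      filter_upwards [mem_nhdsWithin_of_mem_nhds (hμ z (hsub hz) (hI z (hsub hz))),
        self_mem_nhdsWithin] with z' h3 h4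
      exact h3 (hsub h4) (hI z' (hsub h4))
    exact continuousWithinAt_const.congr_of_eventuallyEq this rfl
  exact hinj q (hsub hq) q' (hsub hq') (hI q (hsub hq)) he
    (isPreconnected_connectedComponentIn.constant hcont hq hq')

/-! ### Letters on the axis -/

theorem mem_page_iff_of_axis {A w : Space} (hA : A ∈ axis) {t : ℝ} (ht : 0 < t) (i : ZMod 3) :
    A + t • w ∈ page i ↔ w ∈ page i := by
  have h : ∀ i : ZMod 3, i = 0 ∨ i = 1 ∨ i = 2 := by decide
  have e1 : (A + t • w : Space) 1 = t * w 1 := by simp [hA.1]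
  have e2 : (A + t • w : Space) 2 = t * w 2 := by simp [hA.2]
  rcases h i with rfl | rfl | rfl
  · rw [mem_page_zero, mem_page_zero, e1, e2, mul_eq_zero_iff_left ht.ne',
      mul_nonneg_iff_of_pos_left ht]
  · rw [mem_page_one, mem_page_one, e1, e2, mul_eq_zero_iff_left ht.ne',
      mul_nonneg_iff_of_pos_left ht]
  · rw [mem_page_two, mem_page_two, e1, e2, mul_eq_zero_iff_left ht.ne',
      mul_nonpos_iff_pos_imp_nonpos]
    exact and_congr_right fun _ => ⟨fun h => h.1 ht, fun h => ⟨fun _ => h, fun _ => ht.le⟩⟩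

theorem axis_subset_page (i : ZMod 3) : axis ⊆ page i := by
  have h : ∀ i : ZMod 3, i = 0 ∨ i = 1 ∨ i = 2 := by decide
  intro p hp
  rcases h i with rfl | rfl | rfl
  · exact mem_page_zero.2 ⟨hp.2, hp.1.ge⟩
  · exact mem_page_one.2 ⟨hp.1, hp.2.ge⟩
  · exact mem_page_two.2 ⟨hp.2, hp.1.le⟩

theorem page_inter_page {i j : ZMod 3} (hij : i ≠ j) {p : Space} (hi : p ∈ page i)
    (hj : p ∈ page j) : p ∈ axis := by
  have h : ∀ i : ZMod 3, i = 0 ∨ i = 1 ∨ i = 2 := by decide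
  rcases h i with rfl | rfl | rfl <;> rcases h j with rfl | rfl | rfl <;>
  simp only [mem_page_zero, mem_page_one, mem_page_two, ne_eq, not_true_eq_false] at hi hj hij <;>
  first
    | exact ⟨hi.1, hj.1⟩
    | exact ⟨hj.1, hi.1⟩
    | exact ⟨le_antisymm hj.2 hi.2, hi.1⟩
    | exact ⟨le_antisymm hi.2 hj.2, hi.1⟩

theorem isClosed_page (i : ZMod 3) : IsClosed (page i) := by
  have h : ∀ i : ZMod 3, i = 0 ∨ i = 1 ∨ i = 2 := by decide
  have c : ∀ k : Fin 3, Continuous fun p : Space => p k := fun k => continuous_apply k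
  rcases h i with rfl | rfl | rfl
  · have : page 0 = {p | p 2 = 0} ∩ {p | 0 ≤ p 1} := by ext p; exact mem_page_zero
    rw [this]
    exact (isClosed_eq (c 2) continuous_const).inter (isClosed_le continuous_const (c 1))
  · have : page 1 = {p | p 1 = 0} ∩ {p | 0 ≤ p 2} := by ext p; exact mem_page_one
    rw [this]
    exact (isClosed_eq (c 1) continuous_const).inter (isClosed_le continuous_const (c 2))
  · have : page 2 = {p | p 2 = 0} ∩ {p | p 1 ≤ 0} := by ext p; exact mem_page_two
    rw [this]
    exact (isClosed_eq (c 2) continuous_const).inter (isClosed_le (c 1) continuous_const)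

theorem isClosed_axis : IsClosed axis :=
  (isClosed_eq (continuous_apply 1) continuous_const).inter
    (isClosed_eq (continuous_apply 2) continuous_const)

theorem arcDirections_page {k : ZMod 3 × Side} {w : Space} (h : w ∈ arcDirections k) :
    w ∈ page k.1 ∧ w ∉ axis := by
  obtain ⟨j, _ | _⟩ := k
  exacts [⟨h.1, h.2.1⟩, ⟨h.1, h.2.1⟩]

theorem Letter.arcs_nonempty (l : Letter) : l.arcs.Nonempty := by
  cases l <;> exact ⟨_, Or.inl rfl⟩

theorem HasLetter.mem {Y : Set Space} {A : Space} {l : Letter} (h : HasLetter Y A l) : A ∈ Y := by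
  obtain ⟨v, -, hL⟩ := h
  exact hL.mem (l.arcs_nonempty.image v)

theorem HasLetter.eventually_axis {Y : Set Space} {A : Space} {l : Letter} (hA : A ∈ axis)
    (h : HasLetter Y A l) : ∀ᶠ q in 𝓝 A, q ∈ Y → q ∈ axis → q = A := by
  obtain ⟨v, hv, hL⟩ := h
  filter_upwards [hL] with q hq hqY hqA
  obtain ⟨_, ⟨k, hk, rfl⟩, t, ht, rfl⟩ := hq.1 hqY
  rcases ht.eq_or_lt with rfl | ht
  · simp
  · exfalso
    apply (arcDirections_page (hv k hk)).2
    have h1 := hqA.1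
    have h2 := hqA.2
    simp only [Pi.add_apply, Pi.smul_apply, smul_eq_mul, hA.1, hA.2, zero_add] at h1 h2
    exact ⟨(mul_eq_zero.1 h1).resolve_left ht.ne', (mul_eq_zero.1 h2).resolve_left ht.ne'⟩

/-- The part of a letter in the page `i`. -/
theorem HasLetter.isStrandAt {Y : Set Space} {A : Space} {l : Letter} (hA : A ∈ axis)
    (h : HasLetter Y A l) (i : ZMod 3) :
    IsStrandAt (Y ∩ page i) A ((i, .left) ∈ l.arcs) ((i, .right) ∈ l.arcs) := by
  classical
  have hAY := h.mem
  obtain ⟨w, hw, hL⟩ := h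
  refine ⟨if (i, .left) ∈ l.arcs then w (i, .left) else ![-1, 0, 0],
    if (i, .right) ∈ l.arcs then w (i, .right) else ![1, 0, 0], ?_, ?_, ?_⟩
  · split_ifs with hk
    exacts [(hw _ hk).2.2, by simp]
  · split_ifs with hk
    exacts [(hw _ hk).2.2, by simp]
  filter_upwards [hL] with q hq
  constructor
  · rintro ⟨hqY, hqi⟩
    obtain ⟨_, ⟨k, hk, rfl⟩, t, ht, rfl⟩ := hq.1 hqY
    rcases ht.eq_or_lt with rfl | ht
    · left; simp
    · rw [mem_page_iff_of_axis hA ht] at hqi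
      have hkp := arcDirections_page (hw k hk)
      have : k.1 = i := by
        by_contra hne
        exact hkp.2 (page_inter_page hne hkp.1 hqi)
      right
      obtain ⟨j, _ | _⟩ := k
      · obtain rfl : j = i := this
        exact Or.inl ⟨hk, t, ht, by rw [if_pos hk]⟩
      · obtain rfl : j = i := this
        exact Or.inr ⟨hk, t, ht, by rw [if_pos hk]⟩
  · rintro (rfl | ⟨hk, t, ht, rfl⟩ | ⟨hk, t, ht, rfl⟩)
    · exact ⟨hAY, axis_subset_page i hA⟩
    · rw [if_pos hk] at hq ⊢
      exact ⟨hq.2 ⟨_, mem_image_of_mem w hk, t, ht.le, rfl⟩,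
        (mem_page_iff_of_axis hA ht i).2 (hw _ hk).1⟩
    · rw [if_pos hk] at hq ⊢
      exact ⟨hq.2 ⟨_, mem_image_of_mem w hk, t, ht.le, rfl⟩,
        (mem_page_iff_of_axis hA ht i).2 (hw _ hk).1⟩

/-- Two arcs in different pages form a letter. -/
theorem exists_letter_of_arcs {Y : Set Space} {A u v : Space} {k k' : ZMod 3 × Side}
    (hk : k.1 ≠ k'.1) (hu : u ∈ arcDirections k) (hv : v ∈ arcDirections k')
    (hL : LooksLike Y A {u, v}) : ∃ l, HasLetter Y A l := by
  classical
  have key : ∀ (m : ZMod 3) (s s' : Side) (u v : Space), u ∈ arcDirections (m - 1, s) →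
      v ∈ arcDirections (m + 1, s') → LooksLike Y A {u, v} → ∃ l, HasLetter Y A l := by
    intro m s s' u v hu hv hL
    have hne : ∀ m : ZMod 3, m + 1 ≠ m - 1 := by decide
    obtain ⟨l, hl⟩ : ∃ l : Letter, l.arcs = {(m - 1, s), (m + 1, s')} := by
      cases s <;> cases s'
      exacts [⟨.c m, rfl⟩, ⟨.b m, rfl⟩, ⟨.d m, rfl⟩, ⟨.a m, rfl⟩]
    refine ⟨l, fun k => if k.1 = m - 1 then u else v, ?_, ?_⟩
    · rw [hl]
      rintro k (rfl | rfl)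
      · simpa using hu
      · simpa only [if_neg (hne m)] using hv
    · rw [hl, image_pair, if_pos rfl, if_neg (hne m)]
      exact hL
  have hcases : ∀ i j : ZMod 3, i ≠ j → (∃ m, i = m - 1 ∧ j = m + 1) ∨
      ∃ m, j = m - 1 ∧ i = m + 1 := by decide
  obtain ⟨i, s⟩ := k
  obtain ⟨j, s'⟩ := k'
  rcases hcases i j hk with ⟨m, rfl, rfl⟩ | ⟨m, rfl, rfl⟩
  · exact key m s s' u v hu hv hL
  · rw [pair_comm] at hL
    exact key m s' s v u hv hu hL

namespace BookPicture

/-- Every point of `Y` on the axis has a letter. -/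
theorem exists_letter {Y Z : Set Space} (h : BookPicture Y Z) {A : Space} (hA : A ∈ Y)
    (hAx : A ∈ ThreePage.axis) :
    ∃ l, HasLetter Y A l := by
  by_cases hZ : A ∈ Z
  · obtain ⟨-, -, v, h1, h2⟩ := h.singular A hZ
    exact ⟨_, v, h1, h2⟩
  · obtain ⟨k, k', hk, u, hu, v, hv, hL⟩ := h.axis A hA hAx hZ
    exact exists_letter_of_arcs hk hu hv hL

/-- The points of `Y` on the axis are isolated, and `Y` is compact. -/
theorem finite_inter_axis {Y Z : Set Space} (h : BookPicture Y Z) :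
    (Y ∩ ThreePage.axis).Finite := by
  have hc : IsCompact (Y ∩ ThreePage.axis) := h.compact.inter_right isClosed_axis
  obtain ⟨t, -, ht⟩ := hc.elim_nhds_subcover (fun A => {q | q ∈ Y → q ∈ ThreePage.axis → q = A}) (by
    intro A hA
    obtain ⟨l, hl⟩ := h.exists_letter hA.1 hA.2
    exact hl.eventually_axis hA.2)
  refine t.finite_toSet.subset fun p hp => ?_
  obtain ⟨q, hq, hpq⟩ := mem_iUnion₂.1 (ht hp)
  rw [hpq hp.1 hp.2]; exact hq

/-- Away from the axis only one page is met, and the picture is a single arc. -/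
theorem isStrandAt_off {Y Z : Set Space} (h : BookPicture Y Z) {A : Space}
    {i : ZMod 3} (hA : A ∈ Y) (hAi : A ∈ page i)
    (hAx : A ∉ ThreePage.axis) : IsStrandAt (Y ∩ page i) A True True := by
  obtain ⟨u, v, hu, hv, hL⟩ := h.off_axis A hA hAx
  have hi : ∀ᶠ q in 𝓝 A, ∀ j, j ≠ i → q ∉ page j := by
    refine eventually_all.2 fun j => ?_
    by_cases hj : j = i
    · exact Eventually.of_forall fun _ hn => absurd hj hn
    · filter_upwards [(isClosed_page j).isOpen_compl.mem_nhds
        (fun hAj => hAx (page_inter_page hj hAj hAi))] with q hq _ using hq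
  refine ⟨u, v, hu, hv, ?_⟩
  filter_upwards [hL, hi] with q hq hqi
  have hY : q ∈ Y ∩ page i ↔ q ∈ Y := by
    refine ⟨fun h => h.1, fun hqY => ⟨hqY, ?_⟩⟩
    obtain ⟨j, hj⟩ := mem_iUnion.1 (h.subset_book hqY)
    by_cases hji : j = i
    · exact hji ▸ hj
    · exact absurd hj (hqi j hji)
  rw [hY, hq]
  simp only [true_and]
  constructor
  · rintro ⟨w, rfl | rfl, t, ht, rfl⟩ <;> rcases ht.eq_or_lt with rfl | ht
    · left; simp
    · exact Or.inr (Or.inl ⟨t, ht, rfl⟩)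
    · left; simp
    · exact Or.inr (Or.inr ⟨t, ht, rfl⟩)
  · rintro (rfl | ⟨t, ht, rfl⟩ | ⟨t, ht, rfl⟩)
    · exact ⟨u, Or.inl rfl, 0, le_rfl, by simp⟩
    · exact ⟨u, Or.inl rfl, t, ht.le, rfl⟩
    · exact ⟨v, Or.inr rfl, t, ht.le, rfl⟩

end BookPicture

/-- A letter of `Y` at a point of the axis; the value is irrelevant if there is none. -/
noncomputable def letterAt (Y : Set Space) (A : Space) : Letter :=
  open Classical in if h : ∃ l, HasLetter Y A l then h.choose else .a 0

/-- The condition that `Y` has an arc in the page `i` that issues from `p` to the side `s`. It holds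
at the points away from the axis, which have arcs on both sides. -/
def HasArc (Y : Set Space) (i : ZMod 3) (s : Side) (p : Space) : Prop :=
  p ∈ axis → (i, s) ∈ (letterAt Y p).arcs

theorem BookPicture.hasLetter {Y Z : Set Space} (h : BookPicture Y Z) {A : Space} (hA : A ∈ Y)
    (hAx : A ∈ ThreePage.axis) : HasLetter Y A (letterAt Y A) := by
  have := h.exists_letter hA hAx
  rw [letterAt, dif_pos this]
  exact this.choose_spec

theorem BookPicture.isStrandAt {Y Z : Set Space} (h : BookPicture Y Z) (i : ZMod 3) {p : Space}
    (hp : p ∈ Y ∩ page i) :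
    IsStrandAt (Y ∩ page i) p (HasArc Y i .left p) (HasArc Y i .right p) := by
  by_cases hA : p ∈ ThreePage.axis
  · have := (h.hasLetter hp.1 hA).isStrandAt hA i
    simpa only [HasArc, hA, true_imp_iff] using this
  · have := h.isStrandAt_off hp.1 hp.2 hA
    simpa only [HasArc, hA, false_imp_iff] using this

theorem BookPicture.isCompact_inter_page {Y Z : Set Space} (h : BookPicture Y Z) (i : ZMod 3) :
    IsCompact (Y ∩ page i) :=
  h.compact.inter_right (isClosed_page i)

/-! ### Balanced words -/

/-- The list of brackets leads from the height `m` to the height `n`, where a left bracket is a step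
up and a right bracket a step down, and does not go below zero. -/
inductive Climb : ℕ → List DyckStep → ℕ → Prop
  | nil (n : ℕ) : Climb n [] n
  | up {m n : ℕ} {l : List DyckStep} : Climb (m + 1) l n → Climb m (.U :: l) n
  | down {m n : ℕ} {l : List DyckStep} : Climb m l n → Climb (m + 1) (.D :: l) n

theorem Climb.append {m n k : ℕ} {l l' : List DyckStep} (h : Climb m l n) (h' : Climb n l' k) :
    Climb m (l ++ l') k := by
  induction h with
  | nil => exact h'
  | up _ ih => exact (ih h').up
  | down _ ih => exact (ih h').down

theorem Climb.count {m n : ℕ} {l : List DyckStep} (h : Climb m l n) :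
    m + l.count .U = n + l.count .D ∧
      ∀ i, (l.take i).count .D ≤ m + (l.take i).count .U := by
  induction h with
  | nil => simp
  | up _ ih =>
    refine ⟨by simp only [List.count_cons]; simp; omega, fun i => ?_⟩
    cases i with
    | zero => simp
    | succ i => have := ih.2 i; simp only [List.take_succ_cons, List.count_cons]; simp; omega
  | down _ ih =>
    refine ⟨by simp only [List.count_cons]; simp; omega, fun i => ?_⟩
    cases i with
    | zero => simp
    | succ i => have := ih.2 i; simp only [List.take_succ_cons, List.count_cons]; simp; omega

theorem Climb.exists_dyckWord {l : List DyckStep} (h : Climb 0 l 0) :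
    ∃ p : DyckWord, p.toList = l :=
  ⟨⟨l, by simpa using h.count.1, fun i => by simpa using h.count.2 i⟩, rfl⟩

open Classical in
/-- The brackets of a letter: the arc on the left closes a bracket, the arc on the right opens
one. -/
theorem Letter.brackets_eq (i : ZMod 3) (l : Letter) : l.brackets i =
    (if (i, Side.left) ∈ l.arcs then [.D] else []) ++
      if (i, Side.right) ∈ l.arcs then [.U] else [] := by
  have h1 : ∀ i j : ZMod 3, i = j ∨ i = j - 1 ∨ i = j + 1 := by decide
  have d1 : ∀ j : ZMod 3, j ≠ j - 1 := by decide
  have d2 : ∀ j : ZMod 3, j ≠ j + 1 := by decide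
  have d3 : ∀ j : ZMod 3, j + 1 ≠ j - 1 := by decide
  have d4 : ∀ j : ZMod 3, j = j + 1 + 1 ↔ False := by decide
  have d5 : ∀ j : ZMod 3, j = j - 1 - 1 ↔ False := by decide
  cases l with
  | a j | b j | c j | d j | x j =>
    rcases h1 i j with rfl | rfl | rfl <;>
    simp [Letter.brackets, Letter.arcs, d1, d2, d3, (d3 _).symm, d4, d5]

open Classical in
theorem Letter.climb (i : ZMod 3) (l : Letter) (n : ℕ) :
    Climb (n + if (i, Side.left) ∈ l.arcs then 1 else 0) (l.brackets i)
      (n + if (i, Side.right) ∈ l.arcs then 1 else 0) := by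
  rw [Letter.brackets_eq]
  split_ifs
  · exact .down (.up (.nil _))
  · exact .down (.nil _)
  · exact .up (.nil _)
  · exact .nil _

/-! ### The word of a picture in the book -/

theorem axisPoint_mem_axis (b : ℝ) : axisPoint b ∈ axis := ⟨rfl, rfl⟩

theorem eq_axisPoint {p : Space} (hp : p ∈ axis) : p = axisPoint (p 0) := by
  ext i; fin_cases i
  exacts [rfl, hp.1, hp.2]

namespace BookPicture

/-- The number of points in the fibre is locally constant away from the points on the axis. -/
theorem eventually_ncard_fibre {Y Z : Set Space} (h : BookPicture Y Z) (i : ZMod 3) {b : ℝ}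
    (hb : axisPoint b ∉ Y) :
    ∀ᶠ x in 𝓝 b, (fibre (Y ∩ page i) x).ncard = (fibre (Y ∩ page i) b).ncard := by
  obtain ⟨δ, hδ, Λ, hΛ⟩ := exists_labelling (h.isCompact_inter_page i)
    (fun p hp => h.isStrandAt i hp) b
  have hall : ∀ s, {p ∈ fibre (Y ∩ page i) b | HasArc Y i s p} = fibre (Y ∩ page i) b := by
    intro s
    refine sep_eq_self_iff_mem_true.2 fun p hp hpx => ?_
    have he := eq_axisPoint hpx
    rw [hp.2] at he
    exact absurd (he ▸ hp.1.1) hb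
  filter_upwards [Ioo_mem_nhds (sub_lt_self b hδ) (lt_add_of_pos_right b hδ)] with x hx
  rcases lt_trichotomy x b with hxb | rfl | hxb
  · rw [hΛ.ncard_left hx.1 hxb, hall]
  · rfl
  · rw [hΛ.ncard_right hxb hx.2, hall]

/-- All points of the fibre away from the axis have an arc to the side `s`; the point on the axis
has one if its letter does. -/
theorem ncard_hasArc {Y Z : Set Space} (h : BookPicture Y Z) (i : ZMod 3) {b : ℝ}
    (hb : axisPoint b ∈ Y) (s : Side) [Decidable ((i, s) ∈ (letterAt Y (axisPoint b)).arcs)] :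
    {p ∈ fibre (Y ∩ page i) b | HasArc Y i s p}.ncard =
      {p ∈ fibre (Y ∩ page i) b | p ∉ ThreePage.axis}.ncard +
        if (i, s) ∈ (letterAt Y (axisPoint b)).arcs then 1 else 0 := by
  have hF := finite_fibre (h.isCompact_inter_page i) (fun p hp => h.isStrandAt i hp) b
  have hpt : ∀ p ∈ fibre (Y ∩ page i) b, p ∈ ThreePage.axis → p = axisPoint b := by
    intro p hp hpx
    rw [eq_axisPoint hpx, hp.2]
  have hbF : axisPoint b ∈ fibre (Y ∩ page i) b :=
    ⟨⟨hb, axis_subset_page i (axisPoint_mem_axis b)⟩, rfl⟩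
  split_ifs with harc
  · rw [← ncard_insert_of_notMem (a := axisPoint b)
      (s := {p ∈ fibre (Y ∩ page i) b | p ∉ ThreePage.axis})
      (fun hn => hn.2 (axisPoint_mem_axis b)) (hF.subset (sep_subset _ _))]
    congr 1
    ext p
    constructor
    · rintro ⟨hp, -⟩
      by_cases hpx : p ∈ ThreePage.axis
      · exact Or.inl (hpt p hp hpx)
      · exact Or.inr ⟨hp, hpx⟩
    · rintro (rfl | ⟨hp, hpx⟩)
      · exact ⟨hbF, fun _ => harc⟩
      · exact ⟨hp, fun hn => absurd hn hpx⟩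
  · rw [add_zero]
    congr 1
    ext p
    refine and_congr_right fun hp => ⟨fun ha hpx => harc ?_, fun hpx hn => absurd hn hpx⟩
    rw [← hpt p hp hpx]
    exact ha hpx

open Classical in
/-- The number of points in the fibre changes at a point of the axis according to the arcs of its
letter. -/
theorem exists_ncard_fibre {Y Z : Set Space} (h : BookPicture Y Z) (i : ZMod 3) {b : ℝ}
    (hb : axisPoint b ∈ Y) : ∃ n : ℕ,
    (∀ᶠ x in 𝓝[<] b, (fibre (Y ∩ page i) x).ncard =
      n + if (i, Side.left) ∈ (letterAt Y (axisPoint b)).arcs then 1 else 0) ∧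
    ∀ᶠ x in 𝓝[>] b, (fibre (Y ∩ page i) x).ncard =
      n + if (i, Side.right) ∈ (letterAt Y (axisPoint b)).arcs then 1 else 0 := by
  obtain ⟨δ, hδ, Λ, hΛ⟩ := exists_labelling (h.isCompact_inter_page i)
    (fun p hp => h.isStrandAt i hp) b
  refine ⟨{p ∈ fibre (Y ∩ page i) b | p ∉ ThreePage.axis}.ncard, ?_, ?_⟩
  · filter_upwards [Ioo_mem_nhdsLT (sub_lt_self b hδ)] with x hx
    rw [hΛ.ncard_left hx.1 hx.2, h.ncard_hasArc i hb]
  · filter_upwards [Ioo_mem_nhdsGT (lt_add_of_pos_right b hδ)] with x hx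
    rw [hΛ.ncard_right hx.1 hx.2, h.ncard_hasArc i hb]

/-- The number of points in the fibre does not change over an interval without letters. -/
theorem ncard_fibre_eq {Y Z : Set Space} (h : BookPicture Y Z) (i : ZMod 3) {x₀ x₁ : ℝ}
    (hx : x₀ ≤ x₁) (hno : ∀ x ∈ Icc x₀ x₁, axisPoint x ∉ Y) :
    (fibre (Y ∩ page i) x₀).ncard = (fibre (Y ∩ page i) x₁).ncard := by
  refine isPreconnected_Icc.constant (f := fun x => (fibre (Y ∩ page i) x).ncard) (fun x hxI => ?_)
    (left_mem_Icc.2 hx) (right_mem_Icc.2 hx)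
  refine ContinuousAt.continuousWithinAt ?_
  exact continuousAt_const.congr ((h.eventually_ncard_fibre i (hno x hxI)).mono fun _ h => h.symm)

/-- The brackets of the letters on the right of `x₀` lead from the number of points in the fibre
over `x₀` to zero. -/
theorem climb {Y Z : Set Space} (h : BookPicture Y Z) (i : ZMod 3) :
    ∀ (us : List ℝ) (x₀ : ℝ), us.Pairwise (· < ·) → axisPoint x₀ ∉ Y →
      (∀ b, b ∈ us ↔ x₀ < b ∧ axisPoint b ∈ Y) → Climb (fibre (Y ∩ page i) x₀).ncard
        ((us.map fun b => letterAt Y (axisPoint b)).flatMap (Letter.brackets i)) 0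
  | [], x₀, _, h₀, hmem => by
    -- Without letters on the right of `x₀` all fibres there are empty, like those far away.
    obtain ⟨R, hR⟩ := (h.compact.image (continuous_apply (0 : Fin 3))).bddAbove
    have hx : x₀ ≤ max x₀ (R + 1) := le_max_left _ _
    rw [h.ncard_fibre_eq i hx (by
      intro x hxI hxY
      rcases hxI.1.eq_or_lt with rfl | hlt
      · exact h₀ hxY
      · simpa using (hmem x).2 ⟨hlt, hxY⟩)]
    have hempty : fibre (Y ∩ page i) (max x₀ (R + 1)) = ∅ := by
      refine eq_empty_of_forall_notMem fun p hp => ?_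
      have h1 : p 0 ≤ R := hR ⟨p, hp.1.1, rfl⟩
      have h2 := le_max_right x₀ (R + 1)
      rw [← hp.2] at h2
      linarith
    rw [hempty, ncard_empty]
    exact .nil 0
  | b :: us, x₀, hs, h₀, hmem => by
    classical
    rw [List.pairwise_cons] at hs
    obtain ⟨hxb, hbY⟩ := (hmem b).1 (List.mem_cons_self)
    obtain ⟨n, hn1, hn2⟩ := h.exists_ncard_fibre i hbY
    obtain ⟨x, hxn, hx0, hx⟩ := (hn1.and (Ioo_mem_nhdsLT hxb)).exists
    -- A point `x₁` between `b` and the next letter.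
    have htail : ∀ᶠ x in 𝓝[>] b, ∀ b' ∈ {b' | b' ∈ us}, x < b' :=
      (eventually_all_finite us.finite_toSet).2 fun b' hb' =>
        mem_nhdsWithin_of_mem_nhds (Iio_mem_nhds (hs.1 b' hb'))
    obtain ⟨x₁, ⟨hx₁n, hx₁t⟩, hx₁⟩ := ((hn2.and htail).and self_mem_nhdsWithin).exists
    have hx₁ : b < x₁ := hx₁
    have h₁ : axisPoint x₁ ∉ Y := by
      intro hY
      rcases List.mem_cons.1 ((hmem x₁).2 ⟨hxb.trans hx₁, hY⟩) with he | he
      · exact hx₁.ne' he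
      · exact (hx₁t x₁ he).false
    have ih := h.climb i us x₁ hs.2 h₁ (fun b' => by
      constructor
      · intro hb'
        exact ⟨hx₁t b' hb', ((hmem b').1 (List.mem_cons_of_mem _ hb')).2⟩
      · rintro ⟨hlt, hY⟩
        rcases List.mem_cons.1 ((hmem b').2 ⟨hxb.trans (hx₁.trans hlt), hY⟩) with he | he
        · linarith
        · exact he)
    rw [h.ncard_fibre_eq i hx0.le (by
      intro z hz hzY
      rcases hz.1.eq_or_lt with rfl | hlt
      · exact h₀ hzY
      · rcases List.mem_cons.1 ((hmem z).2 ⟨hlt, hzY⟩) with he | he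
        · linarith [hz.2]
        · linarith [hz.2, hs.1 z he]), hxn, List.map_cons, List.flatMap_cons]
    rw [hx₁n] at ih
    exact (Letter.climb i _ n).append ih

/-- A picture in the book is encoded by a balanced word. -/
theorem exists_word {Y Z : Set Space} (h : BookPicture Y Z) :
    ∃ w, Encodes w Y ∧ IsBalanced w := by
  classical
  have hE : {b : ℝ | axisPoint b ∈ Y}.Finite := by
    refine (h.finite_inter_axis.image fun p : Space => p 0).subset fun b hb => ?_
    exact ⟨axisPoint b, ⟨hb, axisPoint_mem_axis b⟩, rfl⟩
  set us : List ℝ := hE.toFinset.sort with hus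
  have hmem : ∀ b, b ∈ us ↔ axisPoint b ∈ Y := by
    intro b; rw [hus, Finset.mem_sort, hE.mem_toFinset]; rfl
  have hlt : us.SortedLT := Finset.sortedLT_sort _
  refine ⟨us.map fun b => letterAt Y (axisPoint b),
    ⟨fun k => us.get (k.cast (List.length_map _)), ?_, ?_,
    ?_⟩, fun i => ?_⟩
  · intro k k' hk
    exact hlt.strictMono_get hk
  · ext p
    constructor
    · rintro ⟨hp, hpx⟩
      rw [eq_axisPoint hpx] at hp
      obtain ⟨k, hk⟩ := List.get_of_mem ((hmem _).2 hp)
      refine ⟨k.cast (List.length_map _).symm, ?_⟩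
      rw [eq_axisPoint hpx]
      simpa using congrArg axisPoint hk
    · rintro ⟨k, rfl⟩
      exact ⟨(hmem _).1 (List.get_mem _ _), axisPoint_mem_axis _⟩
  · intro k
    have hk : axisPoint (us.get (k.cast (List.length_map _))) ∈ Y := (hmem _).1 (List.get_mem _ _)
    have := h.hasLetter hk (axisPoint_mem_axis _)
    simpa using this
  · obtain ⟨R, hR⟩ := (h.compact.image (continuous_apply (0 : Fin 3))).bddBelow
    have hR' : ∀ x < R, ∀ p ∈ Y, p 0 ≠ x := by
      intro x hx p hp he
      have : R ≤ p 0 := hR ⟨p, hp, rfl⟩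
      linarith
    have hempty : fibre (Y ∩ page i) (R - 1) = ∅ :=
      eq_empty_of_forall_notMem fun p hp => hR' _ (by linarith) p hp.1.1 hp.2
    have := h.climb i us (R - 1) (List.sortedLT_iff_pairwise.1 hlt)
      (fun hY => hR' (R - 1) (by linarith) _ hY rfl) (fun b => by
        rw [hmem]
        refine ⟨fun hb => ⟨?_, hb⟩, fun hb => hb.2⟩
        have : R ≤ axisPoint b 0 := hR ⟨_, hb, rfl⟩
        change R ≤ b at this
        linarith)
    rw [hempty, ncard_empty] at this
    exact this.exists_dyckWord

end BookPicture

/-! ### Three-page embeddings of singular knots -/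

theorem exists_threePageEmbedding (K : SingularKnot) :
    ∃ (Φ : AmbientPLIsotopy) (w : List Letter), IsThreePageEmbedding K (Φ.map 1) ∧
      Encodes w (Φ.map 1 '' K.carrier) ∧ IsBalanced w := by
  obtain ⟨Φ₁, hreg, hsing⟩ := exists_straightening K
  have hsub := SingularKnot.singularPoints_subset K
  obtain ⟨Φ₂, P, hgen, hΦ₂⟩ := exists_generic_position
    (X := Φ₁.map 1 '' K.carrier) (S := Φ₁.map 1 '' K.singularPoints)
    (IsCompact.image K.isCompact_carrier (Φ₁.map 1).continuous) (K.finite.image _)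
    (image_mono hsub) hreg (by
      rintro _ ⟨B, hB, rfl⟩
      exact (hsing B hB).2)
  obtain ⟨Φ₃, hbook, hΦ₃⟩ := hgen.exists_bookPicture
  have hcomp : ∀ A : Set Space, ((Φ₁.trans Φ₂).trans Φ₃).map 1 '' A =
      Φ₃.map 1 '' (Φ₂.map 1 '' (Φ₁.map 1 '' A)) := by
    intro A
    rw [image_image, image_image]; rfl
  obtain ⟨w, hw, hbal⟩ := hbook.exists_word
  refine ⟨(Φ₁.trans Φ₂).trans Φ₃, w, ?_, by rwa [hcomp], hbal⟩
  constructor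
  · rw [hcomp]; exact hbook.subset_book
  · rw [hcomp]; exact fun A hA => (hbook.singular A hA).2.1
  · rw [hcomp]; exact hbook.finite_inter_axis
  · rw [hcomp, hcomp]
    rintro A ⟨hA, hAx⟩ hAS
    obtain ⟨k, k', hk, u, hu, v, hv, hL⟩ := hbook.axis A hA hAx hAS
    exact ⟨k.1, k'.1, hk, u, arcDirections_page hu, v, arcDirections_page hv, hL⟩
  · intro B hB
    -- The pages `0` and `2` form the horizontal plane. The first isotopy makes the template
    -- horizontal, and the other two preserve the horizontal direction near the singular points.
    have hpages : ∀ p : Space, p ∈ page (1 - 1) ∪ page (1 + 1) ↔ p 2 = 0 := by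
      intro p
      rw [show (1 : ZMod 3) - 1 = 0 by decide, show (1 : ZMod 3) + 1 = 2 by decide, mem_union,
        mem_page_zero, mem_page_two]
      constructor
      · rintro (h | h)
        exacts [h.1, h.1]
      · intro h
        exact (le_total 0 (p 1)).imp (fun h' => ⟨h, h'⟩) fun h' => ⟨h, h'⟩
    have hB2 : Φ₂.map 1 (Φ₁.map 1 B) ∈ Φ₂.map 1 '' (Φ₁.map 1 '' K.singularPoints) :=
      mem_image_of_mem _ (mem_image_of_mem _ hB)
    refine ⟨1, ?_, ?_⟩
    · rw [hcomp]
      obtain ⟨-, hAx, v, hv, hL⟩ := hbook.singular _ (mem_image_of_mem (Φ₃.map 1) hB2)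
      filter_upwards [hL] with p hp hpY
      obtain ⟨_, ⟨k, hk, rfl⟩, t, ht, rfl⟩ := hp.1 hpY
      have hk1 : k.1 = 1 - 1 ∨ k.1 = 1 + 1 := by
        rcases hk with rfl | rfl | rfl | rfl <;> simp
      have hvp := (arcDirections_page (hv k hk)).1
      have hpage : ∀ i, v k ∈ page i →
          Φ₃.map 1 (Φ₂.map 1 (Φ₁.map 1 B)) + t • v k ∈ page i := by
        intro i hi
        rcases ht.eq_or_lt with rfl | ht
        · rw [zero_smul, add_zero]; exact axis_subset_page i hAx
        · exact (mem_page_iff_of_axis hAx ht i).2 hi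
      rcases hk1 with h1 | h1
      · exact Or.inl (hpage _ (h1 ▸ hvp))
      · exact Or.inr (hpage _ (h1 ▸ hvp))
    · have ht : Tendsto (fun q => Φ₂.map 1 (Φ₁.map 1 q)) (𝓝 B) (𝓝 (Φ₂.map 1 (Φ₁.map 1 B))) :=
        ((Φ₂.map 1).continuous.comp (Φ₁.map 1).continuous).tendsto B
      filter_upwards [ht.eventually (hΦ₃ _ hB2), (hsing B hB).1] with q h1 h2
      rw [hpages, h2]
      change _ ↔ Φ₃.map 1 (Φ₂.map 1 (Φ₁.map 1 q)) 2 = 0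
      rw [h1, hΦ₂, hΦ₂]
  · intro i p _
    rw [hcomp]
    exact injOn_connectedComponentIn (hbook.isCompact_inter_page i)
      (fun p hp => hbook.isStrandAt i hp) p

end ThreePage

theorem theorem1 (K : ThreePage.SingularKnot) :
    ∃ (Φ : ThreePage.AmbientPLIsotopy) (w : List ThreePage.Letter),
      ThreePage.IsThreePageEmbedding K (Φ.map 1) ∧
      ThreePage.Encodes w (Φ.map 1 '' K.carrier) ∧
      ThreePage.IsBalanced w ∧
      (ThreePage.SK.ofWord w).Represents K := by
  obtain ⟨Φ, w, h1, h2, h3⟩ := ThreePage.exists_threePageEmbedding K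
  exact ⟨Φ, w, h1, h2, h3, Φ, w, h1, h2, h3, rfl⟩
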